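/- Let $\Omega=\{x\in\mathbb R^3:\ |x|>1\}$, let $\nu(x)=x$ for $|x|=1$ be the unit normal on $\partial\Omega=\mathbb S^2$ pointing into $\Omega$, and let $\gamma>0$ be a constant. For $u\in\mathbb C^3$ and $|x|=1$ put $u_{tan}=u-\langle u,\nu(x)\rangle\,\nu(x)$. Let $G_b$ be the Maxwell operator on $\mathcal H=L^2(\Omega;\mathbb C^3)\times L^2(\Omega;\mathbb C^3)$ with dissipative boundary condition, that is, $$G_b(E,B)=(\operatorname{curl}B,\,-\operatorname{curl}E),$$ whose domain $D(G_b)$ is the closure, in the graph norm, of the set of restrictions to $\Omega$ of pairs $(E,B)\in C_c^\infty(\mathbb R^3;\mathbb C^3)^2$ satisfying $$E_{tan}-\gamma\,(\nu\wedge B_{tan})=0\quad\text{on }\mathbb S^2 .$$ **Corollary 3.1.** Let $\gamma>1$. Then there is an infinite sequence $(\lambda_n)_{n\ge 1}$ of real eigenvalues of $G_b$ with $$-\infty<\dots<\lambda_n<\dots<\lambda_2<\lambda_1<0,$$ and for every $n\ge 1$ the eigenvalue $\lambda_n$ has geometric multiplicity $2n+1$, that is, $\dim_{\mathbb C}\{u\in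 D(G_b):\ G_bu=\lambda_nu\}=2n+1$. -/

import Mathlib

open MeasureTheory Set
open scoped ContDiff

noncomputable section

namespace MaxwellExterior

/-- Euclidean space `ℝ³`. -/
abbrev R3 : Type := EuclideanSpace ℝ (Fin 3)

/-- Hermitian space `ℂ³`. -/
abbrev C3 : Type := EuclideanSpace ℂ (Fin 3)

/-- The exterior domain `Ω = {x ∈ ℝ³ : |x| > 1}`; its boundary is the unit sphere. -/
def exteriorDomain : Set R3 := {x | 1 < ‖x‖}

/-- The space `L²(Ω; ℂ³)`. -/
abbrev L2Field : Type := Lp C3 2 ((volume : Measure R3).restrict exteriorDomain)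

/-- The Hilbert space `L²(Ω)⁶ = L²(Ω; ℂ³) ⊕ L²(Ω; ℂ³)` of pairs `(E, B)`. -/
abbrev StateSpace : Type := WithLp 2 (L2Field × L2Field)

/-- The partial derivative `∂_j v_k` at `x` of a vector field. -/
def partialDeriv (v : R3 → C3) (j k : Fin 3) (x : R3) : ℂ :=
  fderiv ℝ (fun y => v y k) x (EuclideanSpace.single j 1)

/-- The curl of a vector field. -/
def curl (v : R3 → C3) (x : R3) : C3 :=
  !₂[partialDeriv v 1 2 x - partialDeriv v 2 1 x,
     partialDeriv v 2 0 x - partialDeriv v 0 2 x,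
     partialDeriv v 0 1 x - partialDeriv v 1 0 x]

/-- The bilinear vector product `a ∧ b` on `ℂ³`. -/
def wedge (a b : C3) : C3 :=
  !₂[a 1 * b 2 - a 2 * b 1, a 2 * b 0 - a 0 * b 2, a 0 * b 1 - a 1 * b 0]

/-- The unit normal on the unit sphere pointing into `Ω`, that is `ν(x) = x`, as a vector
of `ℂ³`. -/
def normal (x : R3) : C3 := WithLp.toLp 2 (fun i => (x i : ℂ))

/-- The tangential part `u_tan = u - ⟨u, ν⟩ ν` at the point `x` of the unit sphere. (The inner
product of Mathlib is linear in its second argument.) -/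
def tangential (x : R3) (u : C3) : C3 := u - inner ℂ (normal x) u • normal x

/-- The dissipative boundary condition `E_tan - γ (ν ∧ B_tan) = 0` on the unit sphere. -/
def BoundaryCondition (γ : ℝ) (v w : R3 → C3) : Prop :=
  ∀ x : R3, ‖x‖ = 1 →
    tangential x (v x) - (γ : ℂ) • wedge (normal x) (tangential x (w x)) = 0

lemma differentiable_comp {v : R3 → C3} (hv : ContDiff ℝ ∞ v) (k : Fin 3) :
    Differentiable ℝ (fun y => v y k) := by
  have h : ContDiff ℝ ∞ (fun y => v y k) := by fun_prop
  exact h.differentiable (by simp)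

lemma partialDeriv_add {v w : R3 → C3} (hv : ContDiff ℝ ∞ v) (hw : ContDiff ℝ ∞ w)
    (j k : Fin 3) (x : R3) :
    partialDeriv (v + w) j k x = partialDeriv v j k x + partialDeriv w j k x := by
  have h := fderiv_add (differentiable_comp hv k x) (differentiable_comp hw k x)
  have e : (fun y => (v + w) y k) = (fun y => v y k) + fun y => w y k := rfl
  simp only [partialDeriv, e, h, add_apply]

lemma partialDeriv_smul {v : R3 → C3} (hv : ContDiff ℝ ∞ v) (c : ℂ) (j k : Fin 3) (x : R3) :
    partialDeriv (c • v) j k x = c * partialDeriv v j k x := by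
  have h := fderiv_const_smul (differentiable_comp hv k x) c
  have e : (fun y => (c • v) y k) = c • fun y => v y k := rfl
  simp only [partialDeriv, e, h]
  rfl

lemma curl_add {v w : R3 → C3} (hv : ContDiff ℝ ∞ v) (hw : ContDiff ℝ ∞ w) :
    curl (v + w) = curl v + curl w := by
  funext x
  ext i
  fin_cases i <;> simp [curl, partialDeriv_add hv hw] <;> ring

lemma curl_smul {v : R3 → C3} (hv : ContDiff ℝ ∞ v) (c : ℂ) :
    curl (c • v) = c • curl v := by
  funext x
  ext i
  fin_cases i <;> simp [curl, partialDeriv_smul hv] <;> ring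

lemma tangential_add (x : R3) (a b : C3) :
    tangential x (a + b) = tangential x a + tangential x b := by
  simp only [tangential, inner_add_right, add_smul]
  abel

lemma tangential_smul (x : R3) (c : ℂ) (a : C3) :
    tangential x (c • a) = c • tangential x a := by
  simp only [tangential, inner_smul_right, smul_sub, smul_smul]

lemma wedge_add (a b c : C3) : wedge a (b + c) = wedge a b + wedge a c := by
  ext i
  fin_cases i <;> simp [wedge] <;> ring

lemma wedge_smul (a : C3) (z : ℂ) (b : C3) : wedge a (z • b) = z • wedge a b := by
  ext i
  fin_cases i <;> simp [wedge] <;> ring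

/-- The graph of the Maxwell operator `(v, w) ↦ (curl w, -curl v)` on the fields that are
restrictions to `Ω` of smooth compactly supported fields on `ℝ³` and satisfy the boundary
condition. -/
def coreGraph (γ : ℝ) : Submodule ℂ (StateSpace × StateSpace) where
  carrier := {p | ∃ v w : R3 → C3,
    ContDiff ℝ ∞ v ∧ HasCompactSupport v ∧ ContDiff ℝ ∞ w ∧ HasCompactSupport w ∧
    BoundaryCondition γ v w ∧
    p.1.fst =ᵐ[volume.restrict exteriorDomain] v ∧
    p.1.snd =ᵐ[volume.restrict exteriorDomain] w ∧
    p.2.fst =ᵐ[volume.restrict exteriorDomain] curl w ∧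
    p.2.snd =ᵐ[volume.restrict exteriorDomain] -curl v}
  zero_mem' := by
    have hc : curl 0 = 0 := by
      have := curl_smul (v := 0) contDiff_const 0
      simpa using this
    refine ⟨0, 0, contDiff_const, HasCompactSupport.zero, contDiff_const,
      HasCompactSupport.zero, ?_, ?_, ?_, ?_, ?_⟩
    · intro x _
      have h1 : tangential x 0 = 0 := by simp [tangential]
      have h2 : wedge (normal x) 0 = 0 := by
        ext i
        fin_cases i <;> simp [wedge]
      simp [h1, h2]
    · exact Lp.coeFn_zero _ _ _
    · exact Lp.coeFn_zero _ _ _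
    · rw [hc]
      exact Lp.coeFn_zero _ _ _
    · rw [hc, neg_zero]
      exact Lp.coeFn_zero _ _ _
  add_mem' := by
    rintro p q ⟨v, w, hv, hvc, hw, hwc, hb, h1, h2, h3, h4⟩
      ⟨v', w', hv', hvc', hw', hwc', hb', h1', h2', h3', h4'⟩
    refine ⟨v + v', w + w', hv.add hv', hvc.add hvc', hw.add hw', hwc.add hwc', ?_,
      ?_, ?_, ?_, ?_⟩
    · intro x hx
      have := congrArg₂ (· + ·) (hb x hx) (hb' x hx)
      simp only [Pi.add_apply, tangential_add, wedge_add, smul_add] at this ⊢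
      rw [add_zero] at this
      rw [← this]
      abel
    · exact (Lp.coeFn_add _ _).trans (h1.add h1')
    · exact (Lp.coeFn_add _ _).trans (h2.add h2')
    · rw [curl_add hw hw']
      exact (Lp.coeFn_add _ _).trans (h3.add h3')
    · rw [curl_add hv hv', neg_add]
      exact (Lp.coeFn_add _ _).trans (h4.add h4')
  smul_mem' := by
    rintro c p ⟨v, w, hv, hvc, hw, hwc, hb, h1, h2, h3, h4⟩
    refine ⟨c • v, c • w, contDiff_const.smul hv, hvc.smul_left (f := fun _ => c),
      contDiff_const.smul hw, hwc.smul_left (f := fun _ => c), ?_, ?_, ?_, ?_, ?_⟩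
    · intro x hx
      have := congrArg (c • ·) (hb x hx)
      simp only [Pi.smul_apply, tangential_smul, wedge_smul, smul_sub, smul_zero] at this ⊢
      rw [smul_comm (γ : ℂ) c]
      exact this
    · exact (Lp.coeFn_smul _ _).trans (h1.const_smul c)
    · exact (Lp.coeFn_smul _ _).trans (h2.const_smul c)
    · rw [curl_smul hw]
      exact (Lp.coeFn_smul _ _).trans (h3.const_smul c)
    · rw [curl_smul hv, ← smul_neg]
      exact (Lp.coeFn_smul _ _).trans (h4.const_smul c)

/-- The generator `G_b`: the closed operator on `L²(Ω)⁶` whose graph is the closure of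
`coreGraph γ` in `L²(Ω)⁶ × L²(Ω)⁶`. Thus its domain is the closure of the core in the graph norm,
and `G_b (E, B) = (curl B, -curl E)`. That the closure is a graph is `generator_graph` below. -/
def generator (γ : ℝ) : StateSpace →ₗ.[ℂ] StateSpace :=
  (coreGraph γ).topologicalClosure.toLinearPMap

/-- The geometric eigenspace `{u ∈ D(G) : G u = z u}` of an unbounded operator `G`. -/
def eigenspace {H : Type*} [AddCommGroup H] [Module ℂ H] (G : H →ₗ.[ℂ] H) (z : ℂ) :
    Submodule ℂ H where
  carrier := {u | ∃ hu : u ∈ G.domain, G ⟨u, hu⟩ = z • u}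
  zero_mem' := ⟨G.domain.zero_mem, by
    rw [smul_zero]
    exact G.map_zero⟩
  add_mem' := by
    rintro u v ⟨hu, hu'⟩ ⟨hv, hv'⟩
    refine ⟨G.domain.add_mem hu hv, ?_⟩
    rw [smul_add, ← hu', ← hv', ← G.map_add]
    rfl
  smul_mem' := by
    rintro c u ⟨hu, hu'⟩
    refine ⟨G.domain.smul_mem c hu, ?_⟩
    rw [smul_comm, ← hu', ← G.map_smul]
    rfl

/-- `z` is an eigenvalue of the unbounded operator `G`: some nonzero `u` in the domain satisfies
`G u = z u`. -/
def IsEigenvalue {H : Type*} [AddCommGroup H] [Module ℂ H] (G : H →ₗ.[ℂ] H) (z : ℂ) : Prop :=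
  ∃ u : G.domain, (u : H) ≠ 0 ∧ G u = z • (u : H)

/-- The geometric multiplicity of `z`: the (cardinal) dimension of its eigenspace. -/
def geometricMultiplicity {H : Type*} [AddCommGroup H] [Module ℂ H] (G : H →ₗ.[ℂ] H) (z : ℂ) :
    Cardinal :=
  Module.rank ℂ (eigenspace G z)

/-! The rest checks that the closure of the core graph is the graph of an operator. -/

lemma isOpen_exteriorDomain : IsOpen exteriorDomain :=
  isOpen_lt continuous_const continuous_norm

/-- Integration against a continuous compactly supported function is continuous on `L²`. -/
lemma exists_functional (F : R3 → ℂ) (hF : Continuous F) (hc : HasCompactSupport F) (k : Fin 3) :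
    ∃ T : L2Field →L[ℂ] ℂ, ∀ u : L2Field, T u = ∫ x in exteriorDomain, F x * u x k := by
  have hm : MemLp (fun x => (EuclideanSpace.single k (star (F x)) : C3)) 2
      ((volume : Measure R3).restrict exteriorDomain) := by
    have hcont : Continuous (fun x => (EuclideanSpace.single k (star (F x)) : C3)) := by
      refine (PiLp.continuous_toLp 2 _).comp ?_
      refine continuous_pi fun i => ?_
      by_cases h : i = k
      · subst h
        simpa using hF.star
      · simp only [Pi.single_eq_of_ne h]
        exact continuous_const
    refine hcont.memLp_of_hasCompactSupport ?_
    exact hc.comp_left (g := fun z => (EuclideanSpace.single k (star z) : C3)) (by simp)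
  refine ⟨innerSL ℂ (hm.toLp _), fun u => ?_⟩
  rw [innerSL_apply_apply, L2.inner_def]
  refine integral_congr_ae ?_
  filter_upwards [hm.coeFn_toLp] with x hx
  rw [hx, EuclideanSpace.inner_single_left]
  simp

lemma integral_by_parts (f g : R3 → ℂ) (hf : ContDiff ℝ ∞ f) (hfc : HasCompactSupport f)
    (hfs : tsupport f ⊆ exteriorDomain) (hg : ContDiff ℝ ∞ g) (e : R3) :
    ∫ x in exteriorDomain, f x * fderiv ℝ g x e =
      -∫ x in exteriorDomain, fderiv ℝ f x e * g x := by
  have hf' : Continuous (fun x => fderiv ℝ f x e) :=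
    (hf.continuous_fderiv (by simp)).clm_apply continuous_const
  have hg' : Continuous (fun x => fderiv ℝ g x e) :=
    (hg.continuous_fderiv (by simp)).clm_apply continuous_const
  have hf'c : HasCompactSupport (fun x => fderiv ℝ f x e) := hfc.fderiv_apply ℝ e
  rw [setIntegral_eq_integral_of_forall_compl_eq_zero,
    setIntegral_eq_integral_of_forall_compl_eq_zero]
  · refine integral_mul_fderiv_eq_neg_fderiv_mul_of_integrable ?_ ?_ ?_ ?_ ?_
    · exact (hf'.mul hg.continuous).integrable_of_hasCompactSupport hf'c.mul_right
    · exact (hf.continuous.mul hg').integrable_of_hasCompactSupport hfc.mul_right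
    · exact (hf.continuous.mul hg.continuous).integrable_of_hasCompactSupport hfc.mul_right
    · exact fun x _ => hf.differentiable (by simp) x
    · exact fun x _ => hg.differentiable (by simp) x
  · intro x hx
    have h0 : fderiv ℝ f x = 0 := by
      by_contra h
      exact hx (hfs (support_fderiv_subset ℝ h))
    simp [h0]
  · intro x hx
    have h0 : f x = 0 := by
      by_contra h
      exact hx (hfs (subset_tsupport f h))
    simp [h0]

lemma curl_apply (v : R3 → C3) (x : R3) (k : Fin 3) :
    curl v x k = partialDeriv v (k + 1) (k + 2) x - partialDeriv v (k + 2) (k + 1) x := by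
  fin_cases k <;> rfl

lemma integral_mul_curl (f : R3 → ℂ) (hf : ContDiff ℝ ∞ f) (hfc : HasCompactSupport f)
    (hfs : tsupport f ⊆ exteriorDomain) (w : R3 → C3) (hw : ContDiff ℝ ∞ w) (k : Fin 3) :
    ∫ x in exteriorDomain, f x * curl w x k =
      (∫ x in exteriorDomain, fderiv ℝ f x (EuclideanSpace.single (k + 2) 1) * w x (k + 1)) -
      ∫ x in exteriorDomain, fderiv ℝ f x (EuclideanSpace.single (k + 1) 1) * w x (k + 2) := by
  have hk : ∀ i, ContDiff ℝ ∞ (fun y => w y i) := fun i => by fun_prop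
  have hint : ∀ j i, Integrable (fun x => f x * partialDeriv w j i x)
      ((volume : Measure R3).restrict exteriorDomain) := by
    intro j i
    have hg' : Continuous (partialDeriv w j i) :=
      ((hk i).continuous_fderiv (by simp)).clm_apply continuous_const
    exact ((hf.continuous.mul hg').integrable_of_hasCompactSupport hfc.mul_right).restrict
  simp only [curl_apply, mul_sub]
  rw [integral_sub (hint _ _) (hint _ _)]
  have h := fun j i => integral_by_parts f (fun y => w y i) hf hfc hfs (hk i)
    (EuclideanSpace.single j 1)
  simp only [partialDeriv]
  rw [h, h]
  ring

lemma ae_zero_of_tests (u : L2Field)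
    (h : ∀ f : R3 → ℂ, ContDiff ℝ ∞ f → HasCompactSupport f → tsupport f ⊆ exteriorDomain →
      ∀ k, ∫ x in exteriorDomain, f x * u x k = 0) : u = 0 := by
  have hk : ∀ k : Fin 3, ∀ᵐ x ∂(volume : Measure R3), x ∈ exteriorDomain → u x k = 0 := by
    intro k
    refine isOpen_exteriorDomain.ae_eq_zero_of_integral_contDiff_smul_eq_zero ?_ ?_
    · have h1 : MemLp (fun x => u x k) 2 ((volume : Measure R3).restrict exteriorDomain) :=
        (EuclideanSpace.proj k : C3 →L[ℂ] ℂ).comp_memLp' (Lp.memLp u)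
      exact locallyIntegrableOn_of_locallyIntegrable_restrict
        (h1.locallyIntegrable (by norm_num))
    · intro g hg hgc hgs
      have hG : ContDiff ℝ ∞ (fun x => (g x : ℂ)) := Complex.ofRealCLM.contDiff.comp hg
      have hGc : HasCompactSupport (fun x => (g x : ℂ)) :=
        hgc.comp_left (g := fun t : ℝ => (t : ℂ)) (by simp)
      have hs : tsupport (fun x => (g x : ℂ)) ⊆ exteriorDomain :=
        (tsupport_comp_subset (g := fun t : ℝ => (t : ℂ)) (by simp) g).trans hgs
      have := h _ hG hGc hs k
      rw [setIntegral_eq_integral_of_forall_compl_eq_zero] at this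
      · simpa [Complex.real_smul] using this
      · intro x hx
        have h0 : g x = 0 := by
          by_contra h
          exact hx (hgs (subset_tsupport g h))
        simp [h0]
  have hall := ae_all_iff.2 hk
  refine (Lp.eq_zero_iff_ae_eq_zero).2 ?_
  rw [Filter.EventuallyEq, ae_restrict_iff' isOpen_exteriorDomain.measurableSet]
  filter_upwards [hall] with x hx hxm
  ext k
  exact hx k hxm

/-- On the closure of the core graph, `p.2 = (curl p.1.snd, -curl p.1.fst)` weakly in `Ω`. -/
lemma weak_curl (γ : ℝ) {p : StateSpace × StateSpace} (hp : p ∈ (coreGraph γ).topologicalClosure)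
    (f : R3 → ℂ) (hf : ContDiff ℝ ∞ f) (hfc : HasCompactSupport f)
    (hfs : tsupport f ⊆ exteriorDomain) (k : Fin 3) :
    ((∫ x in exteriorDomain, f x * p.2.fst x k) =
      (∫ x in exteriorDomain, fderiv ℝ f x (EuclideanSpace.single (k + 2) 1) * p.1.snd x (k + 1)) -
      ∫ x in exteriorDomain, fderiv ℝ f x (EuclideanSpace.single (k + 1) 1) * p.1.snd x (k + 2)) ∧
    ((∫ x in exteriorDomain, f x * p.2.snd x k) =
      -((∫ x in exteriorDomain,
          fderiv ℝ f x (EuclideanSpace.single (k + 2) 1) * p.1.fst x (k + 1)) -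
      ∫ x in exteriorDomain,
          fderiv ℝ f x (EuclideanSpace.single (k + 1) 1) * p.1.fst x (k + 2))) := by
  have hf' : ∀ e : R3, Continuous (fun x => fderiv ℝ f x e) := fun e =>
    (hf.continuous_fderiv (by simp)).clm_apply continuous_const
  obtain ⟨T, hT⟩ := exists_functional f hf.continuous hfc k
  obtain ⟨A, hA⟩ := exists_functional _ (hf' (EuclideanSpace.single (k + 2) 1))
    (hfc.fderiv_apply ℝ _) (k + 1)
  obtain ⟨B, hB⟩ := exists_functional _ (hf' (EuclideanSpace.single (k + 1) 1))
    (hfc.fderiv_apply ℝ _) (k + 2)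
  simp only [← hT, ← hA, ← hB]
  have hclosed : IsClosed {p : StateSpace × StateSpace |
      T p.2.fst = A p.1.snd - B p.1.snd ∧ T p.2.snd = -(A p.1.fst - B p.1.fst)} := by
    refine IsClosed.inter (isClosed_eq ?_ ?_) (isClosed_eq ?_ ?_) <;> fun_prop
  have hsub : ((coreGraph γ : Submodule ℂ (StateSpace × StateSpace)) :
      Set (StateSpace × StateSpace)) ⊆ {p |
      T p.2.fst = A p.1.snd - B p.1.snd ∧ T p.2.snd = -(A p.1.fst - B p.1.fst)} := by
    rintro q ⟨v, w, hv, _, hw, _, _, h1, h2, h3, h4⟩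
    have key : ∀ (F : R3 → ℂ) (u : L2Field) (z : R3 → C3) (i : Fin 3),
        u =ᵐ[volume.restrict exteriorDomain] z →
        ∫ x in exteriorDomain, F x * u x i = ∫ x in exteriorDomain, F x * z x i := by
      intro F u z i h
      refine integral_congr_ae ?_
      filter_upwards [h] with x hx
      rw [hx]
    refine ⟨?_, ?_⟩
    · rw [hT, hA, hB, key _ _ _ _ h3, key _ _ _ _ h2, key _ _ _ _ h2]
      exact integral_mul_curl f hf hfc hfs w hw k
    · rw [hT, hA, hB, key _ _ _ _ h4, key _ _ _ _ h1, key _ _ _ _ h1,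
        ← integral_mul_curl f hf hfc hfs v hv k, ← integral_neg]
      simp
  exact closure_minimal hsub hclosed hp

lemma coreGraph_closure_functional (γ : ℝ) :
    ∀ p ∈ (coreGraph γ).topologicalClosure, p.1 = 0 → p.2 = 0 := by
  intro p hp h0
  have hz : ∀ (F : R3 → ℂ) (i : Fin 3),
      ∫ x in exteriorDomain, F x * (0 : L2Field) x i = 0 := by
    intro F i
    refine integral_eq_zero_of_ae ?_
    filter_upwards [Lp.coeFn_zero C3 2 ((volume : Measure R3).restrict exteriorDomain)] with x hx
    rw [hx]
    simp
  have h1 : p.1.fst = 0 := by rw [h0]; rfl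
  have h2 : p.1.snd = 0 := by rw [h0]; rfl
  have e1 : p.2.fst = 0 := ae_zero_of_tests _ fun f hf hfc hfs k => by
    rw [(weak_curl γ hp f hf hfc hfs k).1, h2, hz, hz, sub_zero]
  have e2 : p.2.snd = 0 := ae_zero_of_tests _ fun f hf hfc hfs k => by
    rw [(weak_curl γ hp f hf hfc hfs k).2, h1, hz, hz, sub_zero, neg_zero]
  exact (WithLp.equiv 2 (L2Field × L2Field)).injective (Prod.ext e1 e2)

/-- The graph of the generator is the closure of the core graph. -/
theorem generator_graph (γ : ℝ) :
    (generator γ).graph = (coreGraph γ).topologicalClosure :=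
  Submodule.toLinearPMap_graph_eq _ (coreGraph_closure_functional γ)

end MaxwellExterior

end

/-! Variables are separated on spheres. Let P be a harmonic homogeneous polynomial of degree n and
let a, b, c be functions of s = |x|². The curl exchanges toroidal fields c x ∧ ∇P and poloidal
fields a P x + b ∇P (`curl_posField`, `curl_gradField`, `curl_rotField`). For the eigenvalue -μ with
B toroidal and E poloidal, Maxwell's system says that cP solves Δφ = μ²φ, and the decaying solution
is the Bessel profile `besselRadial μ n`. The boundary condition then becomes the scalar equation
`logDecay n μ = γ`.

Roots. For μ > 0, `logDecay n μ` is continuous in μ, tends to 1 as μ → ∞, and is strictly increasing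
in n by the Turán inequality `turan_pos`. At a root of degree n the value in degree n + 1 exceeds γ
> 1, so the intermediate value theorem places a root of degree n + 1 strictly further to the right.
This yields increasing μ_n, and λ_n = -μ_n.

Lower bound on the multiplicity. Each P gives an eigenfunction. It lies in the domain because
cutting it off far away approximates it in the graph norm (`mem_closure_of_isDecaying`), and the
space of such P has dimension 2n + 1 (`finrank_harmonics`).

Upper bound. No trace or regularity theory for the domain enters. By Green's formula an
eigenfunction is a weak solution (`IsWeakSolution`), tested against smooth fields obeying the dual
boundary condition. Solving the dual problem mode by mode, a radial Robin problem
(`exists_robin_profile`), shows that x · E is orthogonal to h(|x|²) P for all compactly supported h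
in every nonresonant degree, and for h orthogonal to one fixed function in the resonant degree n.
The symmetry (E, B, γ) ↦ (B, -E, 1/γ) gives the same for x · B, where no degree resonates since 1/γ
< 1 ≤ `logDecay`. So x · B = 0, and x · E is determined by 2n + 1 moments (`radialMoments`). A weak
solution whose radial components both vanish is zero (`IsWeakSolution.ae_eq_zero`), hence the
moments are injective on the eigenspace. -/

namespace MaxwellExterior

/-! ### Harmonic polynomials in three variables -/

open MvPolynomial

/-- Complex polynomials in three variables. -/
abbrev Poly3 : Type := MvPolynomial (Fin 3) ℂ

/-- The Laplacian on polynomials. -/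
noncomputable def lap : Poly3 →ₗ[ℂ] Poly3 :=
  ∑ i : Fin 3, (pderiv i).toLinearMap ∘ₗ (pderiv i).toLinearMap

lemma lap_apply (p : Poly3) : lap p = ∑ i : Fin 3, pderiv i (pderiv i p) := by
  simp [lap]

/-- The polynomial `x₀² + x₁² + x₂²`. -/
noncomputable def normSqPoly : Poly3 := ∑ i : Fin 3, X i ^ 2

/-- Harmonic homogeneous polynomials of degree `n`. -/
noncomputable def harmonics (n : ℕ) : Submodule ℂ Poly3 :=
  homogeneousSubmodule (Fin 3) ℂ n ⊓ LinearMap.ker lap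

lemma normSqPoly_isHomogeneous : normSqPoly.IsHomogeneous 2 :=
  IsHomogeneous.sum _ _ _ fun i _ => by simpa using (isHomogeneous_X ℂ i).pow 2

lemma lap_isHomogeneous {n : ℕ} {p : Poly3} (hp : p.IsHomogeneous n) :
    (lap p).IsHomogeneous (n - 2) := by
  rw [lap_apply]
  exact IsHomogeneous.sum _ _ _ fun i _ => hp.pderiv.pderiv

lemma pderiv_normSqPoly (i : Fin 3) : pderiv i normSqPoly = 2 * X i := by
  fin_cases i <;> simp [normSqPoly, Fin.sum_univ_three]

lemma euler {n : ℕ} {p : Poly3} (hp : p.IsHomogeneous n) :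
    X 0 * pderiv 0 p + X 1 * pderiv 1 p + X 2 * pderiv 2 p = (n : Poly3) * p := by
  have := hp.sum_X_mul_pderiv
  rwa [Fin.sum_univ_three, nsmul_eq_mul] at this

lemma lap_normSqPoly_mul {n : ℕ} {p : Poly3} (hp : p.IsHomogeneous n) :
    lap (normSqPoly * p) = (6 + 4 * n : Poly3) * p + normSqPoly * lap p := by
  have e := euler hp
  simp only [lap_apply, Fin.sum_univ_three, Derivation.leibniz, smul_eq_mul, map_add,
    pderiv_normSqPoly]
  simp only [show (2 : Poly3) = C 2 from rfl, pderiv_X_self, pderiv_C]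
  simp only [show (C 2 : Poly3) = 2 from rfl]
  linear_combination 4 * e

/-- Iteration of `lap_normSqPoly_mul`, each power of |x|² raising the degree by 2. What matters is
that the numerical coefficient never vanishes. -/
lemma lap_normSqPoly_pow_mul {n : ℕ} {p : Poly3} (hp : p.IsHomogeneous n) (j : ℕ) :
    lap (normSqPoly ^ (j + 1) * p) =
      (2 * (j + 1) * (2 * j + 3 + 2 * n) : Poly3) * (normSqPoly ^ j * p) +
        normSqPoly ^ (j + 1) * lap p := by
  induction j with
  | zero =>
    have := lap_normSqPoly_mul hp
    simp only [zero_add, pow_one, this, Nat.cast_zero]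
    ring
  | succ j ih =>
    have h1 : (normSqPoly ^ (j + 1) * p).IsHomogeneous (2 * (j + 1) + n) :=
      (normSqPoly_isHomogeneous.pow (j + 1)).mul hp
    rw [pow_succ' _ (j + 1), mul_assoc, lap_normSqPoly_mul h1, ih]
    push_cast
    ring

lemma normSqPoly_ne_zero : normSqPoly ≠ 0 := by
  intro h
  have := congrArg (eval (fun _ => (1 : ℂ))) h
  simp [normSqPoly] at this

/-- Descent on the degree: cancelling |x|^(2j) leaves c p = -|x|² Δp with c ≠ 0, so p = |x|² p' with
p' of degree n - 2, and p' satisfies the hypothesis with j + 1. The exponent j is free so that the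
induction closes; the case j = 0 is the one needed. -/
lemma eq_zero_of_lap_normSqPoly_pow_mul {n : ℕ} : ∀ {p : Poly3}, p.IsHomogeneous n →
    ∀ j : ℕ, lap (normSqPoly ^ (j + 1) * p) = 0 → p = 0 := by
  induction n using Nat.strong_induction_on with
  | _ n ih =>
    intro p hp j h
    by_contra hp0
    rw [lap_normSqPoly_pow_mul hp] at h
    set c : ℂ := 2 * (j + 1) * (2 * j + 3 + 2 * n) with hc
    have hc0 : c ≠ 0 := by
      have : ((2 * (j + 1) * (2 * j + 3 + 2 * n) : ℕ) : ℂ) ≠ 0 :=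
        Nat.cast_ne_zero.2 (by positivity)
      rw [hc]
      exact_mod_cast this
    have h2 : C c * p + normSqPoly * lap p = 0 := by
      have h3 : normSqPoly ^ j * (C c * p + normSqPoly * lap p) = 0 := by
        rw [← h, hc]
        simp only [map_mul, map_add, map_natCast, map_ofNat, map_one]
        ring
      exact (mul_eq_zero.1 h3).resolve_left (pow_ne_zero _ normSqPoly_ne_zero)
    have h4 : p = normSqPoly * (C (-c⁻¹) * lap p) := by
      have h5 : C c⁻¹ * (C c * p) = p := by
        rw [← mul_assoc, ← map_mul, inv_mul_cancel₀ hc0, map_one, one_mul]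
      rw [map_neg]
      linear_combination -h5 + C c⁻¹ * h2
    have h6 : (C (-c⁻¹) * lap p).IsHomogeneous (n - 2) := by
      simpa using (isHomogeneous_C (Fin 3) (-c⁻¹)).mul (lap_isHomogeneous hp)
    -- A nonzero homogeneous polynomial has only one degree. Hence n ≥ 2: the subtraction is not
    -- truncated and the degree really drops.
    have h7 : n = 2 + (n - 2) := by
      refine hp.inj_right ?_ hp0
      conv_lhs => rw [h4]
      exact normSqPoly_isHomogeneous.mul h6
    have h8 := ih (n - 2) (by omega) h6 (j + 1) (by
      have h9 : normSqPoly ^ (j + 1 + 1) * (C (-c⁻¹) * lap p) = normSqPoly ^ (j + 1) * p := by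
        conv_rhs => rw [h4]
        ring
      rw [h9, lap_normSqPoly_pow_mul hp]
      exact h)
    rw [h8, mul_zero] at h4
    exact hp0 h4

instance (n : ℕ) : FiniteDimensional ℂ (homogeneousSubmodule (Fin 3) ℂ n) :=
  Module.Finite.iff_fg.2 (homogeneousSubmodule_fg (Fin 3) ℂ n)

lemma finrank_homogeneousSubmodule (n : ℕ) :
    Module.finrank ℂ (homogeneousSubmodule (Fin 3) ℂ n) = (n + 2).choose 2 := by
  rw [homogeneousSubmodule_eq_finsupp_supported,
    (AddMonoidAlgebra.supportedEquivFinsupp (R := ℂ) (S := ℂ)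
      {d : Fin 3 →₀ ℕ | d.degree = n}).finrank_eq]
  have e : {d : Fin 3 →₀ ℕ | d.degree = n} =
      ((Finset.univ : Finset (Fin 3)).finsuppAntidiag n : Set (Fin 3 →₀ ℕ)) := by
    ext d
    simp [Finsupp.degree_eq_sum]
  rw [e, Module.finrank_finsupp_self]
  simp only [Finset.coe_sort_coe, Fintype.card_coe, Finset.card_finsuppAntidiag_nat_eq_choose]
  simp only [Finset.card_univ, Fintype.card_fin]
  rw [show 3 + n - 1 = n + 2 by omega, ← Nat.choose_symm_add]

/-- The map q ↦ Δ(|x|² q) preserves the degree and is injective, hence surjective in finite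
dimension. -/
lemma exists_lap_normSqPoly_mul_eq {n : ℕ} {p : Poly3} (hp : p.IsHomogeneous n) :
    ∃ q : Poly3, q.IsHomogeneous n ∧ lap (normSqPoly * q) = p := by
  let T : homogeneousSubmodule (Fin 3) ℂ n →ₗ[ℂ] homogeneousSubmodule (Fin 3) ℂ n :=
    (lap ∘ₗ LinearMap.mulLeft ℂ normSqPoly).restrict fun q hq => by
      have := lap_isHomogeneous (normSqPoly_isHomogeneous.mul hq)
      simpa using this
  have hinj : Function.Injective T := by
    rw [← LinearMap.ker_eq_bot, LinearMap.ker_eq_bot']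
    intro q hq
    have h1 : lap (normSqPoly * q) = 0 := congrArg Subtype.val hq
    exact Subtype.ext (eq_zero_of_lap_normSqPoly_pow_mul q.2 0 (by simpa using h1))
  obtain ⟨q, hq⟩ := (LinearMap.injective_iff_surjective.1 hinj) ⟨p, hp⟩
  exact ⟨q, q.2, congrArg Subtype.val hq⟩

lemma lap_eq_zero_of_lt_two {n : ℕ} {p : Poly3} (hp : p.IsHomogeneous n) (hn : n < 2) :
    lap p = 0 := by
  rw [lap_apply]
  refine Finset.sum_eq_zero fun i _ => ?_
  have h : (pderiv i p).IsHomogeneous 0 := by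
    have := hp.pderiv (i := i)
    rwa [show n - 1 = 0 by omega] at this
  rw [totalDegree_eq_zero_iff_eq_C.1 (Nat.le_zero.1 h.totalDegree_le), pderiv_C]

/-- For n = m + 2 the Laplacian maps degree m + 2 onto degree m, so rank-nullity leaves C(m + 4, 2)
- C(m + 2, 2) = 2m + 5. -/
lemma finrank_harmonics (n : ℕ) : Module.finrank ℂ (harmonics n) = 2 * n + 1 := by
  rcases Nat.lt_or_ge n 2 with hn | hn
  · have h : harmonics n = homogeneousSubmodule (Fin 3) ℂ n :=
      inf_eq_left.2 fun p hp => lap_eq_zero_of_lt_two hp hn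
    rw [h, finrank_homogeneousSubmodule]
    interval_cases n <;> rfl
  · obtain ⟨m, rfl⟩ := Nat.exists_eq_add_of_le' hn
    let T : homogeneousSubmodule (Fin 3) ℂ (m + 2) →ₗ[ℂ] homogeneousSubmodule (Fin 3) ℂ m :=
      lap.restrict fun q hq => by simpa using lap_isHomogeneous hq
    have hs : LinearMap.range T = ⊤ := by
      rw [LinearMap.range_eq_top]
      rintro ⟨p, hp⟩
      obtain ⟨q, hq, h⟩ := exists_lap_normSqPoly_mul_eq hp
      exact ⟨⟨normSqPoly * q, by
        have := normSqPoly_isHomogeneous.mul hq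
        rwa [add_comm] at this⟩, Subtype.ext h⟩
    have hk : Module.finrank ℂ (LinearMap.ker T) = Module.finrank ℂ (harmonics (m + 2)) := by
      have e : (LinearMap.ker T).map (Submodule.subtype _) = harmonics (m + 2) := by
        ext p
        simp only [Submodule.mem_map, LinearMap.mem_ker, Submodule.coe_subtype, Subtype.exists,
          exists_and_right, exists_eq_right]
        constructor
        · rintro ⟨hp, h⟩
          exact ⟨hp, congrArg Subtype.val h⟩
        · rintro ⟨hp, h⟩
          exact ⟨hp, Subtype.ext h⟩
      rw [← e]
      exact (LinearEquiv.finrank_eq (Submodule.equivMapOfInjective _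
        (Submodule.subtype_injective _) _))
    have := T.finrank_range_add_finrank_ker
    rw [hs, finrank_top, finrank_homogeneousSubmodule, finrank_homogeneousSubmodule, hk] at this
    have h1 := Nat.choose_succ_succ' (m + 3) 1
    have h2 := Nat.choose_succ_succ' (m + 2) 1
    simp only [Nat.choose_one_right] at h1 h2
    have h1' : (m + 2 + 2).choose 2 = m + 3 + (m + 3).choose 2 := h1
    have h2' : (m + 3).choose 2 = m + 2 + (m + 2).choose 2 := h2
    omega

/-- Every polynomial is obtained from harmonic homogeneous ones by sums and multiplication by
`|x|²`. -/
lemma harmonic_induction {motive : Poly3 → Prop} (zero : motive 0)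
    (add : ∀ p q, motive p → motive q → motive (p + q))
    (normSq_mul : ∀ p, motive p → motive (normSqPoly * p))
    (harmonic : ∀ n, ∀ p ∈ harmonics n, motive p) (p : Poly3) : motive p := by
  have hom : ∀ n, ∀ q : Poly3, q.IsHomogeneous n → motive q := by
    intro n
    induction n using Nat.strong_induction_on with
    | _ n ih =>
      intro q hq
      rcases Nat.lt_or_ge n 2 with hn | hn
      · exact harmonic n q ⟨hq, lap_eq_zero_of_lt_two hq hn⟩
      · obtain ⟨m, rfl⟩ := Nat.exists_eq_add_of_le' hn
        -- With Δ(|x|² r) = Δq the difference q - |x|² r is harmonic, and r has smaller degree.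
        obtain ⟨r, hr, h⟩ := exists_lap_normSqPoly_mul_eq (lap_isHomogeneous hq)
        simp only [Nat.add_sub_cancel] at hr
        have h1 : (normSqPoly * r).IsHomogeneous (m + 2) := by
          have := normSqPoly_isHomogeneous.mul hr
          rwa [add_comm] at this
        have h2 : motive (q - normSqPoly * r) :=
          harmonic (m + 2) _ ⟨Submodule.sub_mem _ hq h1, by
            change lap (q - normSqPoly * r) = 0
            rw [map_sub, h, sub_self]⟩
        have := add _ _ h2 (normSq_mul r (ih m (by omega) r hr))
        simpa using this
  rw [← sum_homogeneousComponent p]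
  exact Finset.sum_induction _ motive add zero fun i _ =>
    hom i _ (homogeneousComponent_isHomogeneous i p)

end MaxwellExterior

/-! ### Polynomial vector fields and their curls -/

namespace MaxwellExterior

open MvPolynomial

/-- The commutator of two derivations is a derivation, and this one kills the variables. -/
lemma pderiv_comm (i j : Fin 3) (p : Poly3) :
    pderiv i (pderiv j p) = pderiv j (pderiv i p) := by
  have h : ⁅(pderiv i : Derivation ℂ Poly3 Poly3), (pderiv j : Derivation ℂ Poly3 Poly3)⁆ = 0 := by
    refine derivation_ext fun k => ?_
    rw [Derivation.commutator_apply]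
    simp only [pderiv_X, Pi.single_apply]
    split_ifs <;> simp
  have := congrArg (fun D : Derivation ℂ Poly3 Poly3 => D p) h
  rw [Derivation.commutator_apply] at this
  exact sub_eq_zero.1 this

/-- The curl of a polynomial vector field. -/
noncomputable def polyCurl (Q : Fin 3 → Poly3) (k : Fin 3) : Poly3 :=
  pderiv (k + 1) (Q (k + 2)) - pderiv (k + 2) (Q (k + 1))

/-- The vector product `x ∧ Q` for a polynomial vector field `Q`. -/
noncomputable def polyWedge (Q : Fin 3 → Poly3) (k : Fin 3) : Poly3 :=
  X (k + 1) * Q (k + 2) - X (k + 2) * Q (k + 1)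

/-- The polynomial `x · Q`. -/
noncomputable def polyRadial (Q : Fin 3 → Poly3) : Poly3 := ∑ i : Fin 3, X i * Q i

/-- The polynomial vector field `p x`. -/
noncomputable def posField (p : Poly3) (i : Fin 3) : Poly3 := X i * p

/-- The gradient of a polynomial. -/
noncomputable def gradField (p : Poly3) (i : Fin 3) : Poly3 := pderiv i p

/-- The rotational field `x ∧ ∇p`. -/
noncomputable def rotField (p : Poly3) : Fin 3 → Poly3 := polyWedge (gradField p)

lemma polyCurl_posField (p : Poly3) : polyCurl (posField p) = -rotField p := by
  funext i
  fin_cases i <;> simp [polyCurl, posField, rotField, polyWedge, gradField]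

lemma polyCurl_gradField (p : Poly3) : polyCurl (gradField p) = 0 := by
  funext i
  exact sub_eq_zero.2 (pderiv_comm _ _ _)

lemma polyWedge_posField (p : Poly3) : polyWedge (posField p) = 0 := by
  funext i
  fin_cases i <;> simp [polyWedge, posField] <;> ring

lemma euler_pderiv {n : ℕ} {p : Poly3} (hp : p.IsHomogeneous n) (i : Fin 3) :
    pderiv i p + (X 0 * pderiv i (pderiv 0 p) + X 1 * pderiv i (pderiv 1 p) +
      X 2 * pderiv i (pderiv 2 p)) = (n : Poly3) * pderiv i p := by
  have h := congrArg (pderiv i) (euler hp)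
  rw [show (n : Poly3) = C (n : ℂ) by simp] at h ⊢
  simp only [map_add, Derivation.leibniz, pderiv_C, smul_eq_mul] at h
  rw [mul_zero, add_zero] at h
  rw [← h]
  fin_cases i <;> simp <;> ring

/-- The double product x ∧ (x ∧ ∇p) = (x · ∇p) x - |x|² ∇p, combined with Euler's identity x · ∇p =
n p. -/
lemma polyWedge_rotField {n : ℕ} {p : Poly3} (hp : p.IsHomogeneous n) (i : Fin 3) :
    polyWedge (rotField p) i = (n : Poly3) * posField p i - normSqPoly * gradField p i := by
  have e := euler hp
  fin_cases i <;>
    simp [polyWedge, posField, rotField, gradField, normSqPoly, Fin.sum_univ_three]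
  · linear_combination X 0 * e
  · linear_combination X 1 * e
  · linear_combination X 2 * e

lemma polyRadial_posField (p : Poly3) : polyRadial (posField p) = normSqPoly * p := by
  simp only [polyRadial, posField, normSqPoly, Finset.sum_mul]
  exact Finset.sum_congr rfl fun i _ => by ring

lemma polyRadial_gradField {n : ℕ} {p : Poly3} (hp : p.IsHomogeneous n) :
    polyRadial (gradField p) = (n : Poly3) * p := by
  rw [← euler hp, polyRadial, Fin.sum_univ_three]
  rfl

/-- In general curl (x ∧ ∇p) = x Δp - 2∇p - (x · ∇)∇p. The first term vanishes, and ∇p is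
homogeneous of degree n - 1. -/
lemma polyCurl_rotField {n : ℕ} {p : Poly3} (hp : p ∈ harmonics n) (i : Fin 3) :
    polyCurl (rotField p) i = -((n : Poly3) + 1) * gradField p i := by
  have e := euler_pderiv hp.1 i
  have l : lap p = 0 := hp.2
  rw [lap_apply, Fin.sum_univ_three] at l
  have c10 := pderiv_comm 1 0 p
  have c20 := pderiv_comm 2 0 p
  have c21 := pderiv_comm 2 1 p
  fin_cases i <;>
    simp only [polyCurl, rotField, polyWedge, gradField, Fin.zero_eta, Fin.mk_one,
      Fin.reduceFinMk, Fin.reduceAdd, map_sub, Derivation.leibniz, smul_eq_mul, pderiv_X_self,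
      pderiv_X_of_ne, ne_eq, Fin.reduceEq, not_false_eq_true, zero_ne_one, one_ne_zero] at e ⊢ <;>
    simp only [c10, c20, c21, Fin.isValue] at e ⊢
  · linear_combination X 0 * l - e
  · linear_combination X 1 * l - e
  · linear_combination X 2 * l - e

/-- A harmonic polynomial times a constant vector `eⱼ` in terms of radial, gradient and
rotational fields. -/
lemma harmonic_smul_basis {n : ℕ} {p : Poly3} (hp : p ∈ harmonics n) (i j : Fin 3) :
    (if i = j then (n : Poly3) * (n + 1) * p else 0) =
      n * gradField (X j * p) i - normSqPoly * gradField (pderiv j p) i +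
        (n - 1) * posField (pderiv j p) i - rotField (rotField p j) i := by
  have e := euler hp.1
  have e0 := euler_pderiv hp.1 0
  have e1 := euler_pderiv hp.1 1
  have e2 := euler_pderiv hp.1 2
  have l : lap p = 0 := hp.2
  rw [lap_apply, Fin.sum_univ_three] at l
  have c10 := pderiv_comm 1 0 p
  have c20 := pderiv_comm 2 0 p
  have c21 := pderiv_comm 2 1 p
  rw [c10] at e1
  rw [c20, c21] at e2
  -- Each of the nine entries is a polynomial combination of Euler's identity for p, of its three
  -- derivatives and of Δp = 0.
  fin_cases i <;> fin_cases j <;>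
    simp only [posField, rotField, polyWedge, gradField, normSqPoly, Fin.sum_univ_three,
      Fin.zero_eta, Fin.mk_one, Fin.isValue,
      Fin.reduceFinMk, Fin.reduceAdd, map_sub, Derivation.leibniz, smul_eq_mul, pderiv_X_self,
      pderiv_X_of_ne, ne_eq, Fin.reduceEq, not_false_eq_true, zero_ne_one, one_ne_zero,
      if_true, if_false] <;>
    simp only [c10, c20, c21, Fin.isValue]
  · linear_combination -(X 1 * e1 + X 2 * e2 - X 0 * e0 + n * e - (X 1 ^ 2 + X 2 ^ 2) * l)
  · linear_combination X 1 * e0 + X 0 * e1 - X 0 * X 1 * l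
  · linear_combination X 2 * e0 + X 0 * e2 - X 0 * X 2 * l
  · linear_combination X 1 * e0 + X 0 * e1 - X 0 * X 1 * l
  · linear_combination -(X 0 * e0 + X 2 * e2 - X 1 * e1 + n * e - (X 0 ^ 2 + X 2 ^ 2) * l)
  · linear_combination X 1 * e2 + X 2 * e1 - X 2 * X 1 * l
  · linear_combination X 2 * e0 + X 0 * e2 - X 0 * X 2 * l
  · linear_combination X 1 * e2 + X 2 * e1 - X 2 * X 1 * l
  · linear_combination -(X 0 * e0 + X 1 * e1 - X 2 * e2 + n * e - (X 0 ^ 2 + X 1 ^ 2) * l)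

/-- A polynomial as a function on `ℝ³`. -/
noncomputable def polyFun (p : Poly3) (x : R3) : ℂ := eval (fun i => (x i : ℂ)) p

/-- A polynomial vector field as a function on `ℝ³`. -/
noncomputable def polyField (Q : Fin 3 → Poly3) (x : R3) : C3 :=
  WithLp.toLp 2 fun i => polyFun (Q i) x

lemma polyFun_add (p q : Poly3) (x : R3) : polyFun (p + q) x = polyFun p x + polyFun q x :=
  map_add _ _ _

lemma polyFun_mul (p q : Poly3) (x : R3) : polyFun (p * q) x = polyFun p x * polyFun q x :=
  map_mul _ _ _

lemma polyFun_sub (p q : Poly3) (x : R3) : polyFun (p - q) x = polyFun p x - polyFun q x :=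
  map_sub _ _ _

lemma polyFun_natCast (n : ℕ) (x : R3) : polyFun (n : Poly3) x = n := map_natCast _ _

lemma polyFun_one (x : R3) : polyFun 1 x = 1 := map_one _

lemma polyFun_neg (p : Poly3) (x : R3) : polyFun (-p) x = -polyFun p x := map_neg _ _

lemma polyFun_zero (x : R3) : polyFun 0 x = 0 := map_zero _

lemma polyFun_smul (c : ℂ) (p : Poly3) (x : R3) : polyFun (c • p) x = c * polyFun p x := by
  simp [polyFun]

lemma polyFun_X (i : Fin 3) (x : R3) : polyFun (X i) x = x i := eval_X _

lemma polyFun_normSqPoly (x : R3) : polyFun normSqPoly x = ((‖x‖ ^ 2 : ℝ) : ℂ) := by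
  simp [polyFun, normSqPoly, EuclideanSpace.real_norm_sq_eq]

lemma hasFDerivAt_coord (i : Fin 3) (x : R3) :
    HasFDerivAt (fun y : R3 => ((y i : ℝ) : ℂ))
      (Complex.ofRealCLM ∘L (EuclideanSpace.proj i : R3 →L[ℝ] ℝ)) x :=
  (Complex.ofRealCLM ∘L (EuclideanSpace.proj i : R3 →L[ℝ] ℝ)).hasFDerivAt

lemma contDiff_coord (i : Fin 3) : ContDiff ℝ ∞ (fun y : R3 => ((y i : ℝ) : ℂ)) :=
  (Complex.ofRealCLM ∘L (EuclideanSpace.proj i : R3 →L[ℝ] ℝ)).contDiff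

lemma contDiff_polyFun (p : Poly3) : ContDiff ℝ ∞ (polyFun p) := by
  induction p using MvPolynomial.induction_on with
  | C a =>
    have : polyFun (C a) = fun _ => a := by
      funext y
      simp [polyFun]
    rw [this]
    exact contDiff_const
  | add p q hp hq =>
    simp only [funext (polyFun_add p q)]
    exact hp.add hq
  | mul_X p i hp =>
    simp only [funext (polyFun_mul p (X i)), polyFun_X]
    exact hp.mul (contDiff_coord i)

lemma fderiv_polyFun (p : Poly3) (j : Fin 3) (x : R3) :
    fderiv ℝ (polyFun p) x (EuclideanSpace.single j 1) = polyFun (pderiv j p) x := by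
  induction p using MvPolynomial.induction_on with
  | C a =>
    have : polyFun (C a) = fun _ => a := by
      funext y
      simp [polyFun]
    rw [this, pderiv_C, polyFun_zero]
    simp
  | add p q hp hq =>
    have : polyFun (p + q) = polyFun p + polyFun q := funext (polyFun_add p q)
    rw [this, fderiv_add ((contDiff_polyFun p).differentiable (by simp) x)
      ((contDiff_polyFun q).differentiable (by simp) x), add_apply, hp, hq, map_add, polyFun_add]
  | mul_X p i hp =>
    have : polyFun (p * X i) = polyFun p * fun y => ((y i : ℝ) : ℂ) := by
      funext y
      rw [polyFun_mul, polyFun_X]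
      rfl
    have h := ((contDiff_polyFun p).differentiable (by simp) x).hasFDerivAt.mul
      (hasFDerivAt_coord i x)
    rw [this, h.fderiv, Derivation.leibniz, polyFun_add]
    simp only [add_apply, smul_apply, hp, ContinuousLinearMap.comp_apply, smul_eq_mul, polyFun_mul,
      polyFun_X, pderiv_X, PiLp.proj_apply, PiLp.single_apply, Complex.ofRealCLM_apply]
    by_cases hij : i = j
    · subst hij
      simp [polyFun_one]
    · simp [hij, polyFun_zero]

lemma contDiff_polyField (Q : Fin 3 → Poly3) : ContDiff ℝ ∞ (polyField Q) :=
  (contDiff_piLp 2).2 fun i => contDiff_polyFun (Q i)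

lemma polyFun_growth (p : Poly3) :
    ∃ C : ℝ, 0 ≤ C ∧ ∃ m : ℕ, ∀ x : R3, ‖polyFun p x‖ ≤ C * (1 + ‖x‖) ^ m := by
  induction p using MvPolynomial.induction_on with
  | C a => exact ⟨‖a‖, norm_nonneg _, 0, fun x => by simp [polyFun]⟩
  | add p q hp hq =>
    obtain ⟨C, hC, m, h⟩ := hp
    obtain ⟨D, hD, l, h'⟩ := hq
    refine ⟨C + D, by positivity, max m l, fun x => ?_⟩
    have h1 : 1 ≤ 1 + ‖x‖ := by simp
    rw [polyFun_add, add_mul]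
    refine (norm_add_le _ _).trans (add_le_add ((h x).trans ?_) ((h' x).trans ?_)) <;> gcongr
    exacts [le_max_left _ _, le_max_right _ _]
  | mul_X p i hp =>
    obtain ⟨C, hC, m, h⟩ := hp
    refine ⟨C, hC, m + 1, fun x => ?_⟩
    rw [polyFun_mul, polyFun_X, norm_mul, pow_succ, ← mul_assoc, Complex.norm_real]
    have h1 : ‖x i‖ ≤ 1 + ‖x‖ := (PiLp.norm_apply_le x i).trans (by simp)
    exact mul_le_mul (h x) h1 (norm_nonneg _) (by positivity)

end MaxwellExterior

/-! ### Fields with radial profiles: curls, decay and pairings -/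

namespace MaxwellExterior

/-- Lebesgue measure on the exterior domain. -/
noncomputable abbrev extMeasure : Measure R3 := (volume : Measure R3).restrict exteriorDomain

/-- The bilinear product on `ℂ³`. -/
noncomputable def dot (a b : C3) : ℂ := ∑ i : Fin 3, a i * b i

lemma dot_add_right (a b c : C3) : dot a (b + c) = dot a b + dot a c := by
  simp [dot, mul_add, Finset.sum_add_distrib]

lemma dot_sub_right (a b c : C3) : dot a (b - c) = dot a b - dot a c := by
  simp [dot, mul_sub, Finset.sum_sub_distrib]

lemma dot_smul_right (z : ℂ) (a b : C3) : dot a (z • b) = z * dot a b := by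
  simp [dot, Finset.mul_sum, mul_left_comm]

lemma dot_smul_left (z : ℂ) (a b : C3) : dot (z • a) b = z * dot a b := by
  simp [dot, Finset.mul_sum, mul_assoc]

lemma dot_neg_right (a b : C3) : dot a (-b) = -dot a b := by
  simp [dot]

lemma dot_neg_left (a b : C3) : dot (-a) b = -dot a b := by
  simp [dot]

lemma dot_zero_right (a : C3) : dot a 0 = 0 := by
  simp [dot]

lemma wedge_apply (a b : C3) (k : Fin 3) :
    wedge a b k = a (k + 1) * b (k + 2) - a (k + 2) * b (k + 1) := by
  fin_cases k <;> rfl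

lemma normal_apply (x : R3) (i : Fin 3) : normal x i = (x i : ℂ) := rfl

lemma inner_normal (x : R3) (u : C3) : inner ℂ (normal x) u = dot (normal x) u := by
  simp [dot, PiLp.inner_apply, normal, mul_comm]

lemma dot_normal_self (x : R3) : dot (normal x) (normal x) = ((‖x‖ ^ 2 : ℝ) : ℂ) := by
  rw [EuclideanSpace.real_norm_sq_eq]
  simp [dot, normal, sq]

lemma wedge_sub (a b c : C3) : wedge a (b - c) = wedge a b - wedge a c := by
  rw [sub_eq_add_neg, wedge_add, sub_eq_add_neg, ← neg_one_smul ℂ c, wedge_smul, neg_one_smul]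

lemma wedge_self (a : C3) : wedge a a = 0 := by
  ext k
  fin_cases k <;> simp [wedge] <;> ring

lemma wedge_tangential (x : R3) (u : C3) : wedge (normal x) (tangential x u) = wedge (normal x) u := by
  rw [tangential, wedge_sub, wedge_smul, wedge_self, smul_zero, sub_zero]

lemma wedge_wedge (x : R3) (hx : ‖x‖ = 1) (u : C3) :
    wedge (normal x) (wedge (normal x) u) = -tangential x u := by
  have h := dot_normal_self x
  rw [hx] at h
  simp only [dot, Fin.sum_univ_three, normal_apply] at h
  rw [tangential, inner_normal]
  ext k
  fin_cases k <;> simp [wedge, dot, Fin.sum_univ_three, normal_apply] at h ⊢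
  · linear_combination -u 0 * h
  · linear_combination -u 1 * h
  · linear_combination -u 2 * h

lemma tangential_wedge (x : R3) (u : C3) :
    tangential x (wedge (normal x) u) = wedge (normal x) u := by
  rw [tangential, inner_normal]
  have : dot (normal x) (wedge (normal x) u) = 0 := by
    simp [dot, wedge, Fin.sum_univ_three]
    ring
  rw [this, zero_smul, sub_zero]

lemma hasFDerivAt_normSq (x : R3) :
    HasFDerivAt (fun y : R3 => ‖y‖ ^ 2) (2 • (innerSL ℝ x : R3 →L[ℝ] ℝ)) x :=
  (hasStrictFDerivAt_norm_sq x).hasFDerivAt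

lemma partialDeriv_radial_smul {g : ℝ → ℝ} {g' : ℝ} {x : R3} (hg : HasDerivAt g g' (‖x‖ ^ 2))
    {F : R3 → C3} (hF : ContDiff ℝ ∞ F) (j k : Fin 3) :
    partialDeriv (fun y => ((g (‖y‖ ^ 2) : ℝ) : ℂ) • F y) j k x =
      (g (‖x‖ ^ 2) : ℂ) * partialDeriv F j k x + 2 * g' * x j * F x k := by
  have h1 : HasFDerivAt (fun y : R3 => ((g (‖y‖ ^ 2) : ℝ) : ℂ))
      (Complex.ofRealCLM ∘L (g' • (2 • (innerSL ℝ x : R3 →L[ℝ] ℝ)))) x :=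
    Complex.ofRealCLM.hasFDerivAt.comp x (hg.comp_hasFDerivAt x (hasFDerivAt_normSq x))
  have h2 := h1.mul (differentiable_comp hF k x).hasFDerivAt
  have e : (fun y => (((g (‖y‖ ^ 2) : ℝ) : ℂ) • F y) k) =
      (fun y : R3 => ((g (‖y‖ ^ 2) : ℝ) : ℂ)) * fun y => F y k := rfl
  rw [partialDeriv, e, h2.fderiv]
  simp [partialDeriv, EuclideanSpace.inner_single_right]
  ring

lemma curl_radial_smul {g : ℝ → ℝ} {g' : ℝ} {x : R3} (hg : HasDerivAt g g' (‖x‖ ^ 2))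
    {F : R3 → C3} (hF : ContDiff ℝ ∞ F) :
    curl (fun y => ((g (‖y‖ ^ 2) : ℝ) : ℂ) • F y) x =
      (g (‖x‖ ^ 2) : ℂ) • curl F x + ((2 * g' : ℝ) : ℂ) • wedge (normal x) (F x) := by
  ext k
  simp only [curl_apply, partialDeriv_radial_smul hg hF, PiLp.add_apply, PiLp.smul_apply,
    smul_eq_mul, wedge_apply, normal_apply]
  push_cast
  ring

lemma contDiff_radial {g : ℝ → ℝ} (hg : ContDiff ℝ ∞ g) :
    ContDiff ℝ ∞ (fun y : R3 => ((g (‖y‖ ^ 2) : ℝ) : ℂ)) :=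
  Complex.ofRealCLM.contDiff.comp (hg.comp (contDiff_norm_sq ℝ))

lemma polyField_apply (Q : Fin 3 → Poly3) (x : R3) (i : Fin 3) :
    polyField Q x i = polyFun (Q i) x := rfl

lemma curl_polyField (Q : Fin 3 → Poly3) (x : R3) :
    curl (polyField Q) x = polyField (polyCurl Q) x := by
  ext k
  rw [curl_apply, polyField_apply, polyCurl, polyFun_sub]
  simp only [partialDeriv, polyField_apply]
  rw [← fderiv_polyFun, ← fderiv_polyFun]

lemma wedge_polyField (Q : Fin 3 → Poly3) (x : R3) :
    wedge (normal x) (polyField Q x) = polyField (polyWedge Q) x := by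
  ext k
  simp only [wedge_apply, polyField_apply, polyWedge, polyFun_sub, polyFun_mul, polyFun_X,
    normal_apply]

lemma dot_normal_polyField (Q : Fin 3 → Poly3) (x : R3) :
    dot (normal x) (polyField Q x) = polyFun (polyRadial Q) x := by
  simp [dot, polyRadial, polyFun, polyField, normal]

/-- A polynomial vector field multiplied by a function of `|x|²`. -/
noncomputable def radialField (g : ℝ → ℝ) (Q : Fin 3 → Poly3) (x : R3) : C3 :=
  ((g (‖x‖ ^ 2) : ℝ) : ℂ) • polyField Q x

lemma contDiff_radialField {g : ℝ → ℝ} (hg : ContDiff ℝ ∞ g) (Q : Fin 3 → Poly3) :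
    ContDiff ℝ ∞ (radialField g Q) :=
  (contDiff_radial hg).smul (contDiff_polyField Q)

lemma curl_radialField {g : ℝ → ℝ} {g' : ℝ} {x : R3} (hg : HasDerivAt g g' (‖x‖ ^ 2))
    (Q : Fin 3 → Poly3) :
    curl (radialField g Q) x = (g (‖x‖ ^ 2) : ℂ) • polyField (polyCurl Q) x +
      ((2 * g' : ℝ) : ℂ) • polyField (polyWedge Q) x := by
  rw [← curl_polyField, ← wedge_polyField]
  exact curl_radial_smul hg (contDiff_polyField Q)

/-- The gradient of g(|x|²) is parallel to x and drops out against the radial field. For gradient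
fields the roles are reversed: there only the term with g' survives. -/
lemma curl_posField {g : ℝ → ℝ} {g' : ℝ} {x : R3} (hg : HasDerivAt g g' (‖x‖ ^ 2))
    (p : Poly3) :
    curl (radialField g (posField p)) x = -((g (‖x‖ ^ 2) : ℂ) • polyField (rotField p) x) := by
  rw [curl_radialField hg, polyCurl_posField, polyWedge_posField]
  ext i
  simp [polyField_apply, polyFun_neg, polyFun_zero]

lemma curl_gradField {g : ℝ → ℝ} {g' : ℝ} {x : R3} (hg : HasDerivAt g g' (‖x‖ ^ 2))
    (p : Poly3) :
    curl (radialField g (gradField p)) x = ((2 * g' : ℝ) : ℂ) • polyField (rotField p) x := by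
  rw [curl_radialField hg, polyCurl_gradField, ← rotField]
  ext i
  simp [polyField_apply, polyFun_zero]

/-- Together with `curl_posField` and `curl_gradField` this reduces Maxwell's system, for a fixed
harmonic p, to ordinary differential equations in s = |x|². -/
lemma curl_rotField {g : ℝ → ℝ} {g' : ℝ} {x : R3} (hg : HasDerivAt g g' (‖x‖ ^ 2))
    {n : ℕ} {p : Poly3} (hp : p ∈ harmonics n) :
    curl (radialField g (rotField p)) x =
      ((2 * n * g' : ℝ) : ℂ) • polyField (posField p) x -
      (((n + 1) * g (‖x‖ ^ 2) + 2 * ‖x‖ ^ 2 * g' : ℝ) : ℂ) • polyField (gradField p) x := by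
  rw [curl_radialField hg]
  ext i
  simp only [PiLp.add_apply, PiLp.sub_apply, PiLp.smul_apply, polyField_apply, smul_eq_mul,
    polyCurl_rotField hp, polyWedge_rotField hp.1, polyFun_mul, polyFun_sub, polyFun_neg,
    polyFun_add, polyFun_natCast, polyFun_one, polyFun_normSqPoly]
  push_cast
  ring

/-- A function on `[1, ∞)` that decays faster than any power. -/
def RapidDecay (g : ℝ → ℝ) : Prop := ∀ N : ℕ, ∃ C : ℝ, ∀ s, 1 ≤ s → |g s| * s ^ N ≤ C

lemma RapidDecay.add {g h : ℝ → ℝ} (hg : RapidDecay g) (hh : RapidDecay h) :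
    RapidDecay (fun s => g s + h s) := fun N => by
  obtain ⟨C, hC⟩ := hg N
  obtain ⟨D, hD⟩ := hh N
  refine ⟨C + D, fun s hs => ?_⟩
  have h0 : 0 ≤ s ^ N := by positivity
  calc |g s + h s| * s ^ N ≤ (|g s| + |h s|) * s ^ N :=
        mul_le_mul_of_nonneg_right (abs_add_le _ _) h0
    _ ≤ C + D := by
        rw [add_mul]
        exact add_le_add (hC s hs) (hD s hs)

lemma RapidDecay.mul_of_le {g h : ℝ → ℝ} (hg : RapidDecay g) (K : ℝ) (m : ℕ)
    (hh : ∀ s, 1 ≤ s → |h s| ≤ K * s ^ m) : RapidDecay (fun s => h s * g s) := fun N => by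
  obtain ⟨C, hC⟩ := hg (m + N)
  refine ⟨|K| * C, fun s hs => ?_⟩
  have h0 : 0 ≤ s ^ N := by positivity
  calc |h s * g s| * s ^ N ≤ (|K| * s ^ m) * |g s| * s ^ N := by
        rw [abs_mul]
        have : |h s| ≤ |K| * s ^ m :=
          (hh s hs).trans (mul_le_mul_of_nonneg_right (le_abs_self K) (by positivity))
        gcongr
    _ = |K| * (|g s| * s ^ (m + N)) := by ring
    _ ≤ |K| * C := mul_le_mul_of_nonneg_left (hC s hs) (abs_nonneg K)

lemma RapidDecay.const_mul {g : ℝ → ℝ} (hg : RapidDecay g) (c : ℝ) :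
    RapidDecay (fun s => c * g s) :=
  hg.mul_of_le |c| 0 fun s _ => by simp

lemma RapidDecay.congr {g h : ℝ → ℝ} (hg : RapidDecay g) (e : ∀ s, 1 ≤ s → h s = g s) :
    RapidDecay h := fun N => by
  obtain ⟨C, hC⟩ := hg N
  exact ⟨C, fun s hs => by rw [e s hs]; exact hC s hs⟩

lemma norm_polyField_le (Q : Fin 3 → Poly3) :
    ∃ C : ℝ, 0 ≤ C ∧ ∃ m : ℕ, ∀ x : R3, 1 ≤ ‖x‖ → ‖polyField Q x‖ ≤ C * (‖x‖ ^ 2) ^ m := by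
  choose C hC m hm using fun i => polyFun_growth (Q i)
  have hsum : ∀ x : R3, ‖polyField Q x‖ ≤ ∑ i, ‖polyFun (Q i) x‖ := by
    intro x
    have : polyField Q x = ∑ i, EuclideanSpace.single i (polyFun (Q i) x) := by
      ext k
      fin_cases k <;> simp [polyField_apply, Fin.sum_univ_three]
    rw [this]
    refine (norm_sum_le _ _).trans (le_of_eq ?_)
    simp
  refine ⟨∑ i, C i * 2 ^ m i, Finset.sum_nonneg fun i _ => mul_nonneg (hC i) (by positivity),
    ∑ i, m i, fun x hx => (hsum x).trans ?_⟩
  rw [Finset.sum_mul]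
  refine Finset.sum_le_sum fun i _ => (hm i x).trans ?_
  rw [mul_assoc]
  refine mul_le_mul_of_nonneg_left ?_ (hC i)
  have h1 : 1 + ‖x‖ ≤ 2 * ‖x‖ ^ 2 := by nlinarith
  calc (1 + ‖x‖) ^ m i ≤ (2 * ‖x‖ ^ 2) ^ m i := by gcongr
    _ = 2 ^ m i * (‖x‖ ^ 2) ^ m i := mul_pow _ _ _
    _ ≤ 2 ^ m i * (‖x‖ ^ 2) ^ ∑ i, m i := by
        have h2 : 1 ≤ ‖x‖ ^ 2 := one_le_pow₀ hx
        have h3 : m i ≤ ∑ i, m i := Finset.single_le_sum (fun _ _ => Nat.zero_le _)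
          (Finset.mem_univ i)
        gcongr

/-- Comparison with (1 + |x|)⁻², which is square integrable because 4 > 3; the factor 4 comes from 1
+ |x| ≤ 2|x| outside the unit ball. -/
lemma memLp_of_norm_le {F : R3 → C3} (hF : Continuous F) (C : ℝ)
    (h : ∀ x : R3, 1 < ‖x‖ → ‖F x‖ * ‖x‖ ^ 2 ≤ C) : MemLp F 2 extMeasure := by
  have h1 : Integrable (fun x : R3 => (1 + ‖x‖) ^ (-4 : ℝ)) volume :=
    integrable_one_add_norm (by simp; norm_num)
  have h2 : MemLp (fun x : R3 => (1 + ‖x‖) ^ (-2 : ℝ)) 2 extMeasure := by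
    have hc : Continuous (fun x : R3 => (1 + ‖x‖) ^ (-2 : ℝ)) :=
      (continuous_const.add continuous_norm).rpow_const fun x =>
        Or.inl (add_pos_of_pos_of_nonneg one_pos (norm_nonneg x)).ne'
    rw [memLp_two_iff_integrable_sq hc.aestronglyMeasurable]
    refine (h1.restrict (s := exteriorDomain)).congr (ae_of_all _ fun x => ?_)
    change (1 + ‖x‖) ^ (-4 : ℝ) = ((1 + ‖x‖) ^ (-2 : ℝ)) ^ 2
    rw [← Real.rpow_natCast, ← Real.rpow_mul (by positivity)]
    norm_num
  refine (h2.const_mul (4 * C)).mono hF.aestronglyMeasurable ?_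
  rw [ae_restrict_iff' isOpen_exteriorDomain.measurableSet]
  refine ae_of_all _ fun x (hx : 1 < ‖x‖) => ?_
  have h3 := h x hx
  have h4 : (1 + ‖x‖) ^ 2 ≤ 4 * ‖x‖ ^ 2 := by nlinarith
  refine le_trans ?_ (le_abs_self _)
  have h5 : (1 + ‖x‖) ^ (-2 : ℝ) = ((1 + ‖x‖) ^ 2)⁻¹ := by
    rw [Real.rpow_neg (by positivity)]
    norm_num
  rw [h5, ← div_eq_mul_inv, le_div_iff₀ (by positivity)]
  nlinarith [norm_nonneg (F x), mul_le_mul_of_nonneg_left h4 (norm_nonneg (F x))]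

lemma memLp_radialField {g : ℝ → ℝ} (hg : Continuous g) (hd : RapidDecay g)
    (Q : Fin 3 → Poly3) : MemLp (radialField g Q) 2 extMeasure := by
  obtain ⟨C, hC, m, hm⟩ := norm_polyField_le Q
  obtain ⟨D, hD⟩ := hd (m + 1)
  have hc : Continuous (radialField g Q) :=
    (Complex.continuous_ofReal.comp (hg.comp (continuous_norm.pow 2))).smul
      (contDiff_polyField Q).continuous
  refine memLp_of_norm_le hc (C * D) fun x hx => ?_
  have h1 : 1 ≤ ‖x‖ ^ 2 := one_le_pow₀ hx.le
  rw [radialField, norm_smul, Complex.norm_real, Real.norm_eq_abs]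
  calc |g (‖x‖ ^ 2)| * ‖polyField Q x‖ * ‖x‖ ^ 2
      ≤ |g (‖x‖ ^ 2)| * (C * (‖x‖ ^ 2) ^ m) * ‖x‖ ^ 2 := by
        have := hm x hx.le
        gcongr
    _ = C * (|g (‖x‖ ^ 2)| * (‖x‖ ^ 2) ^ (m + 1)) := by ring
    _ ≤ C * D := mul_le_mul_of_nonneg_left (hD _ h1) hC

/-- The bilinear pairing with a square integrable field is continuous on `L²`. -/
lemma exists_pairing {Φ : R3 → C3} (hΦ : MemLp Φ 2 extMeasure) :
    ∃ T : L2Field →L[ℂ] ℂ, ∀ u : L2Field, T u = ∫ x in exteriorDomain, dot (u x) (Φ x) := by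
  have hcont : Continuous (fun a : C3 => (WithLp.toLp 2 fun i => star (a i) : C3)) :=
    (PiLp.continuous_toLp 2 _).comp (continuous_pi fun i => by fun_prop)
  have hm : MemLp (fun x => (WithLp.toLp 2 fun i => star (Φ x i) : C3)) 2 extMeasure := by
    refine hΦ.of_le (hcont.comp_aestronglyMeasurable hΦ.1) (ae_of_all _ fun x => le_of_eq ?_)
    simp [EuclideanSpace.norm_eq]
  refine ⟨innerSL ℂ (hm.toLp _), fun u => ?_⟩
  rw [innerSL_apply_apply, L2.inner_def]
  refine integral_congr_ae ?_
  filter_upwards [hm.coeFn_toLp] with x hx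
  rw [hx]
  simp [PiLp.inner_apply, dot]

lemma integrable_dot {u Φ : R3 → C3} (hu : MemLp u 2 extMeasure) (hΦ : MemLp Φ 2 extMeasure) :
    Integrable (fun x => dot (u x) (Φ x)) extMeasure := by
  refine integrable_finsetSum _ fun i _ => ?_
  exact ((EuclideanSpace.proj i : C3 →L[ℂ] ℂ).comp_memLp' hu).integrable_mul
    ((EuclideanSpace.proj i : C3 →L[ℂ] ℂ).comp_memLp' hΦ)

end MaxwellExterior

/-! ### The divergence theorem in the exterior domain -/

namespace MaxwellExterior

open Filter Topology

lemma deriv_smoothTransition_bounded :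
    ∃ M : ℝ, ∀ t, |deriv Real.smoothTransition t| ≤ M := by
  have hc : Continuous (deriv Real.smoothTransition) :=
    (Real.smoothTransition.contDiff (n := 1)).continuous_deriv le_rfl
  have hs : HasCompactSupport (deriv Real.smoothTransition) := by
    refine HasCompactSupport.intro (isCompact_Icc (a := (0 : ℝ)) (b := 1)) fun t ht => ?_
    rw [mem_Icc, not_and_or, not_le, not_le] at ht
    rcases ht with h | h
    · have : Real.smoothTransition =ᶠ[𝓝 t] fun _ => 0 := by
        filter_upwards [Iio_mem_nhds h] with s hs
        exact Real.smoothTransition.zero_of_nonpos (le_of_lt hs)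
      rw [this.deriv_eq, deriv_const]
    · have : Real.smoothTransition =ᶠ[𝓝 t] fun _ => 1 := by
        filter_upwards [Ioi_mem_nhds h] with s hs
        exact Real.smoothTransition.one_of_one_le (le_of_lt hs)
      rw [this.deriv_eq, deriv_const]
  obtain ⟨M, hM⟩ := hs.exists_bound_of_continuous hc
  exact ⟨M, hM⟩

lemma deriv_smoothTransition_of_nonpos {t : ℝ} (ht : t ≤ 0) :
    deriv Real.smoothTransition t = 0 := by
  have hmin : IsLocalMin Real.smoothTransition t := by
    refine Eventually.of_forall fun s => ?_
    rw [Real.smoothTransition.zero_of_nonpos ht]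
    exact Real.smoothTransition.nonneg s
  exact hmin.deriv_eq_zero

lemma deriv_smoothTransition_of_one_le {t : ℝ} (ht : 1 ≤ t) :
    deriv Real.smoothTransition t = 0 := by
  have hmax : IsLocalMax Real.smoothTransition t := by
    refine Eventually.of_forall fun s => ?_
    rw [Real.smoothTransition.one_of_one_le ht]
    exact Real.smoothTransition.le_one s
  exact hmax.deriv_eq_zero

lemma fderiv_radial {g : ℝ → ℝ} {g' : ℝ} {x : R3} (hg : HasDerivAt g g' (‖x‖ ^ 2)) (j : Fin 3) :
    fderiv ℝ (fun y : R3 => ((g (‖y‖ ^ 2) : ℝ) : ℂ)) x (EuclideanSpace.single j 1) =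
      2 * g' * x j := by
  have h1 : HasFDerivAt (fun y : R3 => ((g (‖y‖ ^ 2) : ℝ) : ℂ))
      (Complex.ofRealCLM ∘L (g' • (2 • (innerSL ℝ x : R3 →L[ℝ] ℝ)))) x :=
    Complex.ofRealCLM.hasFDerivAt.comp x (hg.comp_hasFDerivAt x (hasFDerivAt_normSq x))
  rw [h1.fderiv]
  simp [EuclideanSpace.inner_single_right]
  ring

/-- A `C¹` compactly supported function that vanishes on the unit sphere is `O(|x| - 1)`. -/
lemma norm_le_of_eq_zero_on_sphere {m : R3 → ℂ} (hm : ContDiff ℝ 1 m) (hc : HasCompactSupport m)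
    (h0 : ∀ x, ‖x‖ = 1 → m x = 0) :
    ∃ C : ℝ, 0 ≤ C ∧ ∀ x : R3, 1 ≤ ‖x‖ → ‖m x‖ ≤ C * (‖x‖ - 1) := by
  obtain ⟨C, hC⟩ := hm.lipschitzWith_of_hasCompactSupport hc one_ne_zero
  refine ⟨C, C.2, fun x hx => ?_⟩
  have hx0 : 0 < ‖x‖ := by linarith
  -- The Lipschitz bound is applied to x and its projection x/|x|, which lies at distance |x| - 1
  -- and where m vanishes.
  have h1 : ‖(‖x‖⁻¹ : ℝ) • x‖ = 1 := by
    rw [norm_smul, norm_inv, norm_norm, inv_mul_cancel₀ hx0.ne']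
  have h2 := hC.dist_le_mul x ((‖x‖⁻¹ : ℝ) • x)
  rw [h0 _ h1, dist_zero_right, dist_eq_norm] at h2
  have h3 : x - (‖x‖⁻¹ : ℝ) • x = (1 - ‖x‖⁻¹ : ℝ) • x := by rw [sub_smul, one_smul]
  have h4 : 0 ≤ 1 - ‖x‖⁻¹ := sub_nonneg.2 (inv_le_one_of_one_le₀ hx)
  rwa [h3, norm_smul, Real.norm_of_nonneg h4, sub_mul, one_mul, inv_mul_cancel₀ hx0.ne'] at h2

/-- The divergence theorem in the exterior domain for fields tangential to the boundary. -/
theorem integral_div_eq_zero (F : Fin 3 → R3 → ℂ) (hF : ∀ i, ContDiff ℝ 1 (F i))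
    (hc : ∀ i, HasCompactSupport (F i)) (h0 : ∀ x : R3, ‖x‖ = 1 → ∑ i, (x i : ℂ) * F i x = 0) :
    ∫ x in exteriorDomain, ∑ i, fderiv ℝ (F i) x (EuclideanSpace.single i 1) = 0 := by
  set D : R3 → ℂ := fun x => ∑ i, fderiv ℝ (F i) x (EuclideanSpace.single i 1) with hD
  set m : R3 → ℂ := fun x => ∑ i, (x i : ℂ) * F i x with hm
  have hcd : ∀ i, Continuous (fun x => fderiv ℝ (F i) x (EuclideanSpace.single i 1)) := fun i =>
    ((hF i).continuous_fderiv one_ne_zero).clm_apply continuous_const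
  have hcs : ∀ i, HasCompactSupport (fun x => fderiv ℝ (F i) x (EuclideanSpace.single i 1)) :=
    fun i => (hc i).fderiv_apply ℝ _
  have hid : ∀ i, Integrable (fun x => fderiv ℝ (F i) x (EuclideanSpace.single i 1)) := fun i =>
    (hcd i).integrable_of_hasCompactSupport (hcs i)
  have hDint : Integrable D := integrable_finsetSum _ fun i _ => hid i
  have hm1 : ContDiff ℝ 1 m := ContDiff.sum fun i _ =>
    ((contDiff_coord i).of_le (by simp)).mul (hF i)
  have hmc : HasCompactSupport m := by
    have : m = fun x => (x 0 : ℂ) * F 0 x + (x 1 : ℂ) * F 1 x + (x 2 : ℂ) * F 2 x := by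
      funext x
      rw [hm]
      exact Fin.sum_univ_three _
    rw [this]
    exact (((hc 0).mul_left).add (hc 1).mul_left).add (hc 2).mul_left
  obtain ⟨C, hC0, hC⟩ := norm_le_of_eq_zero_on_sphere hm1 hmc h0
  obtain ⟨M, hM⟩ := deriv_smoothTransition_bounded
  have hM0 : 0 ≤ M := (abs_nonneg _).trans (hM 0)
  -- Inner cutoffs tending to the indicator of s > 1; they vary only in the layer 0 < s - 1 < 1/(j +
  -- 1).
  let g : ℕ → ℝ → ℝ := fun j s => Real.smoothTransition ((j + 1) * (s - 1))
  have hg : ∀ j, ContDiff ℝ ∞ (g j) := fun j =>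
    Real.smoothTransition.contDiff.comp (contDiff_const.mul (contDiff_id.sub contDiff_const))
  have hg' : ∀ j s, HasDerivAt (g j)
      ((j + 1) * deriv Real.smoothTransition ((j + 1) * (s - 1))) s := by
    intro j s
    have h1 : HasDerivAt (fun s : ℝ => ((j : ℝ) + 1) * (s - 1)) ((j : ℝ) + 1) s := by
      simpa using ((hasDerivAt_id s).sub_const 1).const_mul ((j : ℝ) + 1)
    have h2 := ((Real.smoothTransition.contDiff (n := 1)).differentiable one_ne_zero
      (((j : ℝ) + 1) * (s - 1))).hasDerivAt.comp s h1
    rw [mul_comm]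
    exact h2
  -- The gradient of the cutoff is a multiple of x, so integration by parts leaves only the radial
  -- component m = x · F.
  have hparts : ∀ j, ∫ x, ((g j (‖x‖ ^ 2) : ℝ) : ℂ) * D x =
      -∫ x : R3, ((2 * ((j + 1) * deriv Real.smoothTransition ((j + 1) * (‖x‖ ^ 2 - 1))) : ℝ) : ℂ) *
        m x := by
    intro j
    have hgc := contDiff_radial (hg j)
    have hgd : ∀ i, Continuous (fun x => fderiv ℝ (fun y : R3 => ((g j (‖y‖ ^ 2) : ℝ) : ℂ)) x
        (EuclideanSpace.single i 1)) := fun i =>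
      (hgc.continuous_fderiv (by simp)).clm_apply continuous_const
    have e1 : ∀ i, ∫ x, ((g j (‖x‖ ^ 2) : ℝ) : ℂ) * fderiv ℝ (F i) x (EuclideanSpace.single i 1) =
        -∫ x, fderiv ℝ (fun y : R3 => ((g j (‖y‖ ^ 2) : ℝ) : ℂ)) x (EuclideanSpace.single i 1) *
          F i x := by
      intro i
      refine integral_mul_fderiv_eq_neg_fderiv_mul_of_integrable ?_ ?_ ?_ ?_ ?_
      · exact ((hgd i).mul (hF i).continuous).integrable_of_hasCompactSupport (hc i).mul_left
      · exact (hgc.continuous.mul (hcd i)).integrable_of_hasCompactSupport (hcs i).mul_left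
      · exact (hgc.continuous.mul (hF i).continuous).integrable_of_hasCompactSupport
          (hc i).mul_left
      · exact fun x _ => hgc.differentiable (by simp) x
      · exact fun x _ => (hF i).differentiable one_ne_zero x
    simp only [hD, hm, Finset.mul_sum]
    rw [integral_finsetSum, integral_finsetSum, ← Finset.sum_neg_distrib]
    · refine Finset.sum_congr rfl fun i _ => ?_
      rw [e1]
      congr 1
      refine integral_congr_ae (ae_of_all _ fun x => ?_)
      simp only
      rw [fderiv_radial (hg' j _)]
      push_cast
      ring
    · intro i _
      have h1 : Integrable (fun x => fderiv ℝ (fun y : R3 => ((g j (‖y‖ ^ 2) : ℝ) : ℂ)) x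
          (EuclideanSpace.single i 1) * F i x) :=
        ((hgd i).mul (hF i).continuous).integrable_of_hasCompactSupport (hc i).mul_left
      refine h1.congr (ae_of_all _ fun x => ?_)
      simp only
      rw [fderiv_radial (hg' j _)]
      push_cast
      ring
    · intro i _
      exact (hgc.continuous.mul (hcd i)).integrable_of_hasCompactSupport (hcs i).mul_left
  have hpos : ∀ j : ℕ, (0 : ℝ) < (j : ℝ) + 1 := fun j => by positivity
  have lim1 : Tendsto (fun j => ∫ x, ((g j (‖x‖ ^ 2) : ℝ) : ℂ) * D x) atTop
      (𝓝 (∫ x in exteriorDomain, D x)) := by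
    rw [← integral_indicator isOpen_exteriorDomain.measurableSet]
    refine tendsto_integral_of_dominated_convergence (fun x => ‖D x‖) ?_ hDint.norm ?_ ?_
    · exact fun j => ((contDiff_radial (hg j)).continuous.aestronglyMeasurable).mul hDint.1
    · refine fun j => ae_of_all _ fun x => ?_
      rw [norm_mul, Complex.norm_real, Real.norm_of_nonneg (Real.smoothTransition.nonneg _)]
      exact mul_le_of_le_one_left (norm_nonneg _) (Real.smoothTransition.le_one _)
    · refine ae_of_all _ fun x => ?_
      by_cases hx : x ∈ exteriorDomain
      · rw [indicator_of_mem hx]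
        have hx1 : 0 < ‖x‖ ^ 2 - 1 := by
          have : 1 < ‖x‖ := hx
          nlinarith
        obtain ⟨J, hJ⟩ := exists_nat_gt (1 / (‖x‖ ^ 2 - 1))
        refine tendsto_const_nhds.congr' ?_
        filter_upwards [eventually_ge_atTop J] with j hj
        have : g j (‖x‖ ^ 2) = 1 := by
          refine Real.smoothTransition.one_of_one_le ?_
          rw [div_lt_iff₀ hx1] at hJ
          have : (J : ℝ) ≤ j := by exact_mod_cast hj
          nlinarith
        rw [this, Complex.ofReal_one, one_mul]
      · rw [indicator_of_notMem hx]
        refine tendsto_const_nhds.congr fun j => ?_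
        have hx1 : ‖x‖ ≤ 1 := not_lt.1 hx
        have : g j (‖x‖ ^ 2) = 0 := by
          refine Real.smoothTransition.zero_of_nonpos ?_
          have : ‖x‖ ^ 2 ≤ 1 := pow_le_one₀ (norm_nonneg _) hx1
          have := hpos j
          nlinarith
        rw [this, Complex.ofReal_zero, zero_mul]
  -- In the layer the derivative of the cutoff is at most (j + 1)M, while m is at most C(|x|² - 1) ≤
  -- C/(j + 1). The integrand is thus bounded by 2MC on a fixed ball, and at every point it is
  -- eventually zero.
  have lim2 : Tendsto (fun j : ℕ => ∫ x : R3,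
      ((2 * ((j + 1) * deriv Real.smoothTransition ((j + 1) * (‖x‖ ^ 2 - 1))) : ℝ) : ℂ) * m x)
      atTop (𝓝 (∫ _x : R3, (0 : ℂ))) := by
    refine tendsto_integral_of_dominated_convergence
      ((Metric.closedBall (0 : R3) 2).indicator fun _ => 2 * M * C) ?_ ?_ ?_ ?_
    · intro j
      have h1 : Continuous (deriv Real.smoothTransition) :=
        (Real.smoothTransition.contDiff (n := 1)).continuous_deriv le_rfl
      have h2 : Continuous fun x : R3 => ((j : ℝ) + 1) * (‖x‖ ^ 2 - 1) := by fun_prop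
      have h3 := h1.comp h2
      have h4 : Continuous fun x : R3 =>
          (2 * (((j : ℝ) + 1) * deriv Real.smoothTransition ((j + 1) * (‖x‖ ^ 2 - 1)))) :=
        continuous_const.mul (continuous_const.mul h3)
      exact ((Complex.continuous_ofReal.comp h4).mul hm1.continuous).aestronglyMeasurable
    · exact (integrable_indicator_iff measurableSet_closedBall).2
        (integrableOn_const measure_closedBall_lt_top.ne)
    · refine fun j => ae_of_all _ fun x => ?_
      have hj := hpos j
      by_cases ht : ((j : ℝ) + 1) * (‖x‖ ^ 2 - 1) ≤ 0
      · rw [deriv_smoothTransition_of_nonpos ht]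
        simp only [mul_zero, Complex.ofReal_zero, zero_mul, norm_zero]
        exact indicator_nonneg (fun _ _ => by positivity) _
      by_cases ht' : 1 ≤ ((j : ℝ) + 1) * (‖x‖ ^ 2 - 1)
      · rw [deriv_smoothTransition_of_one_le ht']
        simp only [mul_zero, Complex.ofReal_zero, zero_mul, norm_zero]
        exact indicator_nonneg (fun _ _ => by positivity) _
      rw [not_le] at ht ht'
      have hs : 0 < ‖x‖ ^ 2 - 1 := pos_of_mul_pos_right ht hj.le
      have hx1 : 1 < ‖x‖ := by nlinarith [norm_nonneg x]
      have hle : ‖x‖ - 1 ≤ ‖x‖ ^ 2 - 1 := by nlinarith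
      have hx2 : ‖x‖ ≤ 2 := by
        have : (0 : ℝ) ≤ j := Nat.cast_nonneg j
        nlinarith
      rw [indicator_of_mem (by simpa using hx2), norm_mul, Complex.norm_real, Real.norm_eq_abs,
        abs_mul, abs_mul, abs_of_pos hj, abs_two]
      have h1 := hC x hx1.le
      calc 2 * (((j : ℝ) + 1) * |deriv Real.smoothTransition ((j + 1) * (‖x‖ ^ 2 - 1))|) * ‖m x‖
          ≤ 2 * (((j : ℝ) + 1) * M) * (C * (‖x‖ ^ 2 - 1)) := by
            have h2 := hM (((j : ℝ) + 1) * (‖x‖ ^ 2 - 1))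
            have h3 : ‖m x‖ ≤ C * (‖x‖ ^ 2 - 1) :=
              h1.trans (mul_le_mul_of_nonneg_left hle hC0)
            gcongr
        _ = 2 * M * C * (((j : ℝ) + 1) * (‖x‖ ^ 2 - 1)) := by ring
        _ ≤ 2 * M * C * 1 := mul_le_mul_of_nonneg_left ht'.le (by positivity)
        _ = 2 * M * C := mul_one _
    · refine ae_of_all _ fun x => ?_
      by_cases hx : ‖x‖ ^ 2 ≤ 1
      · refine tendsto_const_nhds.congr fun j => ?_
        rw [deriv_smoothTransition_of_nonpos]
        · simp
        · have := hpos j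
          nlinarith
      · rw [not_le] at hx
        have hx1 : 0 < ‖x‖ ^ 2 - 1 := by linarith
        obtain ⟨J, hJ⟩ := exists_nat_gt (1 / (‖x‖ ^ 2 - 1))
        refine tendsto_const_nhds.congr' ?_
        filter_upwards [eventually_ge_atTop J] with j hj
        rw [deriv_smoothTransition_of_one_le]
        · simp
        · rw [div_lt_iff₀ hx1] at hJ
          have : (J : ℝ) ≤ j := by exact_mod_cast hj
          nlinarith
  have := tendsto_nhds_unique lim1 (by simpa only [hparts] using lim2.neg)
  simpa using this

/-! ### Green's formula and weak solutions -/

lemma contDiff_wedge_apply {v w : R3 → C3} (hv : ContDiff ℝ ∞ v) (hw : ContDiff ℝ ∞ w)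
    (i : Fin 3) : ContDiff ℝ ∞ (fun x => wedge (v x) (w x) i) := by
  have h1 : ∀ k, ContDiff ℝ ∞ (fun x => v x k) := fun k => by fun_prop
  have h2 : ∀ k, ContDiff ℝ ∞ (fun x => w x k) := fun k => by fun_prop
  simp only [wedge_apply]
  exact ((h1 _).mul (h2 _)).sub ((h1 _).mul (h2 _))

lemma fderiv_wedge_apply {v w : R3 → C3} (hv : ContDiff ℝ ∞ v) (hw : ContDiff ℝ ∞ w)
    (i j : Fin 3) (x : R3) :
    fderiv ℝ (fun y => wedge (v y) (w y) i) x (EuclideanSpace.single j 1) =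
      partialDeriv v j (i + 1) x * w x (i + 2) + v x (i + 1) * partialDeriv w j (i + 2) x -
      (partialDeriv v j (i + 2) x * w x (i + 1) + v x (i + 2) * partialDeriv w j (i + 1) x) := by
  have h1 := fun k => (differentiable_comp hv k x).hasFDerivAt
  have h2 := fun k => (differentiable_comp hw k x).hasFDerivAt
  have h := ((h1 (i + 1)).mul (h2 (i + 2))).sub ((h1 (i + 2)).mul (h2 (i + 1)))
  have e : (fun y => wedge (v y) (w y) i) = ((fun y => v y (i + 1)) * fun y => w y (i + 2)) -
      (fun y => v y (i + 2)) * fun y => w y (i + 1) := by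
    funext y
    exact wedge_apply _ _ _
  rw [e, h.fderiv]
  simp only [sub_apply, add_apply, smul_apply, smul_eq_mul, partialDeriv]
  ring

lemma div_wedge {v w : R3 → C3} (hv : ContDiff ℝ ∞ v) (hw : ContDiff ℝ ∞ w) (x : R3) :
    ∑ i, fderiv ℝ (fun y => wedge (v y) (w y) i) x (EuclideanSpace.single i 1) =
      dot (curl v x) (w x) - dot (v x) (curl w x) := by
  simp only [fderiv_wedge_apply hv hw, dot, curl_apply, Fin.sum_univ_three]
  simp only [Fin.isValue, Fin.reduceAdd, zero_add]
  ring

lemma contDiff_curl {v : R3 → C3} (hv : ContDiff ℝ ∞ v) : ContDiff ℝ ∞ (curl v) := by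
  have h1 : ∀ k, ContDiff ℝ ∞ (fun x => v x k) := fun k => by fun_prop
  have h2 : ∀ j k, ContDiff ℝ ∞ (partialDeriv v j k) := fun j k =>
    ((h1 k).fderiv_right (m := ∞) (by simp)).clm_apply contDiff_const
  refine (contDiff_piLp 2).2 fun i => ?_
  simp only [curl_apply]
  exact (h2 _ _).sub (h2 _ _)

/-- The boundary condition on the test fields of the weak formulation. -/
def DualBoundaryCondition (γ : ℝ) (Φ Ψ : R3 → C3) : Prop :=
  ∀ x : R3, ‖x‖ = 1 → (γ : ℂ) • tangential x (Ψ x) = wedge (normal x) (Φ x)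

/-- The dual condition is designed for this. It turns x · (w ∧ Φ) = -w · (x ∧ Φ) into -γ w · Ψ_tan,
and the condition on (v, w) turns x · (v ∧ Ψ) = -v · (x ∧ Ψ) into -γ (x ∧ w) · (x ∧ Ψ), which is the
same number. -/
lemma boundary_flux {γ : ℝ} {v w Φ Ψ : R3 → C3} (hb : BoundaryCondition γ v w)
    (hd : DualBoundaryCondition γ Φ Ψ) {x : R3} (hx : ‖x‖ = 1) :
    ∑ i, (x i : ℂ) * (wedge (w x) (Φ x) i - wedge (v x) (Ψ x) i) = 0 := by
  have h1 : ∀ k, _ := fun k => congrArg (fun a : C3 => a k) (hb x hx)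
  have h2 : ∀ k, _ := fun k => congrArg (fun a : C3 => a k) (hd x hx)
  have hN := dot_normal_self x
  rw [hx] at hN
  simp only [tangential, inner_normal, PiLp.sub_apply, PiLp.smul_apply, wedge_apply, smul_eq_mul,
    dot, Fin.sum_univ_three, normal_apply, PiLp.zero_apply] at h1 h2 hN
  have a0 := h1 0
  have a1 := h1 1
  have a2 := h1 2
  have b0 := h2 0
  have b1 := h2 1
  have b2 := h2 2
  simp only [Fin.isValue, Fin.reduceAdd, zero_add] at a0 a1 a2 b0 b1 b2
  simp only [Fin.sum_univ_three, wedge_apply, Fin.isValue, Fin.reduceAdd, zero_add]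
  push_cast at hN
  linear_combination w x 0 * b0 + w x 1 * b1 + w x 2 * b2 +
    (x 1 * Ψ x 2 - x 2 * Ψ x 1) * a0 + (x 2 * Ψ x 0 - x 0 * Ψ x 2) * a1 +
    (x 0 * Ψ x 1 - x 1 * Ψ x 0) * a2 +
    γ * (Ψ x 0 * w x 0 + Ψ x 1 * w x 1 + Ψ x 2 * w x 2) * hN

lemma hasCompactSupport_curl {v : R3 → C3} (hv : HasCompactSupport v) :
    HasCompactSupport (curl v) := by
  refine hv.mono' fun x hx => ?_
  by_contra h
  refine hx ?_
  have h0 : v =ᶠ[𝓝 x] 0 := notMem_tsupport_iff_eventuallyEq.1 h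
  have h1 : ∀ j k, partialDeriv v j k x = 0 := by
    intro j k
    have : (fun y => v y k) =ᶠ[𝓝 x] fun _ => 0 := by
      filter_upwards [h0] with y hy
      rw [hy]
      rfl
    rw [partialDeriv, this.fderiv_eq]
    simp
  ext k
  simp [curl_apply, h1]

/-- Green's formula for fields satisfying the boundary condition. -/
theorem green {γ : ℝ} {v w Φ Ψ : R3 → C3} (hv : ContDiff ℝ ∞ v) (hvc : HasCompactSupport v)
    (hw : ContDiff ℝ ∞ w) (hwc : HasCompactSupport w) (hΦ : ContDiff ℝ ∞ Φ) (hΨ : ContDiff ℝ ∞ Ψ)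
    (hb : BoundaryCondition γ v w) (hd : DualBoundaryCondition γ Φ Ψ) :
    ∫ x in exteriorDomain, (dot (curl w x) (Φ x) - dot (w x) (curl Φ x) -
      (dot (curl v x) (Ψ x) - dot (v x) (curl Ψ x))) = 0 := by
  have h := integral_div_eq_zero
    (fun i x => wedge (w x) (Φ x) i - wedge (v x) (Ψ x) i)
    (fun i => ((contDiff_wedge_apply hw hΦ i).sub (contDiff_wedge_apply hv hΨ i)).of_le (by simp))
    (fun i => by
      have h1 : ∀ k, HasCompactSupport (fun x => v x k) := fun k =>
        hvc.comp_left (g := fun a : C3 => a k) rfl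
      have h2 : ∀ k, HasCompactSupport (fun x => w x k) := fun k =>
        hwc.comp_left (g := fun a : C3 => a k) rfl
      simp only [wedge_apply]
      exact ((h2 _).mul_right.sub (h2 _).mul_right).sub ((h1 _).mul_right.sub (h1 _).mul_right))
    (fun x hx => boundary_flux hb hd hx)
  rw [← h]
  refine integral_congr_ae (ae_of_all _ fun x => ?_)
  simp only
  rw [← div_wedge hw hΦ, ← div_wedge hv hΨ, ← Finset.sum_sub_distrib]
  refine Finset.sum_congr rfl fun i _ => ?_
  rw [fderiv_fun_sub ((contDiff_wedge_apply hw hΦ i).differentiable (by simp) x)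
    ((contDiff_wedge_apply hv hΨ i).differentiable (by simp) x)]
  rfl

/-- Green's formula on the closure of the core graph. -/
theorem green_closure {γ : ℝ} {Φ Ψ : R3 → C3} (hΦ : ContDiff ℝ ∞ Φ) (hΨ : ContDiff ℝ ∞ Ψ)
    (hΦ2 : MemLp Φ 2 extMeasure) (hΨ2 : MemLp Ψ 2 extMeasure)
    (hcΦ : MemLp (curl Φ) 2 extMeasure) (hcΨ : MemLp (curl Ψ) 2 extMeasure)
    (hd : DualBoundaryCondition γ Φ Ψ) {p : StateSpace × StateSpace}
    (hp : p ∈ (coreGraph γ).topologicalClosure) :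
    (∫ x in exteriorDomain, dot (p.2.fst x) (Φ x)) + ∫ x in exteriorDomain, dot (p.2.snd x) (Ψ x) =
      (∫ x in exteriorDomain, dot (p.1.snd x) (curl Φ x)) -
        ∫ x in exteriorDomain, dot (p.1.fst x) (curl Ψ x) := by
  obtain ⟨A, hA⟩ := exists_pairing hΦ2
  obtain ⟨B, hB⟩ := exists_pairing hΨ2
  obtain ⟨A', hA'⟩ := exists_pairing hcΦ
  obtain ⟨B', hB'⟩ := exists_pairing hcΨ
  simp only [← hA, ← hB, ← hA', ← hB']
  -- Every integral is a continuous functional of p, so the identity passes from the core to its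
  -- closure.
  have hclosed : IsClosed {p : StateSpace × StateSpace |
      A p.2.fst + B p.2.snd = A' p.1.snd - B' p.1.fst} := by
    refine isClosed_eq ?_ ?_ <;> fun_prop
  refine closure_minimal (t := {p : StateSpace × StateSpace |
      A p.2.fst + B p.2.snd = A' p.1.snd - B' p.1.fst}) ?_ hclosed hp
  rintro q ⟨v, w, hv, hvc, hw, hwc, hb, h1, h2, h3, h4⟩
  have key : ∀ (u : L2Field) (z X : R3 → C3), u =ᵐ[extMeasure] z →
      ∫ x in exteriorDomain, dot (u x) (X x) = ∫ x in exteriorDomain, dot (z x) (X x) := by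
    intro u z X h
    refine integral_congr_ae ?_
    filter_upwards [h] with x hx
    rw [hx]
  have mem : ∀ {z : R3 → C3}, ContDiff ℝ ∞ z → HasCompactSupport z → MemLp z 2 extMeasure :=
    fun hz hzc => hz.continuous.memLp_of_hasCompactSupport hzc
  have g := green hv hvc hw hwc hΦ hΨ hb hd
  have i1 := integrable_dot (mem (contDiff_curl hw) (hasCompactSupport_curl hwc)) hΦ2
  have i2 := integrable_dot (mem hw hwc) hcΦ
  have i3 := integrable_dot (mem (contDiff_curl hv) (hasCompactSupport_curl hvc)) hΨ2
  have i4 := integrable_dot (mem hv hvc) hcΨ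
  have i12 : Integrable (fun x => dot (curl w x) (Φ x) - dot (w x) (curl Φ x)) extMeasure :=
    i1.sub i2
  have i34 : Integrable (fun x => dot (curl v x) (Ψ x) - dot (v x) (curl Ψ x)) extMeasure :=
    i3.sub i4
  rw [integral_sub i12 i34, integral_sub i1 i2, integral_sub i3 i4] at g
  change A q.2.fst + B q.2.snd = A' q.1.snd - B' q.1.fst
  rw [hA, hB, hA', hB', key _ _ _ h1, key _ _ _ h2, key _ _ _ h3, key _ _ _ h4]
  simp only [Pi.neg_apply, dot_neg_left, integral_neg]
  linear_combination g

/-- The weak form of `curl B = λ E`, `-curl E = λ B` with the boundary condition. -/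
def IsWeakSolution (γ lam : ℝ) (E B : R3 → C3) : Prop :=
  ∀ Φ Ψ : R3 → C3, ContDiff ℝ ∞ Φ → ContDiff ℝ ∞ Ψ → MemLp Φ 2 extMeasure → MemLp Ψ 2 extMeasure →
    MemLp (curl Φ) 2 extMeasure → MemLp (curl Ψ) 2 extMeasure → DualBoundaryCondition γ Φ Ψ →
    ∫ x in exteriorDomain, (dot (E x) ((lam : ℂ) • Φ x + curl Ψ x) +
      dot (B x) ((lam : ℂ) • Ψ x - curl Φ x)) = 0

/-- Green's formula for the point (u, λu) of the closed graph. The rest of the upper bound on the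
multiplicity uses only this weak form and the square integrability of u. -/
lemma IsWeakSolution.of_mem_eigenspace {γ lam : ℝ} {u : StateSpace}
    (hu : u ∈ eigenspace (generator γ) (lam : ℂ)) : IsWeakSolution γ lam u.fst u.snd := by
  intro Φ Ψ hΦ hΨ hΦ2 hΨ2 hcΦ hcΨ hd
  obtain ⟨hdom, hG⟩ := hu
  have hp : (u, (lam : ℂ) • u) ∈ (coreGraph γ).topologicalClosure := by
    rw [← generator_graph, ← hG]
    exact (generator γ).mem_graph ⟨u, hdom⟩
  have h := green_closure hΦ hΨ hΦ2 hΨ2 hcΦ hcΨ hd hp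
  have hE := Lp.memLp u.fst
  have hB := Lp.memLp u.snd
  have e : ∀ (a : L2Field) (X : R3 → C3),
      ∫ x in exteriorDomain, dot (((lam : ℂ) • a : L2Field) x) (X x) =
        ∫ x in exteriorDomain, dot (a x) ((lam : ℂ) • X x) := by
    intro a X
    refine integral_congr_ae ?_
    filter_upwards [Lp.coeFn_smul (lam : ℂ) a] with x hx
    rw [hx, Pi.smul_apply, dot_smul_left, dot_smul_right]
  simp only [WithLp.smul_fst, WithLp.smul_snd, e] at h
  simp only [dot_add_right, dot_sub_right]
  have i1 : Integrable (fun x => dot (u.fst x) ((lam : ℂ) • Φ x)) extMeasure :=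
    integrable_dot hE (hΦ2.const_smul (lam : ℂ))
  have i2 := integrable_dot hE hcΨ
  have i3 : Integrable (fun x => dot (u.snd x) ((lam : ℂ) • Ψ x)) extMeasure :=
    integrable_dot hB (hΨ2.const_smul (lam : ℂ))
  have i4 := integrable_dot hB hcΦ
  have i12 : Integrable (fun x => dot (u.fst x) ((lam : ℂ) • Φ x) + dot (u.fst x) (curl Ψ x))
    extMeasure := i1.add i2
  have i34 : Integrable (fun x => dot (u.snd x) ((lam : ℂ) • Ψ x) - dot (u.snd x) (curl Φ x))
    extMeasure := i3.sub i4
  rw [integral_add i12 i34, integral_add i1 i2, integral_sub i3 i4]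
  linear_combination h

/-- The symmetry `(E, B, γ) ↦ (B, -E, 1/γ)` of the weak problem. -/
lemma IsWeakSolution.swap {γ lam : ℝ} (hγ : γ ≠ 0) {E B : R3 → C3}
    (h : IsWeakSolution γ lam E B) : IsWeakSolution γ⁻¹ lam B (-E) := by
  intro Φ Ψ hΦ hΨ hΦ2 hΨ2 hcΦ hcΨ hd
  have hcn : curl (-Ψ) = -curl Ψ := by
    have := curl_smul hΨ (-1)
    simpa using this
  -- The pair (-Ψ, Φ) is admissible for γ: apply x ∧ to the dual condition for 1/γ and use x ∧ (x ∧
  -- u) = -u_tan on the sphere.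
  have h1 := h (-Ψ) Φ hΨ.neg hΦ hΨ2.neg hΦ2 (by rw [hcn]; exact hcΨ.neg) hcΦ (by
    intro x hx
    have h2 := congrArg (fun a => (γ : ℂ) • wedge (normal x) a) (hd x hx)
    have hγ' : (γ : ℂ) ≠ 0 := by exact_mod_cast hγ
    simp only [wedge_smul, wedge_wedge x hx, wedge_tangential, Complex.ofReal_inv,
      smul_smul, mul_inv_cancel₀ hγ', one_smul] at h2
    rw [Pi.neg_apply, ← neg_one_smul ℂ, wedge_smul, h2]
    simp)
  rw [← h1]
  refine integral_congr_ae (ae_of_all _ fun x => ?_)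
  simp only [hcn, Pi.neg_apply, dot_add_right, dot_sub_right, dot_smul_right, dot_neg_left,
    dot_neg_right]
  ring

end MaxwellExterior

/-! ### Bessel polynomials and the equation for the eigenvalues -/

namespace MaxwellExterior

open Filter Topology

/-- The polynomials `q_k` with `exp (-μ r) q_k (1 / r)` a multiple of the `k`-th decaying modified
spherical Bessel function divided by `r ^ k`. -/
noncomputable def besselPoly (μ : ℝ) : ℕ → Polynomial ℝ
  | 0 => Polynomial.X
  | k + 1 => Polynomial.C μ * Polynomial.X * besselPoly μ k +
      Polynomial.X ^ 3 * Polynomial.derivative (besselPoly μ k)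

lemma besselPoly_succ (μ : ℝ) (k : ℕ) : besselPoly μ (k + 1) =
    Polynomial.C μ * Polynomial.X * besselPoly μ k +
      Polynomial.X ^ 3 * Polynomial.derivative (besselPoly μ k) := rfl

/-- The polynomial form of the modified spherical Bessel equation. It propagates in k: differentiate
the recurrence, insert it in the definition, and recognise the lower members. -/
lemma besselPoly_add_two (μ : ℝ) (k : ℕ) : besselPoly μ (k + 2) =
    (2 * (k : Polynomial ℝ) + 3) * Polynomial.X ^ 2 * besselPoly μ (k + 1) +
      Polynomial.C μ ^ 2 * Polynomial.X ^ 2 * besselPoly μ k := by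
  induction k with
  | zero =>
    simp only [besselPoly, Polynomial.derivative_add, Polynomial.derivative_mul,
      Polynomial.derivative_C, Polynomial.derivative_X, Polynomial.derivative_X_pow,
      Nat.cast_zero, Polynomial.derivative_one]
    simp only [Nat.cast_ofNat, map_ofNat]
    ring
  | succ k ih =>
    have hd := congrArg Polynomial.derivative ih
    have h2 : (2 * k + 3 : Polynomial ℝ) = Polynomial.C (2 * k + 3 : ℝ) := by
      simp [map_ofNat]
    have h3 : Polynomial.C μ ^ 2 = Polynomial.C (μ ^ 2) := by simp
    rw [h2, h3] at hd
    simp only [Polynomial.derivative_add, Polynomial.derivative_mul, Polynomial.derivative_C,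
      Polynomial.derivative_X_pow, Nat.cast_ofNat] at hd
    rw [← h2, ← h3] at hd
    simp only [map_ofNat] at hd
    rw [besselPoly_succ μ (k + 2), hd, ih]
    push_cast
    have e1 := besselPoly_succ μ (k + 1)
    have e0 := besselPoly_succ μ k
    rw [ih] at e1
    linear_combination (-(2 * (k : Polynomial ℝ) + 3) * Polynomial.X ^ 2) * e1 -
      Polynomial.C μ ^ 2 * Polynomial.X ^ 2 * e0

/-- Source of the positivity and monotonicity in t ≥ 0 of these polynomials and of the sign of their
derivatives. -/
lemma besselPoly_coeff_nonneg {μ : ℝ} (hμ : 0 ≤ μ) (k j : ℕ) : 0 ≤ (besselPoly μ k).coeff j := by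
  induction k generalizing j with
  | zero =>
    rw [besselPoly, Polynomial.coeff_X]
    split_ifs <;> norm_num
  | succ k ih =>
    rw [besselPoly_succ, Polynomial.coeff_add, mul_assoc, Polynomial.coeff_C_mul,
      Polynomial.coeff_X_pow_mul', Polynomial.coeff_derivative]
    refine add_nonneg (mul_nonneg hμ ?_) ?_
    · cases j with
      | zero => simp
      | succ j => rw [Polynomial.coeff_X_mul]; exact ih j
    · split_ifs
      · exact mul_nonneg (ih _) (by positivity)
      · exact le_rfl

lemma eval_nonneg_of_coeff {q : Polynomial ℝ} (hq : ∀ j, 0 ≤ q.coeff j) {t : ℝ} (ht : 0 ≤ t) :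
    0 ≤ q.eval t := by
  rw [Polynomial.eval_eq_sum_range]
  exact Finset.sum_nonneg fun j _ => mul_nonneg (hq j) (by positivity)

lemma eval_derivative_nonneg {μ : ℝ} (hμ : 0 ≤ μ) (k : ℕ) {t : ℝ} (ht : 0 ≤ t) :
    0 ≤ (Polynomial.derivative (besselPoly μ k)).eval t := by
  refine eval_nonneg_of_coeff (fun j => ?_) ht
  rw [Polynomial.coeff_derivative]
  exact mul_nonneg (besselPoly_coeff_nonneg hμ k _) (by positivity)

lemma besselPoly_eval_pos {μ : ℝ} (hμ : 0 < μ) (k : ℕ) {t : ℝ} (ht : 0 < t) :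
    0 < (besselPoly μ k).eval t := by
  induction k with
  | zero => simpa [besselPoly] using ht
  | succ k ih =>
    simp only [besselPoly_succ, Polynomial.eval_add, Polynomial.eval_mul, Polynomial.eval_C,
      Polynomial.eval_X, Polynomial.eval_pow]
    have := eval_derivative_nonneg hμ.le k ht.le
    positivity

lemma besselPoly_eval_le {μ : ℝ} (hμ : 0 ≤ μ) (k : ℕ) {t : ℝ} (ht : 0 ≤ t) (ht1 : t ≤ 1) :
    (besselPoly μ k).eval t ≤ (besselPoly μ k).eval 1 := by
  rw [Polynomial.eval_eq_sum_range, Polynomial.eval_eq_sum_range]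
  refine Finset.sum_le_sum fun j _ => mul_le_mul_of_nonneg_left ?_ (besselPoly_coeff_nonneg hμ k j)
  rw [one_pow]
  exact pow_le_one₀ ht ht1

/-- The reverse Bessel polynomials in `μ`. -/
noncomputable def besselValue (k : ℕ) (μ : ℝ) : ℝ := (besselPoly μ k).eval 1

lemma besselValue_zero (μ : ℝ) : besselValue 0 μ = 1 := by simp [besselValue, besselPoly]

lemma besselValue_one (μ : ℝ) : besselValue 1 μ = μ + 1 := by simp [besselValue, besselPoly]

lemma besselValue_add_two (k : ℕ) (μ : ℝ) : besselValue (k + 2) μ =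
    (2 * k + 3) * besselValue (k + 1) μ + μ ^ 2 * besselValue k μ := by
  simp [besselValue, besselPoly_add_two]

lemma besselValue_pos (k : ℕ) {μ : ℝ} (hμ : 0 < μ) : 0 < besselValue k μ :=
  besselPoly_eval_pos hμ k one_pos

lemma besselValue_succ_ge (k : ℕ) {μ : ℝ} (hμ : 0 < μ) :
    μ * besselValue k μ ≤ besselValue (k + 1) μ := by
  simp [besselValue, besselPoly_succ, eval_derivative_nonneg hμ.le k zero_le_one]

lemma continuous_besselValue (k : ℕ) : Continuous (besselValue k) := by
  induction k using Nat.strong_induction_on with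
  | _ k ih =>
    match k, ih with
    | 0, _ =>
      rw [funext besselValue_zero]
      exact continuous_const
    | 1, _ =>
      rw [funext besselValue_one]
      fun_prop
    | k + 2, ih =>
      rw [funext (besselValue_add_two k)]
      have h1 := ih (k + 1) (by omega)
      have h2 := ih k (by omega)
      fun_prop

/-- Minus the logarithmic derivative at `μ` of the `k`-th decaying Riccati–Bessel function. -/
noncomputable def logDecay (k : ℕ) (μ : ℝ) : ℝ :=
  (besselValue (k + 1) μ - (k + 1) * besselValue k μ) / (μ * besselValue k μ)

/-- A Turán-type inequality which, after clearing denominators and using the recurrence, is exactly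
`logDecay k μ < logDecay (k + 1) μ`. The induction goes by steps of two: the expression at k + 2 is
μ⁴ times the one at k plus terms that are nonnegative because Q_(k+2) ≥ μ Q_(k+1), where Q_k is
`besselValue k μ`. -/
lemma turan_pos {μ : ℝ} (hμ : 0 < μ) (k : ℕ) :
    0 < μ ^ 2 * besselValue k μ ^ 2 + (2 * k + 2) * besselValue k μ * besselValue (k + 1) μ -
      besselValue (k + 1) μ ^ 2 := by
  induction k using Nat.strong_induction_on with
  | _ k ih =>
    match k, ih with
    | 0, _ =>
      rw [besselValue_zero, besselValue_one]
      push_cast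
      nlinarith
    | 1, _ =>
      rw [besselValue_add_two 0, besselValue_zero, besselValue_one]
      push_cast
      have : 0 < 2 * μ ^ 2 + 6 * μ + 3 := by positivity
      nlinarith
    | k + 2, ih =>
      have h0 := ih k (by omega)
      have h1 := besselValue_succ_ge (k + 1) hμ
      have h2 := besselValue_pos (k + 1) hμ
      have e1 := besselValue_add_two (k + 1) μ
      have e2 := besselValue_add_two k μ
      have h3 : μ ^ 2 * besselValue (k + 1) μ ^ 2 ≤ besselValue (k + 2) μ ^ 2 := by
        rw [← mul_pow]
        exact pow_le_pow_left₀ (by positivity) h1 2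
      have h4 : 0 < μ ^ 2 * besselValue (k + 1) μ ^ 2 := by positivity
      set A := besselValue k μ
      set B := besselValue (k + 1) μ
      set D := besselValue (k + 2) μ with hD
      rw [e1]
      push_cast
      have key : μ ^ 2 * D ^ 2 + (2 * (k + 2) + 2) * D * ((2 * (k + 1) + 3) * D + μ ^ 2 * B) -
          ((2 * (k + 1) + 3) * D + μ ^ 2 * B) ^ 2 =
          (2 * k + 3) * (D ^ 2 - μ ^ 2 * B ^ 2) + 2 * D ^ 2 + μ ^ 4 *
            (μ ^ 2 * A ^ 2 + (2 * k + 2) * A * B - B ^ 2) := by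
        rw [e2]
        ring
      rw [key]
      have h5 : 0 ≤ (2 * (k : ℝ) + 3) * (D ^ 2 - μ ^ 2 * B ^ 2) :=
        mul_nonneg (by positivity) (by linarith)
      have h6 : 0 < μ ^ 4 * (μ ^ 2 * A ^ 2 + (2 * k + 2) * A * B - B ^ 2) :=
        mul_pos (by positivity) h0
      nlinarith

lemma logDecay_lt_succ {μ : ℝ} (hμ : 0 < μ) (k : ℕ) : logDecay k μ < logDecay (k + 1) μ := by
  have h0 := besselValue_pos k hμ
  have h1 := besselValue_pos (k + 1) hμ
  have hT := turan_pos hμ k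
  rw [logDecay, logDecay, div_lt_div_iff₀ (by positivity) (by positivity), besselValue_add_two]
  push_cast
  set A := besselValue k μ
  set B := besselValue (k + 1) μ
  have : 0 < μ * (μ ^ 2 * A ^ 2 + (2 * k + 2) * A * B - B ^ 2) := mul_pos hμ hT
  nlinarith

lemma logDecay_strictMono {μ : ℝ} (hμ : 0 < μ) : StrictMono fun k => logDecay k μ :=
  strictMono_nat_of_lt_succ (logDecay_lt_succ hμ)

lemma logDecay_zero {μ : ℝ} (hμ : 0 < μ) : logDecay 0 μ = 1 := by
  rw [logDecay, besselValue_zero, besselValue_one]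
  push_cast
  field_simp
  ring

lemma one_le_logDecay {μ : ℝ} (hμ : 0 < μ) (k : ℕ) : 1 ≤ logDecay k μ := by
  rw [← logDecay_zero hμ]
  exact (logDecay_strictMono hμ).monotone (Nat.zero_le k)

lemma continuousOn_logDecay (k : ℕ) : ContinuousOn (logDecay k) (Ioi 0) := by
  have h1 := continuous_besselValue k
  have h2 := continuous_besselValue (k + 1)
  refine ContinuousOn.div (by fun_prop) (by fun_prop) fun μ hμ => ?_
  have := besselValue_pos k (mem_Ioi.1 hμ)
  have h3 : 0 < μ := hμ
  positivity

/-- By the recurrence each ratio is (2k + 3)/μ plus the inverse of the preceding ratio. -/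
lemma tendsto_besselValue_ratio (k : ℕ) :
    Tendsto (fun μ => besselValue (k + 1) μ / (μ * besselValue k μ)) atTop (𝓝 1) := by
  induction k with
  | zero =>
    have h : Tendsto (fun μ : ℝ => 1 + μ⁻¹) atTop (𝓝 (1 + 0)) :=
      tendsto_const_nhds.add tendsto_inv_atTop_zero
    rw [add_zero] at h
    refine h.congr' ?_
    filter_upwards [eventually_gt_atTop 0] with μ hμ
    rw [besselValue_zero, besselValue_one]
    field_simp
  | succ k ih =>
    have h : Tendsto (fun μ : ℝ => (2 * k + 3) * μ⁻¹ +
        (besselValue (k + 1) μ / (μ * besselValue k μ))⁻¹) atTop (𝓝 ((2 * k + 3) * 0 + 1⁻¹)) :=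
      (tendsto_const_nhds.mul tendsto_inv_atTop_zero).add (ih.inv₀ one_ne_zero)
    rw [mul_zero, zero_add, inv_one] at h
    refine h.congr' ?_
    filter_upwards [eventually_gt_atTop 0] with μ hμ
    have h0 := besselValue_pos k hμ
    have h1 := besselValue_pos (k + 1) hμ
    rw [besselValue_add_two]
    field_simp

lemma tendsto_logDecay (k : ℕ) : Tendsto (logDecay k) atTop (𝓝 1) := by
  have h : Tendsto (fun μ => besselValue (k + 1) μ / (μ * besselValue k μ) - (k + 1) * μ⁻¹) atTop
      (𝓝 (1 - (k + 1) * 0)) :=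
    (tendsto_besselValue_ratio k).sub (tendsto_const_nhds.mul tendsto_inv_atTop_zero)
  rw [mul_zero, sub_zero] at h
  refine h.congr' ?_
  filter_upwards [eventually_gt_atTop 0] with μ hμ
  have h0 := besselValue_pos k hμ
  rw [logDecay]
  field_simp

/-- Intermediate value theorem: the limit of `logDecay k` at infinity is 1 < γ. -/
lemma exists_logDecay_eq {γ : ℝ} (hγ : 1 < γ) (k : ℕ) {μ : ℝ} (hμ : 0 < μ)
    (h : γ < logDecay k μ) : ∃ ν, μ < ν ∧ logDecay k ν = γ := by
  obtain ⟨M, hM, hlt⟩ := (((tendsto_logDecay k).eventually (gt_mem_nhds hγ)).and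
    (eventually_gt_atTop μ)).exists
  have hc : ContinuousOn (logDecay k) (Icc μ M) :=
    (continuousOn_logDecay k).mono fun t ht => mem_Ioi.2 (hμ.trans_le ht.1)
  obtain ⟨ν, hν, e⟩ := intermediate_value_Icc' hlt.le hc ⟨hM.le, h.le⟩
  refine ⟨ν, lt_of_le_of_ne hν.1 ?_, e⟩
  rintro rfl
  exact h.ne e.symm

/-- An increasing sequence of solutions of `logDecay n μ = γ`. -/
lemma exists_seq_logDecay_eq {γ : ℝ} (hγ : 1 < γ) : ∃ m : ℕ → ℝ, (∀ n, 0 < m n) ∧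
    (∀ n, m n < m (n + 1)) ∧ ∀ n, 1 ≤ n → logDecay n (m n) = γ := by
  have hγ0 : 0 < γ := by linarith
  -- Here `logDecay 1 μ` equals 1 + 1/(μ(μ + 1)), which at μ = 1/γ is 1 + γ²/(1 + γ) > γ.
  have h0 : γ < logDecay 1 γ⁻¹ := by
    rw [logDecay, besselValue_add_two 0, besselValue_zero, besselValue_one]
    have h1 : 0 < γ⁻¹ := inv_pos.2 hγ0
    rw [lt_div_iff₀ (by positivity)]
    push_cast
    have h2 : γ * γ⁻¹ = 1 := mul_inv_cancel₀ hγ0.ne'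
    nlinarith
  -- A root of degree n + 1 is an admissible left endpoint in degree n + 2, by strict monotonicity
  -- in the degree. The invariant carried along is this inequality.
  have step : ∀ n : ℕ, ∀ μ : {μ : ℝ // 0 < μ ∧ γ < logDecay (n + 1) μ},
      ∃ ν : {ν : ℝ // 0 < ν ∧ γ < logDecay (n + 2) ν}, μ.1 < ν.1 ∧ logDecay (n + 1) ν.1 = γ := by
    rintro n ⟨μ, hμ, h⟩
    obtain ⟨ν, hν, e⟩ := exists_logDecay_eq hγ (n + 1) hμ h
    have hν0 := hμ.trans hν
    exact ⟨⟨ν, hν0, e ▸ logDecay_lt_succ hν0 (n + 1)⟩, hν, e⟩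
  choose f hf1 hf2 using step
  let s : ∀ n : ℕ, {μ : ℝ // 0 < μ ∧ γ < logDecay (n + 1) μ} := fun n =>
    Nat.rec ⟨γ⁻¹, inv_pos.2 hγ0, h0⟩ (fun n μ => f n μ) n
  -- The entry of index 0 is only the starting point 1/γ; the entry of index n ≥ 1 is the root of
  -- degree n.
  refine ⟨fun n => (s n).1, fun n => (s n).2.1, fun n => hf1 n (s n), fun n hn => ?_⟩
  obtain ⟨m, rfl⟩ := Nat.exists_eq_add_of_le' hn
  exact hf2 m (s m)

/-! ### Decaying radial profiles -/

/-- The decaying radial profile as a function of `s = |x|²`: `besselRadial μ k (|x|²) P(x)` solves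
`Δφ = μ² φ` for `P` harmonic of degree `k`. -/
noncomputable def besselRadial (μ : ℝ) (k : ℕ) (s : ℝ) : ℝ :=
  Real.exp (-μ * √s) * (besselPoly μ k).eval (√s)⁻¹

lemma besselRadial_pos {μ : ℝ} (hμ : 0 < μ) (k : ℕ) {s : ℝ} (hs : 0 < s) :
    0 < besselRadial μ k s :=
  mul_pos (Real.exp_pos _) (besselPoly_eval_pos hμ k (inv_pos.2 (Real.sqrt_pos.2 hs)))

lemma besselRadial_one (μ : ℝ) (k : ℕ) :
    besselRadial μ k 1 = Real.exp (-μ) * besselValue k μ := by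
  simp [besselRadial, besselValue]

/-- The recursion defining `besselPoly` is chosen so that differentiation in s raises the index. -/
lemma hasDerivAt_besselRadial (μ : ℝ) (k : ℕ) {s : ℝ} (hs : 0 < s) :
    HasDerivAt (besselRadial μ k) (-(1 / 2) * besselRadial μ (k + 1) s) s := by
  have hr : 0 < √s := Real.sqrt_pos.2 hs
  have h1 := Real.hasDerivAt_sqrt hs.ne'
  have h2 := (h1.const_mul (-μ)).exp
  have h3 := ((besselPoly μ k).hasDerivAt (√s)⁻¹).comp s (h1.inv hr.ne')
  refine (h2.mul h3).congr_deriv ?_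
  simp only [besselRadial, besselPoly_succ, Polynomial.eval_add, Polynomial.eval_mul,
    Polynomial.eval_C, Polynomial.eval_X, Polynomial.eval_pow, Function.comp, Pi.inv_apply]
  field_simp
  ring

/-- In view of `hasDerivAt_besselRadial` this is the radial equation 4s G'' + (4k + 6) G' = μ² G for
G = `besselRadial μ k`. -/
lemma besselRadial_add_two (μ : ℝ) (k : ℕ) {s : ℝ} (hs : 0 < s) :
    s * besselRadial μ (k + 2) s = (2 * k + 3) * besselRadial μ (k + 1) s +
      μ ^ 2 * besselRadial μ k s := by
  have hr : 0 < √s := Real.sqrt_pos.2 hs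
  have h2 : s = √s ^ 2 := (Real.sq_sqrt hs.le).symm
  have h3 : (besselPoly μ (k + 2)).eval (√s)⁻¹ * s = (2 * k + 3) *
      (besselPoly μ (k + 1)).eval (√s)⁻¹ + μ ^ 2 * (besselPoly μ k).eval (√s)⁻¹ := by
    rw [besselPoly_add_two]
    simp only [Polynomial.eval_add, Polynomial.eval_mul, Polynomial.eval_C, Polynomial.eval_X,
      Polynomial.eval_pow, Polynomial.eval_ofNat, Polynomial.eval_natCast]
    have h4 : (√s)⁻¹ ^ 2 * s = 1 := by
      conv_lhs => rw [h2, Real.sqrt_sq hr.le]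
      field_simp
    linear_combination ((2 * k + 3) * (besselPoly μ (k + 1)).eval (√s)⁻¹ +
      μ ^ 2 * (besselPoly μ k).eval (√s)⁻¹) * h4
  simp only [besselRadial]
  linear_combination Real.exp (-μ * √s) * h3

lemma contDiffOn_besselRadial (μ : ℝ) (k : ℕ) : ContDiffOn ℝ ∞ (besselRadial μ k) (Ioi 0) := by
  intro s hs
  have hr : 0 < √s := Real.sqrt_pos.2 hs
  have h1 : ContDiffAt ℝ ∞ (fun s => √s) s := Real.contDiffAt_sqrt (ne_of_gt hs)
  have h2 : ContDiffAt ℝ ∞ (fun s => Real.exp (-μ * √s)) s := (contDiffAt_const.mul h1).exp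
  have h3 : ContDiffAt ℝ ∞ (fun s => (besselPoly μ k).eval (√s)⁻¹) s :=
    (show ContDiff ℝ ∞ fun t => (besselPoly μ k).eval t by
      simpa using (besselPoly μ k).contDiff_aeval (𝕜 := ℝ) ∞).contDiffAt.comp s (h1.inv hr.ne')
  exact (h2.mul h3).contDiffWithinAt

lemma rapidDecay_besselRadial {μ : ℝ} (hμ : 0 < μ) (k : ℕ) : RapidDecay (besselRadial μ k) := by
  intro N
  refine ⟨((2 * N).factorial / μ ^ (2 * N)) * (besselPoly μ k).eval 1, fun s hs => ?_⟩
  have hs0 : 0 < s := by linarith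
  have hr : 1 ≤ √s := Real.one_le_sqrt.2 hs
  rw [abs_of_pos (besselRadial_pos hμ k hs0), besselRadial]
  have h1 : Real.exp (-μ * √s) * s ^ N ≤ (2 * N).factorial / μ ^ (2 * N) := by
    have h2 := Real.pow_div_factorial_le_exp (x := μ * √s) (by positivity) (2 * N)
    have h3 : (μ * √s) ^ (2 * N) = μ ^ (2 * N) * s ^ N := by
      rw [mul_pow, pow_mul (√s), Real.sq_sqrt hs0.le]
    rw [h3, div_le_iff₀ (by positivity)] at h2
    rw [neg_mul, Real.exp_neg, le_div_iff₀ (by positivity), inv_mul_eq_div, div_mul_eq_mul_div,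
      div_le_iff₀ (Real.exp_pos _)]
    linarith
  have h4 : (besselPoly μ k).eval (√s)⁻¹ ≤ (besselPoly μ k).eval 1 :=
    besselPoly_eval_le hμ.le k (by positivity) (inv_le_one_of_one_le₀ hr)
  have h5 : 0 < (besselPoly μ k).eval (√s)⁻¹ :=
    besselPoly_eval_pos hμ k (inv_pos.2 (by positivity))
  calc Real.exp (-μ * √s) * (besselPoly μ k).eval (√s)⁻¹ * s ^ N
      = (Real.exp (-μ * √s) * s ^ N) * (besselPoly μ k).eval (√s)⁻¹ := by ring
    _ ≤ _ := mul_le_mul h1 h4 h5.le (by positivity)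

/-- Profiles may be singular at s = 0, but only s ≥ 1 matters. Agreement already from 1/2 on makes
all derivatives agree at s = 1 too. -/
lemma exists_contDiff_eq {f : ℝ → ℝ} (hf : ContDiffOn ℝ ∞ f (Ioi 0)) :
    ∃ g : ℝ → ℝ, ContDiff ℝ ∞ g ∧ ∀ s, 1 / 2 < s → g s = f s := by
  refine ⟨fun s => Real.smoothTransition (4 * s - 1) * f s, ?_, fun s hs => ?_⟩
  · rw [contDiff_iff_contDiffAt]
    intro s
    rcases lt_or_ge 0 s with hs | hs
    · have h1 : ContDiff ℝ ∞ fun s : ℝ => Real.smoothTransition (4 * s - 1) :=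
        Real.smoothTransition.contDiff.comp ((contDiff_const.mul contDiff_id).sub contDiff_const)
      exact h1.contDiffAt.mul (hf.contDiffAt (Ioi_mem_nhds hs))
    · have : (fun s => Real.smoothTransition (4 * s - 1) * f s) =ᶠ[𝓝 s] fun _ => 0 := by
        filter_upwards [Iio_mem_nhds (show s < 1 / 4 by linarith)] with t ht
        have ht' : t < 1 / 4 := ht
        rw [Real.smoothTransition.zero_of_nonpos (by linarith), zero_mul]
      exact contDiffAt_const.congr_of_eventuallyEq this
  · simp only
    rw [Real.smoothTransition.one_of_one_le (by linarith), one_mul]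

lemma contDiff_integral {e : ℝ → ℝ} (he : ContDiff ℝ ∞ e) (a : ℝ) :
    ContDiff ℝ ∞ (fun s => ∫ t in a..s, e t) := by
  have h : ∀ s, HasDerivAt (fun s => ∫ t in a..s, e t) (e s) s := fun s =>
    intervalIntegral.integral_hasDerivAt_right (he.continuous.intervalIntegrable _ _)
      (he.continuous.stronglyMeasurableAtFilter _ _) he.continuous.continuousAt
  rw [contDiff_infty_iff_deriv]
  refine ⟨fun s => (h s).differentiableAt, ?_⟩
  rwa [funext fun s => (h s).deriv]

end MaxwellExterior

/-! ### The radial Robin problem and orthogonality of radial components -/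

namespace MaxwellExterior

open Filter Topology

lemma exists_bound_of_eventually_const {f : ℝ → ℝ} (hf : Continuous f) {b : ℝ} (hb : 1 ≤ b)
    (hc : ∀ s, b ≤ s → f s = f b) : ∃ K, ∀ s, 1 ≤ s → |f s| ≤ K := by
  obtain ⟨K, hK⟩ := (isCompact_Icc (a := (1 : ℝ)) (b := b)).exists_bound_of_continuousOn
    hf.continuousOn
  refine ⟨K, fun s hs => ?_⟩
  rcases le_total s b with h | h
  · exact hK s ⟨hs, h⟩
  · rw [hc s h]
    exact hK b ⟨hb, le_rfl⟩

lemma RapidDecay.of_eventually_zero {f : ℝ → ℝ} (hf : Continuous f) {b : ℝ} (hb : 1 ≤ b)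
    (hc : ∀ s, b ≤ s → f s = 0) : RapidDecay f := fun N => by
  obtain ⟨K, hK⟩ := exists_bound_of_eventually_const (f := fun s => f s * s ^ N) (by fun_prop) hb
    (fun s hs => by rw [hc s hs, hc b le_rfl, zero_mul, zero_mul])
  refine ⟨K, fun s hs => ?_⟩
  have := hK s hs
  rwa [abs_mul, abs_of_nonneg (a := s ^ N) (by positivity)] at this

/-- Solvability of the exterior radial Robin problem `L c = h`: either the homogeneous problem has
no decaying solution, or `h` is orthogonal to it. -/
lemma exists_robin_profile {μ : ℝ} (hμ : 0 < μ) (k : ℕ) (β : ℝ) {h : ℝ → ℝ}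
    (hh : ContDiff ℝ ∞ h) {b : ℝ} (hb : 1 ≤ b) (h1 : ∀ s, b ≤ s → h s = 0)
    (hβ : (k + 1 - β) * besselValue k μ ≠ besselValue (k + 1) μ ∨
      ∫ t in (1 : ℝ)..b, h t * besselRadial μ k t * t ^ k * √t = 0) :
    ∃ c : ℝ → ℝ, ContDiff ℝ ∞ c ∧ RapidDecay c ∧ RapidDecay (deriv c) ∧
      (∀ s, 1 ≤ s →
        4 * s * deriv (deriv c) s + (4 * k + 6) * deriv c s - μ ^ 2 * c s = h s) ∧
      (k + 1) * c 1 + 2 * deriv c 1 = β * c 1 := by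
  set G := besselRadial μ k with hG
  set G1 := besselRadial μ (k + 1) with hG1
  have hGpos : ∀ {s : ℝ}, 0 < s → 0 < G s := fun hs => besselRadial_pos hμ k hs
  have hsqrt : ContDiffOn ℝ ∞ (fun s : ℝ => √s) (Ioi 0) := fun s hs =>
    (Real.contDiffAt_sqrt (ne_of_gt hs)).contDiffWithinAt
  have hGc : ContDiffOn ℝ ∞ G (Ioi 0) := contDiffOn_besselRadial μ k
  -- Reduction of order: with c = G y and e = y' the equation becomes (G² s^(k+1) √s e)' = h G s^k
  -- √s / 4. The primitive z vanishes beyond b, so e does too, y is constant there, and c decays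
  -- like G.
  obtain ⟨H, hHc, hH⟩ := exists_contDiff_eq (f := fun t => h t * G t * t ^ k * √t / 4)
    ((((hh.contDiffOn.mul hGc).mul (contDiff_id.pow k).contDiffOn).mul hsqrt).div_const 4)
  set z : ℝ → ℝ := fun s => ∫ t in b..s, H t with hz
  have hzc : ContDiff ℝ ∞ z := contDiff_integral hHc b
  have hzd : ∀ s, HasDerivAt z (H s) s := fun s =>
    intervalIntegral.integral_hasDerivAt_right (hHc.continuous.intervalIntegrable _ _)
      (hHc.continuous.stronglyMeasurableAtFilter _ _) hHc.continuous.continuousAt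
  have hzb : ∀ s, b ≤ s → z s = 0 := by
    intro s hs
    refine (intervalIntegral.integral_congr fun t ht => ?_).trans
      intervalIntegral.integral_zero
    rw [uIcc_of_le hs] at ht
    have : (1 / 2 : ℝ) < t := by linarith [ht.1]
    rw [hH t this]
    simp [h1 t ht.1]
  have hw0 : ∀ s : ℝ, 0 < s → G s ^ 2 * s ^ (k + 1) * √s ≠ 0 := fun s hs => by
    have := hGpos hs
    have := Real.sqrt_pos.2 hs
    positivity
  obtain ⟨e, hec, he⟩ := exists_contDiff_eq (f := fun s => z s / (G s ^ 2 * s ^ (k + 1) * √s))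
    (hzc.contDiffOn.div (((hGc.pow 2).mul (contDiff_id.pow (k + 1)).contDiffOn).mul hsqrt)
      fun s hs => hw0 s hs)
  have heb : ∀ s, b ≤ s → e s = 0 := fun s hs => by
    rw [he s (by linarith), hzb s hs, zero_div]
  -- The free constant y(1), fitted to the Robin condition at s = 1.
  set y0 : ℝ := -2 * besselValue k μ * e 1 /
    ((k + 1 - β) * besselValue k μ - besselValue (k + 1) μ) with hy0
  set y : ℝ → ℝ := fun s => y0 + ∫ t in (1 : ℝ)..s, e t with hy
  have hyc : ContDiff ℝ ∞ y := contDiff_const.add (contDiff_integral hec 1)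
  have hyd : ∀ s, HasDerivAt y (e s) s := fun s =>
    (intervalIntegral.integral_hasDerivAt_right (hec.continuous.intervalIntegrable _ _)
      (hec.continuous.stronglyMeasurableAtFilter _ _) hec.continuous.continuousAt).const_add y0
  have hyb : ∀ s, b ≤ s → y s = y b := by
    intro s hs
    have h2 : ∫ t in b..s, e t = 0 := by
      refine (intervalIntegral.integral_congr fun t ht => ?_).trans
        intervalIntegral.integral_zero
      rw [uIcc_of_le hs] at ht
      exact heb t ht.1
    have h3 := intervalIntegral.integral_add_adjacent_intervals
      (hec.continuous.intervalIntegrable (μ := volume) 1 b)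
      (hec.continuous.intervalIntegrable b s)
    simp only [hy]
    rw [← h3, h2, add_zero]
  obtain ⟨c, hcc, hc⟩ := exists_contDiff_eq (hGc.mul hyc.contDiffOn)
  have hGd : ∀ {s : ℝ}, 0 < s → HasDerivAt G (-(1 / 2) * G1 s) s := fun hs =>
    hasDerivAt_besselRadial μ k hs
  have hG1d : ∀ {s : ℝ}, 0 < s → HasDerivAt G1 (-(1 / 2) * besselRadial μ (k + 2) s) s := fun hs =>
    hasDerivAt_besselRadial μ (k + 1) hs
  have hcd : ∀ s, 1 / 2 < s → deriv c s = -(1 / 2) * G1 s * y s + G s * e s := by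
    intro s hs
    have h2 : c =ᶠ[𝓝 s] G * y := by
      filter_upwards [Ioi_mem_nhds hs] with t ht
      exact hc t ht
    rw [h2.deriv_eq]
    exact ((hGd (by linarith)).mul (hyd s)).deriv
  refine ⟨c, hcc, ?_, ?_, ?_, ?_⟩
  · obtain ⟨K, hK⟩ := exists_bound_of_eventually_const hyc.continuous hb hyb
    refine ((rapidDecay_besselRadial hμ k).mul_of_le (h := y) K 0 fun s hs => ?_).congr
      fun s hs => ?_
    · simpa using hK s hs
    · rw [hc s (by linarith), mul_comm]
  · obtain ⟨K, hK⟩ := exists_bound_of_eventually_const hyc.continuous hb hyb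
    have d1 := ((rapidDecay_besselRadial hμ (k + 1)).mul_of_le (h := y) K 0 fun s hs => by
      simpa using hK s hs).const_mul (-(1 / 2))
    obtain ⟨K', hK'⟩ := exists_bound_of_eventually_const hec.continuous hb
      fun s hs => by rw [heb s hs, heb b le_rfl]
    have d2 := (rapidDecay_besselRadial hμ k).mul_of_le (h := e) K' 0 fun s hs => by
      simpa using hK' s hs
    refine (d1.add d2).congr fun s hs => ?_
    rw [hcd s (by linarith)]
    ring
  · intro s hs
    have hs0 : 0 < s := by linarith
    have hs2 : 1 / 2 < s := by linarith
    have hr : 0 < √s := Real.sqrt_pos.2 hs0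
    have hrs : √s ^ 2 = s := Real.sq_sqrt hs0.le
    have hwd : HasDerivAt (fun s => G s ^ 2 * s ^ (k + 1) * √s)
        ((2 * G s * (-(1 / 2) * G1 s) * s ^ (k + 1) + G s ^ 2 * ((k + 1) * s ^ k)) * √s +
          G s ^ 2 * s ^ (k + 1) * (1 / (2 * √s))) s := by
      have p1 := (hGd hs0).pow 2
      have p2 := (hasDerivAt_id s).pow (k + 1)
      refine ((p1.mul p2).mul (Real.hasDerivAt_sqrt hs0.ne')).congr_deriv ?_
      simp
    have hed : deriv e s = H s / (G s ^ 2 * s ^ (k + 1) * √s) +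
        e s * (G1 s / G s - (k + 3 / 2) / s) := by
      have h2 : e =ᶠ[𝓝 s] fun s => z s / (G s ^ 2 * s ^ (k + 1) * √s) := by
        filter_upwards [Ioi_mem_nhds hs2] with t ht
        exact he t ht
      rw [h2.deriv_eq, he s hs2]
      refine (((hzd s).div hwd (hw0 s hs0)).deriv).trans ?_
      have := hGpos hs0
      field_simp
      rw [hrs]
      ring
    have hedd : HasDerivAt e (deriv e s) s := (hec.differentiable (by simp) s).hasDerivAt
    have hcdd : deriv (deriv c) s = -(1 / 2) * (-(1 / 2) * besselRadial μ (k + 2) s) * y s +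
        -(1 / 2) * G1 s * e s + (-(1 / 2) * G1 s * e s + G s * deriv e s) := by
      have h2 : deriv c =ᶠ[𝓝 s] fun s => -(1 / 2) * G1 s * y s + G s * e s := by
        filter_upwards [Ioi_mem_nhds hs2] with t ht
        exact hcd t ht
      rw [h2.deriv_eq]
      exact ((((hG1d hs0).const_mul (-(1 / 2))).mul (hyd s)).add ((hGd hs0).mul hedd)).deriv
    have hrec := besselRadial_add_two μ k hs0
    have hHs : 4 * s * G s * (H s / (G s ^ 2 * s ^ (k + 1) * √s)) = h s := by
      rw [hH s hs2]
      have := hGpos hs0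
      field_simp
      ring
    have hGs : s * G s * (G1 s / G s - (k + 3 / 2) / s) = s * G1 s - (k + 3 / 2) * G s := by
      have := hGpos hs0
      field_simp
    rw [hcdd, hcd s hs2, hc s hs2, hed]
    linear_combination hHs + y s * hrec + 4 * e s * hGs
  · rw [hcd 1 (by norm_num), hc 1 (by norm_num)]
    have y1 : y 1 = y0 := by simp [hy]
    rw [y1, hG, hG1, besselRadial_one, besselRadial_one]
    set D := (k + 1 - β) * besselValue k μ - besselValue (k + 1) μ with hD
    have key : D * y0 + 2 * besselValue k μ * e 1 = 0 := by
      rcases hβ with hβ | hβ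
      · have : D ≠ 0 := sub_ne_zero.2 hβ
        rw [hy0]
        field_simp
        ring
      -- Orthogonality gives z(1) = 0, hence e(1) = 0 and y0 = 0, whatever the denominator; the
      -- Robin condition then holds with both sides zero.
      · have he1 : e 1 = 0 := by
          have h2 : ∫ t in (1 : ℝ)..b, H t = 0 := by
            have h3 : ∫ t in (1 : ℝ)..b, H t = ∫ t in (1 : ℝ)..b, h t * G t * t ^ k * √t / 4 :=
              intervalIntegral.integral_congr fun t ht => by
                rw [uIcc_of_le hb] at ht
                exact hH t (by linarith [ht.1])
            rw [h3, intervalIntegral.integral_div, hβ, zero_div]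
          rw [he 1 (by norm_num), hz]
          simp only
          rw [intervalIntegral.integral_symm, h2, neg_zero, zero_div]
        rw [hy0, he1]
        simp
    rw [hD] at key
    linear_combination Real.exp (-μ) * key

lemma hasDerivAt_of_contDiff {g : ℝ → ℝ} (hg : ContDiff ℝ ∞ g) (s : ℝ) :
    HasDerivAt g (deriv g s) s := (hg.differentiable (by simp) s).hasDerivAt

lemma contDiff_deriv {g : ℝ → ℝ} (hg : ContDiff ℝ ∞ g) : ContDiff ℝ ∞ (deriv g) :=
  (contDiff_infty_iff_deriv.1 hg).2

lemma curl_add_apply {v w : R3 → C3} (hv : ContDiff ℝ ∞ v) (hw : ContDiff ℝ ∞ w) (x : R3) :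
    curl (fun y => v y + w y) x = curl v x + curl w x :=
  congrFun (curl_add hv hw) x

lemma polyField_posField (p : Poly3) (x : R3) :
    polyField (posField p) x = polyFun p x • normal x := by
  ext i
  simp [polyField_apply, posField, polyFun_mul, polyFun_X, normal_apply, mul_comm]

lemma dot_comm (a b : C3) : dot a b = dot b a :=
  Finset.sum_congr rfl fun _ _ => mul_comm _ _

/-- The radial component of a weak solution is orthogonal to `h(|x|²) P(x)`, unless `P` has the
degree for which the Robin problem is resonant. -/
lemma IsWeakSolution.integral_radial_eq_zero {γ μ : ℝ} (hμ : 0 < μ) {E B : R3 → C3}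
    (hw : IsWeakSolution γ (-μ) E B) {n : ℕ} {p : Poly3} (hp : p ∈ harmonics n) {h : ℝ → ℝ}
    (hh : ContDiff ℝ ∞ h) {b : ℝ} (hb : 1 ≤ b) (h1 : ∀ s, b ≤ s → h s = 0)
    (hβ : logDecay n μ ≠ γ ∨
      ∫ t in (1 : ℝ)..b, h t * besselRadial μ n t * t ^ n * √t = 0) :
    ∫ x in exteriorDomain,
      (h (‖x‖ ^ 2) : ℂ) * (dot (normal x) (E x) * polyFun p x) = 0 := by
  have hQ := besselValue_pos n hμ
  -- For β = -μγ, equality here is the resonance `logDecay n μ = γ`.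
  have hβ' : (n + 1 - (-μ * γ)) * besselValue n μ ≠ besselValue (n + 1) μ ∨
      ∫ t in (1 : ℝ)..b, h t * besselRadial μ n t * t ^ n * √t = 0 := by
    refine hβ.imp_left fun hne heq => hne ?_
    rw [logDecay, ← heq]
    field_simp
    ring
  obtain ⟨c, hc, hd0, hd1, hode, hrob⟩ := exists_robin_profile hμ n (-μ * γ) hh hb h1 hβ'
  have hc1 := contDiff_deriv hc
  have hc2 := contDiff_deriv hc1
  -- The test fields are Ψ = c x ∧ ∇P and Φ = aa P x + bb ∇P. The choice of bb removes the gradient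
  -- part of -μΦ + curl Ψ, that of aa gives curl Φ = -μΨ. What remains is the radial field with
  -- profile -μ aa + 2n c', equal to h by the equation for c.
  let bb : ℝ → ℝ := fun s => -((n + 1) * c s + 2 * s * deriv c s) / μ
  let bb' : ℝ → ℝ := fun s => -((n + 3) * deriv c s + 2 * s * deriv (deriv c) s) / μ
  let aa : ℝ → ℝ := fun s => 2 * bb' s + μ * c s
  have hid : ContDiff ℝ ∞ (fun s : ℝ => s) := contDiff_id
  have hbbc : ContDiff ℝ ∞ bb :=
    (((contDiff_const.mul hc).add ((contDiff_const.mul hid).mul hc1)).neg).div_const μ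
  have hbb'c : ContDiff ℝ ∞ bb' :=
    (((contDiff_const.mul hc1).add ((contDiff_const.mul hid).mul hc2)).neg).div_const μ
  have haac : ContDiff ℝ ∞ aa := (contDiff_const.mul hbb'c).add (contDiff_const.mul hc)
  have hbbd : ∀ s, HasDerivAt bb (bb' s) s := by
    intro s
    have p1 := (hasDerivAt_of_contDiff hc s).const_mul ((n : ℝ) + 1)
    have p2 := ((hasDerivAt_id s).const_mul 2).mul (hasDerivAt_of_contDiff hc1 s)
    refine ((p1.add p2).neg.div_const μ).congr_deriv ?_
    simp only [bb', id]
    ring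
  have hL : ∀ s, -μ * aa s + 2 * n * deriv c s =
      4 * s * deriv (deriv c) s + (4 * n + 6) * deriv c s - μ ^ 2 * c s := by
    intro s
    simp only [aa, bb']
    field_simp
    ring
  have hdh : RapidDecay h := RapidDecay.of_eventually_zero hh.continuous hb h1
  have hbbdec : RapidDecay bb := by
    refine ((hd0.const_mul (-(n + 1) / μ)).add
      ((hd1.mul_of_le (h := fun s => s) 1 1 fun s hs => by
        rw [abs_of_nonneg (by linarith)]; simp).const_mul (-2 / μ))).congr fun s _ => ?_
    simp only [bb]
    ring
  have haadec : RapidDecay aa := by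
    refine ((hdh.const_mul (-1 / μ)).add (hd1.const_mul (2 * n / μ))).congr fun s hs => ?_
    have h2 := hL s
    rw [hode s hs] at h2
    field_simp
    linarith
  let Ψ : R3 → C3 := radialField c (rotField p)
  let Φ : R3 → C3 := fun x => radialField aa (posField p) x + radialField bb (gradField p) x
  have hΨc : ContDiff ℝ ∞ Ψ := contDiff_radialField hc _
  have hΦ1 := contDiff_radialField haac (posField p)
  have hΦ2 := contDiff_radialField hbbc (gradField p)
  have hcΦ : curl Φ = fun x => ((-μ : ℝ) : ℂ) • Ψ x := by
    funext x
    rw [curl_add_apply hΦ1 hΦ2, curl_posField (hasDerivAt_of_contDiff haac _),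
      curl_gradField (hbbd _)]
    simp only [Ψ, radialField, aa]
    rw [← neg_smul, ← add_smul, smul_smul]
    congr 1
    push_cast
    ring
  have hcΨ : curl Ψ = fun x => radialField (fun s => 2 * n * deriv c s) (posField p) x -
      radialField (fun s => -μ * bb s) (gradField p) x := by
    funext x
    rw [curl_rotField (hasDerivAt_of_contDiff hc _) hp]
    simp only [radialField, bb]
    congr 4
    field_simp
  -- On the sphere the dual boundary condition reads γ c(1) = bb(1), which is the Robin condition.
  have hmul : -μ * γ * c 1 = -μ * bb 1 := by
    rw [← hrob]
    simp only [bb]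
    field_simp
  have hbc : γ * c 1 = bb 1 := by
    have : -μ ≠ 0 := by linarith
    exact mul_left_cancel₀ this (by linarith)
  have hΨm : MemLp Ψ 2 extMeasure := memLp_radialField hc.continuous hd0 _
  have := hw Φ Ψ (hΦ1.add hΦ2) hΨc
    ((memLp_radialField haac.continuous haadec _).add
      (memLp_radialField hbbc.continuous hbbdec _)) hΨm
    (by rw [hcΦ]; exact hΨm.const_smul ((-μ : ℝ) : ℂ))
    (by
      rw [hcΨ]
      exact (memLp_radialField (by fun_prop) (hd1.const_mul _) _).sub
        (memLp_radialField (by fun_prop) (hbbdec.const_mul _) _))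
    (by
      intro x hx
      have hx2 : ‖x‖ ^ 2 = 1 := by rw [hx, one_pow]
      simp only [Φ, Ψ, radialField, hx2, wedge_add, wedge_smul, tangential_smul, wedge_polyField,
        polyWedge_posField]
      have e0 : polyField 0 x = 0 := by
        ext i
        exact polyFun_zero x
      have e1 : tangential x (polyField (rotField p) x) = polyField (rotField p) x := by
        rw [rotField, ← wedge_polyField, tangential_wedge]
      rw [e0, e1, smul_zero, zero_add, smul_smul, ← Complex.ofReal_mul, hbc]
      rfl)
  rw [← this]
  rw [setIntegral_congr_fun isOpen_exteriorDomain.measurableSet]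
  intro x (hx : 1 < ‖x‖)
  have hs : 1 ≤ ‖x‖ ^ 2 := one_le_pow₀ hx.le
  have e1 : ((-μ : ℝ) : ℂ) • Ψ x - curl Φ x = 0 := by
    rw [hcΦ, sub_self]
  have e2 : ((-μ : ℝ) : ℂ) • Φ x + curl Ψ x =
      (h (‖x‖ ^ 2) : ℂ) • polyField (posField p) x := by
    rw [hcΨ, ← hode _ hs, ← hL]
    simp only [Φ, radialField]
    push_cast
    module
  simp only [e1, e2, dot_zero_right, add_zero, dot_smul_right, polyField_posField]
  rw [dot_comm (E x)]
  ring

end MaxwellExterior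

/-! ### Totality of radial functions times harmonic polynomials -/

namespace MaxwellExterior

open Filter Topology

/-- Smooth functions of `s = |x|²` supported in a compact subset of `(1, ∞)`. -/
structure IsRadialTest (h : ℝ → ℝ) : Prop where
  contDiff : ContDiff ℝ ∞ h
  exists_bounds : ∃ a b : ℝ, 1 < a ∧ a ≤ b ∧ (∀ s, s ≤ a → h s = 0) ∧ ∀ s, b ≤ s → h s = 0

lemma IsRadialTest.id_mul {h : ℝ → ℝ} (hh : IsRadialTest h) : IsRadialTest (fun s => s * h s) where
  contDiff := contDiff_id.mul hh.contDiff
  exists_bounds := by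
    obtain ⟨a, b, ha, hab, h0, h1⟩ := hh.exists_bounds
    exact ⟨a, b, ha, hab, fun s hs => by rw [h0 s hs, mul_zero],
      fun s hs => by rw [h1 s hs, mul_zero]⟩

lemma IsRadialTest.const_mul {h : ℝ → ℝ} (hh : IsRadialTest h) (c : ℝ) :
    IsRadialTest (fun s => c * h s) where
  contDiff := contDiff_const.mul hh.contDiff
  exists_bounds := by
    obtain ⟨a, b, ha, hab, h0, h1⟩ := hh.exists_bounds
    exact ⟨a, b, ha, hab, fun s hs => by rw [h0 s hs, mul_zero],
      fun s hs => by rw [h1 s hs, mul_zero]⟩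

lemma IsRadialTest.sub {h g : ℝ → ℝ} (hh : IsRadialTest h) (hg : IsRadialTest g) :
    IsRadialTest (fun s => h s - g s) where
  contDiff := hh.contDiff.sub hg.contDiff
  exists_bounds := by
    obtain ⟨a, b, ha, hab, h0, h1⟩ := hh.exists_bounds
    obtain ⟨a', b', ha', hab', h0', h1'⟩ := hg.exists_bounds
    refine ⟨min a a', max b b', lt_min ha ha', (min_le_left _ _).trans (hab.trans (le_max_left _ _)),
      fun s hs => ?_, fun s hs => ?_⟩
    · rw [h0 s (hs.trans (min_le_left _ _)), h0' s (hs.trans (min_le_right _ _)), sub_zero]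
    · rw [h1 s ((le_max_left _ _).trans hs), h1' s ((le_max_right _ _).trans hs), sub_zero]

lemma IsRadialTest.deriv {h : ℝ → ℝ} (hh : IsRadialTest h) : IsRadialTest (deriv h) where
  contDiff := contDiff_deriv hh.contDiff
  exists_bounds := by
    obtain ⟨a, b, ha, hab, h0, h1⟩ := hh.exists_bounds
    refine ⟨(1 + a) / 2, b + 1, by linarith, by linarith, fun s hs => ?_, fun s hs => ?_⟩
    · have : h =ᶠ[𝓝 s] fun _ => 0 := by
        filter_upwards [Iio_mem_nhds (show s < a by linarith)] with t ht
        exact h0 t (le_of_lt ht)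
      rw [this.deriv_eq, deriv_const]
    · have : h =ᶠ[𝓝 s] fun _ => 0 := by
        filter_upwards [Ioi_mem_nhds (show b < s by linarith)] with t ht
        exact h1 t (le_of_lt ht)
      rw [this.deriv_eq, deriv_const]

lemma IsRadialTest.rapidDecay {h : ℝ → ℝ} (hh : IsRadialTest h) : RapidDecay h := by
  obtain ⟨a, b, ha, hab, h0, h1⟩ := hh.exists_bounds
  exact RapidDecay.of_eventually_zero hh.contDiff.continuous (by linarith) h1

lemma IsRadialTest.apply_one {h : ℝ → ℝ} (hh : IsRadialTest h) : h 1 = 0 := by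
  obtain ⟨a, b, ha, hab, h0, h1⟩ := hh.exists_bounds
  exact h0 1 ha.le

lemma IsRadialTest.hasCompactSupport {h : ℝ → ℝ} (hh : IsRadialTest h) :
    HasCompactSupport (fun x : R3 => ((h (‖x‖ ^ 2) : ℝ) : ℂ)) := by
  obtain ⟨a, b, ha, hab, h0, h1⟩ := hh.exists_bounds
  refine HasCompactSupport.intro (isCompact_closedBall (0 : R3) b) fun x hx => ?_
  have hx' : b < ‖x‖ := by simpa using hx
  rw [h1 _ (by nlinarith), Complex.ofReal_zero]

lemma exists_radialTest_eq_one {a b : ℝ} (ha : 1 < a) :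
    ∃ h : ℝ → ℝ, IsRadialTest h ∧ (∀ s, 0 ≤ h s) ∧ ∀ s, a ≤ s → s ≤ b → h s = 1 := by
  have hpos : 0 < (a - 1) / 2 := by linarith
  refine ⟨fun s => Real.smoothTransition ((s - (1 + a) / 2) / ((a - 1) / 2)) *
    Real.smoothTransition (max a b + 1 - s), ⟨?_, (1 + a) / 2, max a b + 1, ?_, ?_, ?_, ?_⟩, ?_, ?_⟩
  · exact (Real.smoothTransition.contDiff.comp
      ((contDiff_id.sub contDiff_const).div_const _)).mul
      (Real.smoothTransition.contDiff.comp (contDiff_const.sub contDiff_id))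
  · linarith
  · have := le_max_left a b
    linarith
  · intro s hs
    rw [Real.smoothTransition.zero_of_nonpos (div_nonpos_of_nonpos_of_nonneg (by linarith) hpos.le),
      zero_mul]
  · intro s hs
    rw [Real.smoothTransition.zero_of_nonpos (x := max a b + 1 - s) (by linarith), mul_zero]
  · exact fun s => mul_nonneg (Real.smoothTransition.nonneg _) (Real.smoothTransition.nonneg _)
  · intro s hs hs'
    have := le_max_right a b
    simp only
    rw [Real.smoothTransition.one_of_one_le (by rw [one_le_div hpos]; linarith),
      Real.smoothTransition.one_of_one_le (by linarith), one_mul]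

/-- Weierstrass approximation by polynomials on balls of `ℝ³`. -/
lemma exists_polyFun_near {g : R3 → ℝ} (hg : Continuous g) (R : ℝ) {ε : ℝ} (hε : 0 < ε) :
    ∃ p : Poly3, ∀ x : R3, ‖x‖ ≤ R → ‖(g x : ℂ) - polyFun p x‖ ≤ ε := by
  let coord : Fin 3 → C(R3, ℝ) := fun i => ⟨fun x => x i, by fun_prop⟩
  let φ : MvPolynomial (Fin 3) ℝ →ₐ[ℝ] C(R3, ℝ) := MvPolynomial.aeval coord
  have hsep : φ.range.SeparatesPoints := by
    intro x y hxy
    have : ∃ i, x i ≠ y i := by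
      by_contra! hne
      exact hxy (PiLp.ext hne)
    obtain ⟨i, hi⟩ := this
    refine ⟨fun z => z i, ⟨coord i, ⟨MvPolynomial.X i, ?_⟩, rfl⟩, hi⟩
    exact MvPolynomial.aeval_X coord i
  obtain ⟨f, ⟨q, rfl⟩, hf⟩ :=
    ContinuousMap.exists_mem_subalgebra_near_continuous_of_isCompact_of_separatesPoints hsep
      ⟨g, hg⟩ (isCompact_closedBall (0 : R3) R) hε
  refine ⟨MvPolynomial.map Complex.ofRealHom q, fun x hx => ?_⟩
  have h1 : polyFun (MvPolynomial.map Complex.ofRealHom q) x = ((φ q x : ℝ) : ℂ) := by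
    clear hf
    induction q using MvPolynomial.induction_on with
    | C a => simp [polyFun, φ, MvPolynomial.algHom_C]
    | add p q hp hq =>
      rw [map_add, polyFun_add, hp, hq, map_add, ContinuousMap.add_apply, Complex.ofReal_add]
    | mul_X p i hp =>
      rw [map_mul, polyFun_mul, hp, map_mul, ContinuousMap.mul_apply, Complex.ofReal_mul,
        MvPolynomial.map_X, polyFun_X, MvPolynomial.aeval_X]
      rfl
  rw [h1, ← Complex.ofReal_sub, Complex.norm_real, norm_sub_rev]
  exact (hf x (by simpa using hx)).le

/-- Harmonic polynomials suffice: a factor |x|² is absorbed by passing from h(s) to s h(s), which is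
why h stays universally quantified through the induction. -/
lemma integral_radialTest_mul_polyFun {u : R3 → ℂ} (hu : LocallyIntegrable u extMeasure)
    (h0 : ∀ h, IsRadialTest h → ∀ n, ∀ p ∈ harmonics n,
      ∫ x in exteriorDomain, (h (‖x‖ ^ 2) : ℂ) * (u x * polyFun p x) = 0) (p : Poly3) :
    ∀ h, IsRadialTest h → ∫ x in exteriorDomain, (h (‖x‖ ^ 2) : ℂ) * (u x * polyFun p x) = 0 := by
  have hint : ∀ h, IsRadialTest h → ∀ p : Poly3, Integrable
      (fun x => (h (‖x‖ ^ 2) : ℂ) * (u x * polyFun p x)) extMeasure := by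
    intro h hh p
    have := hu.integrable_smul_left_of_hasCompactSupport
      (g := fun x : R3 => ((h (‖x‖ ^ 2) : ℝ) : ℂ) * polyFun p x)
      ((contDiff_radial hh.contDiff).continuous.mul (contDiff_polyFun p).continuous)
      hh.hasCompactSupport.mul_right
    refine this.congr (ae_of_all _ fun x => ?_)
    simp only [smul_eq_mul]
    ring
  induction p using harmonic_induction with
  | zero => simp [polyFun_zero]
  | add p q hp hq =>
    intro h hh
    simp only [polyFun_add, mul_add]
    rw [integral_add (hint h hh p) (hint h hh q), hp h hh, hq h hh, add_zero]
  | normSq_mul p hp =>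
    intro h hh
    rw [← hp _ hh.id_mul]
    refine integral_congr_ae (ae_of_all _ fun x => ?_)
    simp only [polyFun_mul, polyFun_normSqPoly]
    push_cast
    ring
  | harmonic n p hp => exact fun h hh => h0 h hh n p hp

/-- Products of radial functions and harmonic polynomials are total in the exterior domain. -/
lemma ae_eq_zero_of_harmonics {u : R3 → ℂ} (hu : LocallyIntegrable u extMeasure)
    (h0 : ∀ h, IsRadialTest h → ∀ n, ∀ p ∈ harmonics n,
      ∫ x in exteriorDomain, (h (‖x‖ ^ 2) : ℂ) * (u x * polyFun p x) = 0) :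
    ∀ᵐ x ∂extMeasure, u x = 0 := by
  rw [ae_restrict_iff' isOpen_exteriorDomain.measurableSet]
  refine isOpen_exteriorDomain.ae_eq_zero_of_integral_contDiff_smul_eq_zero
    (locallyIntegrableOn_of_locallyIntegrable_restrict hu) fun g hg hgc hgs => ?_
  obtain ⟨a, ha, hag⟩ : ∃ a, 1 < a ∧ ∀ x ∈ tsupport g, a ≤ ‖x‖ ^ 2 := by
    rcases (tsupport g).eq_empty_or_nonempty with he | hne
    · exact ⟨2, by norm_num, fun x hx => by simp [he] at hx⟩
    · obtain ⟨x0, hx0, hmin⟩ := hgc.exists_isMinOn hne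
        (f := fun x : R3 => ‖x‖ ^ 2) (by fun_prop)
      exact ⟨‖x0‖ ^ 2, one_lt_pow₀ (hgs hx0) two_ne_zero, fun x hx => hmin hx⟩
  obtain ⟨b, hbg⟩ : ∃ b, ∀ x ∈ tsupport g, ‖x‖ ^ 2 ≤ b := by
    obtain ⟨b, hb⟩ := hgc.exists_bound_of_continuousOn
      (f := fun x : R3 => ‖x‖ ^ 2) (by fun_prop)
    exact ⟨b, fun x hx => (le_abs_self _).trans (hb x hx)⟩
  -- Since h(|x|²) = 1 on the support of g, g may be replaced by h g, and then g alone is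
  -- approximated by polynomials.
  obtain ⟨h, hh, hpos, hone⟩ := exists_radialTest_eq_one (b := b) ha
  obtain ⟨a', b', ha', hab', -, hb'⟩ := hh.exists_bounds
  have hhu : Integrable (fun x => (h (‖x‖ ^ 2) : ℂ) * u x) extMeasure := by
    have := hu.integrable_smul_left_of_hasCompactSupport
      (contDiff_radial hh.contDiff).continuous hh.hasCompactSupport
    simpa only [smul_eq_mul] using this
  have hgh : ∀ x, (h (‖x‖ ^ 2) : ℂ) * g x = g x := by
    intro x
    by_cases hx : x ∈ tsupport g
    · rw [hone _ (hag x hx) (hbg x hx), Complex.ofReal_one, one_mul]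
    · rw [image_eq_zero_of_notMem_tsupport hx, Complex.ofReal_zero, mul_zero]
  have e1 : ∫ x, g x • u x = ∫ x in exteriorDomain, (h (‖x‖ ^ 2) : ℂ) * u x * g x := by
    rw [setIntegral_eq_integral_of_forall_compl_eq_zero]
    · refine integral_congr_ae (ae_of_all _ fun x => ?_)
      simp only [Complex.real_smul]
      rw [mul_right_comm, hgh]
    · intro x hx
      rw [mul_right_comm, hgh, image_eq_zero_of_notMem_tsupport (fun h => hx (hgs h))]
      simp
  rw [e1]
  set K := ∫ x in exteriorDomain, ‖(h (‖x‖ ^ 2) : ℂ) * u x‖ with hK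
  have hK0 : 0 ≤ K := integral_nonneg fun x => norm_nonneg _
  have bound : ∀ ε > 0, ‖∫ x in exteriorDomain, (h (‖x‖ ^ 2) : ℂ) * u x * g x‖ ≤ ε * K := by
    intro ε hε
    -- The ball of radius b' contains the support of h(|x|²), because b' > 1.
    obtain ⟨p, hp⟩ := exists_polyFun_near hg.continuous b' hε
    have h2 := integral_radialTest_mul_polyFun hu h0 p h hh
    have hgb : Integrable (fun x => (h (‖x‖ ^ 2) : ℂ) * u x * g x) extMeasure := by
      have hgc' : HasCompactSupport (fun x => (g x : ℂ)) :=
        hgc.comp_left (g := fun t : ℝ => (t : ℂ)) (by simp)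
      have := hu.integrable_smul_left_of_hasCompactSupport
        (Complex.continuous_ofReal.comp hg.continuous) hgc'
      refine this.congr (ae_of_all _ fun x => ?_)
      simp only [Function.comp, smul_eq_mul]
      rw [mul_right_comm, hgh]
    have hpb : Integrable (fun x => (h (‖x‖ ^ 2) : ℂ) * (u x * polyFun p x)) extMeasure := by
      have := hu.integrable_smul_left_of_hasCompactSupport
        (g := fun x : R3 => ((h (‖x‖ ^ 2) : ℝ) : ℂ) * polyFun p x)
        ((contDiff_radial hh.contDiff).continuous.mul (contDiff_polyFun p).continuous)
        hh.hasCompactSupport.mul_right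
      refine this.congr (ae_of_all _ fun x => ?_)
      simp only [smul_eq_mul]
      ring
    rw [← sub_zero (∫ x in exteriorDomain, (h (‖x‖ ^ 2) : ℂ) * u x * g x), ← h2,
      ← integral_sub hgb hpb, hK, ← integral_const_mul]
    refine norm_integral_le_of_norm_le (hhu.norm.const_mul ε) (ae_of_all _ fun x => ?_)
    rw [← mul_assoc, ← mul_sub, norm_mul, mul_comm]
    by_cases hx : ‖x‖ ≤ b'
    · exact mul_le_mul_of_nonneg_right (hp x hx) (norm_nonneg _)
    · rw [not_le] at hx
      rw [hb' _ (by nlinarith)]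
      simp
  rw [← norm_le_zero_iff]
  refine le_of_forall_pos_le_add fun ε hε => ?_
  have h3 := bound (ε / (K + 1)) (by positivity)
  refine h3.trans ?_
  rw [zero_add, div_mul_eq_mul_div, div_le_iff₀ (by positivity)]
  nlinarith

lemma locallyIntegrable_apply {E : R3 → C3} (hE : MemLp E 2 extMeasure) (i : Fin 3) :
    LocallyIntegrable (fun x => E x i) extMeasure :=
  ((EuclideanSpace.proj i : C3 →L[ℂ] ℂ).comp_memLp' hE).locallyIntegrable (by norm_num)

lemma locallyIntegrable_dot_normal {E : R3 → C3} (hE : MemLp E 2 extMeasure) :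
    LocallyIntegrable (fun x => dot (normal x) (E x)) extMeasure := by
  have h1 : ∀ i : Fin 3, LocallyIntegrable (fun x => (x i : ℂ) * E x i) extMeasure := by
    intro i
    rw [← locallyIntegrableOn_univ]
    exact LocallyIntegrableOn.continuousOn_mul
      (locallyIntegrableOn_univ.2 (locallyIntegrable_apply hE i))
      (contDiff_coord i).continuous.continuousOn isOpen_univ.isLocallyClosed
  have e : (fun x => dot (normal x) (E x)) =
      (fun x => (x 0 : ℂ) * E x 0) + (fun x => (x 1 : ℂ) * E x 1) + fun x => (x 2 : ℂ) * E x 2 := by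
    funext x
    simp [dot, Fin.sum_univ_three, normal_apply]
  rw [e]
  exact ((h1 0).add (h1 1)).add (h1 2)

/-! ### Weak solutions without radial components -/

section Tangential

variable {γ lam : ℝ} {E B : R3 → C3}

/-- E is weakly divergence free: the test field 2h' q x + h ∇q is the gradient of h(|x|²) q, hence
curl free, and it vanishes on the sphere. Its radial part does not see E. -/
lemma integral_dot_gradField (hlam : lam ≠ 0) (hw : IsWeakSolution γ lam E B)
    (hE : ∀ᵐ x ∂extMeasure, dot (normal x) (E x) = 0) {h : ℝ → ℝ} (hh : IsRadialTest h)
    (q : Poly3) : ∫ x in exteriorDomain, dot (E x) (radialField h (gradField q) x) = 0 := by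
  have c1 := contDiff_radialField (contDiff_const.mul hh.deriv.contDiff : ContDiff ℝ ∞
    (fun s => 2 * deriv h s)) (posField q)
  have c2 := contDiff_radialField hh.contDiff (gradField q)
  have hcurl : curl (fun x => radialField (fun s => 2 * deriv h s) (posField q) x +
      radialField h (gradField q) x) = 0 := by
    funext x
    rw [curl_add_apply c1 c2, curl_posField (hasDerivAt_of_contDiff
      (contDiff_const.mul hh.deriv.contDiff) _),
      curl_gradField (hasDerivAt_of_contDiff hh.contDiff _)]
    simp
  have hc0 : curl (0 : R3 → C3) = 0 := by
    have := curl_smul (v := 0) contDiff_const 0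
    simpa using this
  have := hw (fun x => radialField (fun s => 2 * deriv h s) (posField q) x +
      radialField h (gradField q) x) 0 (c1.add c2) contDiff_const
    ((memLp_radialField (by have := hh.deriv.contDiff.continuous; fun_prop)
      (hh.deriv.rapidDecay.const_mul 2) _).add
      (memLp_radialField hh.contDiff.continuous hh.rapidDecay _))
    MemLp.zero (by rw [hcurl]; exact MemLp.zero) (by rw [hc0]; exact MemLp.zero) (by
      intro x hx
      have hx2 : ‖x‖ ^ 2 = 1 := by rw [hx, one_pow]
      have h2 : wedge (normal x) 0 = 0 := by
        ext i
        fin_cases i <;> simp [wedge]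
      simp [radialField, hx2, hh.apply_one, hh.deriv.apply_one, h2, tangential])
  have h2 : (lam : ℂ) * ∫ x in exteriorDomain, dot (E x) (radialField h (gradField q) x) = 0 := by
    rw [← this, ← integral_const_mul]
    refine integral_congr_ae ?_
    filter_upwards [hE] with x hx
    rw [hcurl, hc0]
    simp only [Pi.zero_apply, smul_zero, sub_zero, add_zero, dot_zero_right, dot_smul_right,
      dot_add_right, radialField, polyField_posField, dot_comm _ (normal x), hx, mul_zero, zero_add]
  exact (mul_eq_zero.1 h2).resolve_left (by exact_mod_cast hlam)

lemma integral_dot_posField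
    (hE : ∀ᵐ x ∂extMeasure, dot (normal x) (E x) = 0) (h : ℝ → ℝ)
    (q : Poly3) : ∫ x in exteriorDomain, dot (E x) (radialField h (posField q) x) = 0 := by
  refine integral_eq_zero_of_ae ?_
  filter_upwards [hE] with x hx
  simp only [dot_smul_right, radialField, polyField_posField, dot_comm _ (normal x), hx, mul_zero]
  rfl

/-- Test with (0, h q x): its curl is -h x ∧ ∇q, and the pairing of B with the radial field itself
vanishes. -/
lemma integral_dot_rotField (hw : IsWeakSolution γ lam E B)
    (hB : ∀ᵐ x ∂extMeasure, dot (normal x) (B x) = 0) {h : ℝ → ℝ} (hh : IsRadialTest h)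
    (q : Poly3) : ∫ x in exteriorDomain, dot (E x) (radialField h (rotField q) x) = 0 := by
  have hcurl : curl (radialField h (posField q)) = -radialField h (rotField q) := by
    funext x
    rw [curl_posField (hasDerivAt_of_contDiff hh.contDiff _)]
    rfl
  have hc0 : curl (0 : R3 → C3) = 0 := by
    have := curl_smul (v := 0) contDiff_const 0
    simpa using this
  have := hw 0 (radialField h (posField q)) contDiff_const (contDiff_radialField hh.contDiff _)
    MemLp.zero (memLp_radialField hh.contDiff.continuous hh.rapidDecay _)
    (by rw [hc0]; exact MemLp.zero)
    (by rw [hcurl]; exact (memLp_radialField hh.contDiff.continuous hh.rapidDecay _).neg) (by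
      intro x hx
      have hx2 : ‖x‖ ^ 2 = 1 := by rw [hx, one_pow]
      have h2 : wedge (normal x) 0 = 0 := by
        ext i
        fin_cases i <;> simp [wedge]
      simp [radialField, hx2, hh.apply_one, h2, tangential])
  rw [← neg_eq_zero, ← integral_neg, ← this]
  refine integral_congr_ae ?_
  filter_upwards [hB] with x hx
  rw [hcurl, hc0]
  simp only [Pi.zero_apply, Pi.neg_apply, smul_zero, sub_zero, zero_add, dot_neg_right,
    dot_smul_right]
  simp only [radialField, polyField_posField, dot_smul_right, dot_comm _ (normal x), hx, mul_zero,
    add_zero]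

/-- A weak solution with vanishing radial components vanishes. -/
lemma IsWeakSolution.ae_eq_zero (hlam : lam ≠ 0) (hw : IsWeakSolution γ lam E B)
    (hE2 : MemLp E 2 extMeasure)
    (hE : ∀ᵐ x ∂extMeasure, dot (normal x) (E x) = 0)
    (hB : ∀ᵐ x ∂extMeasure, dot (normal x) (B x) = 0) : ∀ᵐ x ∂extMeasure, E x = 0 := by
  have hj : ∀ j : Fin 3, ∀ᵐ x ∂extMeasure, E x j = 0 := by
    intro j
    refine ae_eq_zero_of_harmonics (locallyIntegrable_apply hE2 j) fun h hh n p hp => ?_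
    have hint : ∀ {g : ℝ → ℝ} (Q : Fin 3 → Poly3), IsRadialTest g →
        Integrable (fun x => dot (E x) (radialField g Q x)) extMeasure := fun Q hg =>
      integrable_dot hE2 (memLp_radialField hg.contDiff.continuous hg.rapidDecay Q)
    -- In degree 0 the factor n(n + 1) of `harmonic_smul_basis` vanishes, but then p is constant and
    -- p eⱼ = ∇(xⱼ p) directly.
    rcases Nat.eq_zero_or_pos n with rfl | hn
    · rw [← integral_dot_gradField hlam hw hE hh (MvPolynomial.X j * p)]
      refine integral_congr_ae (ae_of_all _ fun x => ?_)
      have hC := MvPolynomial.totalDegree_eq_zero_iff_eq_C.1 (Nat.le_zero.1 hp.1.totalDegree_le)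
      have e : polyField (gradField (MvPolynomial.X j * p)) x =
          polyFun p x • EuclideanSpace.single j 1 := by
        ext i
        rw [polyField_apply, gradField, Derivation.leibniz, hC, MvPolynomial.pderiv_C,
          MvPolynomial.pderiv_X]
        by_cases hij : i = j
        · subst hij
          simp [polyFun]
        · simp [hij, Ne.symm hij, polyFun]
      have e' : dot (E x) (EuclideanSpace.single j 1) = E x j := by simp [dot]
      simp only [radialField, e, dot_smul_right, e']
      ring
    -- `harmonic_smul_basis` splits p eⱼ into gradient, radial and rotational fields, all
    -- annihilated by E; the factor |x|² goes into the profile s h(s).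
    · have key : ∀ x, (n * (n + 1) : ℂ) * ((h (‖x‖ ^ 2) : ℂ) * (E x j * polyFun p x)) =
          n * dot (E x) (radialField h (gradField (MvPolynomial.X j * p)) x) -
          dot (E x) (radialField (fun s => s * h s) (gradField (MvPolynomial.pderiv j p)) x) +
          (n - 1) * dot (E x) (radialField h (posField (MvPolynomial.pderiv j p)) x) -
          dot (E x) (radialField h (rotField (rotField p j)) x) := by
        intro x
        have h2 := fun i => congrArg (fun q => E x i * polyFun q x) (harmonic_smul_basis hp i j)
        have h3 : ∑ i, E x i * polyFun (if i = j then (n : Poly3) * (n + 1) * p else 0) x =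
            n * (n + 1) * (E x j * polyFun p x) := by
          rw [Finset.sum_eq_single j]
          · rw [if_pos rfl, polyFun_mul, polyFun_mul, polyFun_add, polyFun_natCast, polyFun_one]
            ring
          · intro i _ hij
            rw [if_neg hij, polyFun_zero, mul_zero]
          · simp
        have h4 : (n * (n + 1) : ℂ) * ((h (‖x‖ ^ 2) : ℂ) * (E x j * polyFun p x)) =
            (h (‖x‖ ^ 2) : ℂ) * (n * (n + 1) * (E x j * polyFun p x)) := by ring
        rw [h4, ← h3]
        simp only [h2, radialField, dot_smul_right, polyFun_sub, polyFun_add, polyFun_mul,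
          polyFun_natCast, polyFun_one, polyFun_normSqPoly]
        simp only [dot, polyField_apply, Fin.sum_univ_three]
        push_cast
        ring
      have h5 : (n * (n + 1) : ℂ) *
          ∫ x in exteriorDomain, (h (‖x‖ ^ 2) : ℂ) * (E x j * polyFun p x) = 0 := by
        rw [← integral_const_mul]
        simp only [key]
        have i1 := (hint (gradField (MvPolynomial.X j * p)) hh).const_mul (n : ℂ)
        have i2 := hint (gradField (MvPolynomial.pderiv j p)) hh.id_mul
        have i3 := (hint (posField (MvPolynomial.pderiv j p)) hh).const_mul (n - 1 : ℂ)
        have i4 := hint (rotField (rotField p j)) hh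
        have i12 := i1.sub i2
        have i123 := i12.add i3
        rw [integral_sub (by exact i123) (by exact i4), integral_add (by exact i12) (by exact i3),
          integral_sub (by exact i1) (by exact i2), integral_const_mul, integral_const_mul,
          integral_dot_gradField hlam hw hE hh, integral_dot_gradField hlam hw hE hh.id_mul,
          integral_dot_posField hE, integral_dot_rotField hw hB hh]
        simp
      refine (mul_eq_zero.1 h5).resolve_left ?_
      have : ((n * (n + 1) : ℕ) : ℂ) ≠ 0 := Nat.cast_ne_zero.2 (by positivity)
      exact_mod_cast this
  filter_upwards [ae_all_iff.2 hj] with x hx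
  ext j
  exact hx j

end Tangential

end MaxwellExterior

/-! ### Upper bound for the multiplicity -/

namespace MaxwellExterior

open Filter Topology

instance (n : ℕ) : FiniteDimensional ℂ (harmonics n) :=
  Module.finite_of_finrank_pos (by rw [finrank_harmonics]; omega)

lemma continuousOn_resonance {μ : ℝ} (n : ℕ) {h : ℝ → ℝ} (hh : Continuous h) {b : ℝ} (hb : 1 ≤ b) :
    ContinuousOn (fun t => h t * besselRadial μ n t * t ^ n * √t) (uIcc 1 b) := by
  have h1 : ContinuousOn (besselRadial μ n) (uIcc 1 b) :=
    (contDiffOn_besselRadial μ n).continuousOn.mono fun t ht => by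
      rw [uIcc_of_le hb] at ht
      exact lt_of_lt_of_le one_pos ht.1
  have h2 : Continuous fun t : ℝ => √t := Real.continuous_sqrt
  exact ((hh.continuousOn.mul h1).mul (continuous_pow n).continuousOn).mul h2.continuousOn

/-- Provides one test function outside the hyperplane of solvable right-hand sides, so that
subtracting a multiple of it makes any other one solvable. -/
lemma resonance_pos {μ : ℝ} (hμ : 0 < μ) (n : ℕ) {h : ℝ → ℝ} (hh : Continuous h)
    (h0 : ∀ s, 0 ≤ h s) (h1 : ∀ s, 2 ≤ s → s ≤ 3 → h s = 1) {b : ℝ} (hb : 3 ≤ b) :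
    0 < ∫ t in (1 : ℝ)..b, h t * besselRadial μ n t * t ^ n * √t := by
  have hb1 : (1 : ℝ) ≤ b := by linarith
  refine intervalIntegral.integral_pos (by linarith) ?_ ?_ ⟨2, ⟨by norm_num, by linarith⟩, ?_⟩
  · have := continuousOn_resonance (μ := μ) n hh hb1
    rwa [uIcc_of_le hb1] at this
  · intro t ht
    have ht0 : 0 < t := by linarith [ht.1]
    have := h0 t
    have := besselRadial_pos hμ n ht0
    positivity
  · rw [h1 2 le_rfl (by norm_num)]
    have := besselRadial_pos hμ n (show (0 : ℝ) < 2 by norm_num)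
    positivity

variable {γ μ : ℝ} {E B : R3 → C3}

/-- After the swap, B plays the part of the electric field with constant 1/γ < 1, and `logDecay` is
at least 1: no degree resonates. -/
lemma IsWeakSolution.radial_magnetic_eq_zero (hγ : 1 < γ) (hμ : 0 < μ)
    (hw : IsWeakSolution γ (-μ) E B) (hB : MemLp B 2 extMeasure) :
    ∀ᵐ x ∂extMeasure, dot (normal x) (B x) = 0 := by
  refine ae_eq_zero_of_harmonics (locallyIntegrable_dot_normal hB) fun h hh n p hp => ?_
  obtain ⟨a, b, ha, hab, h0, h1⟩ := hh.exists_bounds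
  refine (hw.swap (by linarith)).integral_radial_eq_zero hμ hp hh.contDiff
    (by linarith : (1 : ℝ) ≤ b) h1 (Or.inl fun heq => ?_)
  have h2 := one_le_logDecay hμ n
  have h3 := inv_lt_one_of_one_lt₀ hγ
  linarith

/-- Only degree n resonates, by strict monotonicity of `logDecay` in the degree. There the solvable
h form a hyperplane, and the moments against g supply the missing direction. -/
lemma IsWeakSolution.radial_electric_eq_zero (hμ : 0 < μ) {n : ℕ}
    (hn : logDecay n μ = γ) (hw : IsWeakSolution γ (-μ) E B) (hE : MemLp E 2 extMeasure)
    {g : ℝ → ℝ} (hg : IsRadialTest g) (hg0 : ∀ s, 0 ≤ g s) (hg1 : ∀ s, 2 ≤ s → s ≤ 3 → g s = 1)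
    (hE0 : ∀ p ∈ harmonics n,
      ∫ x in exteriorDomain, dot (E x) (radialField g (posField p) x) = 0) :
    ∀ᵐ x ∂extMeasure, dot (normal x) (E x) = 0 := by
  refine ae_eq_zero_of_harmonics (locallyIntegrable_dot_normal hE) fun h hh k p hp => ?_
  obtain ⟨a, b, ha, hab, h0, h1⟩ := hh.exists_bounds
  by_cases hk : k = n
  · subst hk
    obtain ⟨a', b', ha', hab', h0', h1'⟩ := hg.exists_bounds
    set d := max (max b b') 3 with hd
    have hbd : b ≤ d := (le_max_left _ _).trans (le_max_left _ _)
    have hbd' : b' ≤ d := (le_max_right _ _).trans (le_max_left _ _)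
    have hd3 : 3 ≤ d := le_max_right _ _
    have hd1 : 1 ≤ d := by linarith
    have hpos := resonance_pos hμ k hg.contDiff.continuous hg0 hg1 hd3
    set J : (ℝ → ℝ) → ℝ := fun f =>
      ∫ t in (1 : ℝ)..d, f t * besselRadial μ k t * t ^ k * √t with hJ
    -- Chosen so that h - r g is orthogonal to the decaying solution, which makes the Robin problem
    -- solvable.
    set r := J h / J g with hr
    have hf : IsRadialTest (fun s => h s - r * g s) := hh.sub (hg.const_mul r)
    have h2 := hw.integral_radial_eq_zero hμ hp hf.contDiff hd1
      (fun s hs => by rw [h1 s (hbd.trans hs), h1' s (hbd'.trans hs), mul_zero, sub_zero])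
      (Or.inr (by
        have e : ∀ t, (h t - r * g t) * besselRadial μ k t * t ^ k * √t =
            h t * besselRadial μ k t * t ^ k * √t -
              r * (g t * besselRadial μ k t * t ^ k * √t) := fun t => by ring
        simp only [e]
        rw [intervalIntegral.integral_sub
          (continuousOn_resonance k hh.contDiff.continuous hd1).intervalIntegrable
          ((continuousOn_resonance k hg.contDiff.continuous hd1).intervalIntegrable.const_mul r),
          intervalIntegral.integral_const_mul]
        change J h - r * J g = 0
        rw [hr, div_mul_cancel₀ _ hpos.ne', sub_self]))
    have h3 := hE0 p hp
    have hint : ∀ {f : ℝ → ℝ}, IsRadialTest f → Integrable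
        (fun x => (f (‖x‖ ^ 2) : ℂ) * (dot (normal x) (E x) * polyFun p x)) extMeasure := by
      intro f hf
      refine (integrable_dot hE (memLp_radialField hf.contDiff.continuous hf.rapidDecay
        (posField p))).congr (ae_of_all _ fun x => ?_)
      simp only [radialField, polyField_posField, dot_smul_left, dot_comm (E x)]
      ring
    have h4 : ∫ x in exteriorDomain,
        (g (‖x‖ ^ 2) : ℂ) * (dot (normal x) (E x) * polyFun p x) = 0 := by
      rw [← h3]
      refine integral_congr_ae (ae_of_all _ fun x => ?_)
      simp only [radialField, polyField_posField, dot_smul_left, dot_comm (E x)]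
      ring
    have e : ∀ x, (((h (‖x‖ ^ 2) - r * g (‖x‖ ^ 2) : ℝ)) : ℂ) *
        (dot (normal x) (E x) * polyFun p x) =
        (h (‖x‖ ^ 2) : ℂ) * (dot (normal x) (E x) * polyFun p x) -
        r * ((g (‖x‖ ^ 2) : ℂ) * (dot (normal x) (E x) * polyFun p x)) := fun x => by
      push_cast
      ring
    simp only [e] at h2
    rw [integral_sub (hint hh) ((hint hg).const_mul _), integral_const_mul, h4, mul_zero,
      sub_zero] at h2
    exact h2
  · refine hw.integral_radial_eq_zero hμ hp hh.contDiff (by linarith : (1 : ℝ) ≤ b) h1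
      (Or.inl fun heq => hk ?_)
    exact (logDecay_strictMono hμ).injective (heq.trans hn.symm)

lemma radialField_posField_add (g : ℝ → ℝ) (p q : Poly3) (x : R3) :
    radialField g (posField (p + q)) x =
      radialField g (posField p) x + radialField g (posField q) x := by
  simp only [radialField, polyField_posField, polyFun_add, add_smul, smul_add]

lemma radialField_posField_smul (g : ℝ → ℝ) (c : ℂ) (p : Poly3) (x : R3) :
    radialField g (posField (c • p)) x = c • radialField g (posField p) x := by
  simp only [radialField, polyField_posField, polyFun_smul, smul_smul]
  congr 1
  ring

/-- The moments of the radial component against `g(|x|²) P(x)`, `P` harmonic of degree `n`. -/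
noncomputable def radialMoments {g : ℝ → ℝ} (hg : IsRadialTest g) (n : ℕ) :
    StateSpace →ₗ[ℂ] Module.Dual ℂ (harmonics n) :=
  LinearMap.mk₂ ℂ
    (fun (u : StateSpace) (p : harmonics n) =>
      ∫ x in exteriorDomain, dot (u.fst x) (radialField g (posField (p : Poly3)) x))
    (fun u v p => by
      obtain ⟨T, hT⟩ := exists_pairing
        (memLp_radialField hg.contDiff.continuous hg.rapidDecay (posField (p : Poly3)))
      simp only [← hT, WithLp.add_fst, map_add])
    (fun c u p => by
      obtain ⟨T, hT⟩ := exists_pairing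
        (memLp_radialField hg.contDiff.continuous hg.rapidDecay (posField (p : Poly3)))
      simp only [← hT, WithLp.smul_fst, map_smul])
    (fun u p q => by
      have hi : ∀ p : Poly3, Integrable
          (fun x => dot (u.fst x) (radialField g (posField p) x)) extMeasure := fun p =>
        integrable_dot (Lp.memLp u.fst)
          (memLp_radialField hg.contDiff.continuous hg.rapidDecay _)
      rw [← integral_add (hi p) (hi q)]
      simp only [Submodule.coe_add, radialField_posField_add, dot_add_right])
    (fun c u p => by
      simp only [Submodule.coe_smul, radialField_posField_smul, dot_smul_right, smul_eq_mul]
      rw [integral_const_mul])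

/-- The moments map the eigenspace injectively into the dual of the harmonics of degree n: if they
vanish, both radial components vanish, and then the field does. -/
lemma rank_eigenspace_le (hγ : 1 < γ) (hμ : 0 < μ) {n : ℕ} (hn : logDecay n μ = γ) :
    Module.rank ℂ (eigenspace (generator γ) ((-μ : ℝ) : ℂ)) ≤ ((2 * n + 1 : ℕ) : Cardinal) := by
  obtain ⟨g, hg, hg0, hg1⟩ := exists_radialTest_eq_one (a := 2) (b := 3) (by norm_num)
  let T := (radialMoments hg n).domRestrict (eigenspace (generator γ) ((-μ : ℝ) : ℂ))
  have hT : Function.Injective T := by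
    rw [← LinearMap.ker_eq_bot, LinearMap.ker_eq_bot']
    rintro ⟨u, hu⟩ h0
    have hw := IsWeakSolution.of_mem_eigenspace hu
    have hE := Lp.memLp u.fst
    have hB := Lp.memLp u.snd
    have hμ0 : -μ ≠ 0 := by linarith
    have hrB := hw.radial_magnetic_eq_zero hγ hμ hB
    have hrE := hw.radial_electric_eq_zero hμ hn hE hg hg0 hg1 fun p hp =>
      congrArg (fun f : Module.Dual ℂ (harmonics n) => f ⟨p, hp⟩) h0
    have hE0 := hw.ae_eq_zero hμ0 hE hrE hrB
    have hB0 := (hw.swap (by linarith)).ae_eq_zero hμ0 hB hrB (by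
      filter_upwards [hrE] with x hx
      rw [Pi.neg_apply, dot_neg_right, hx, neg_zero])
    refine Subtype.ext ((WithLp.equiv 2 (L2Field × L2Field)).injective (Prod.ext ?_ ?_))
    · exact Lp.eq_zero_iff_ae_eq_zero.2 hE0
    · exact Lp.eq_zero_iff_ae_eq_zero.2 hB0
  refine (LinearMap.rank_le_of_injective T hT).trans (le_of_eq ?_)
  rw [← Module.finrank_eq_rank, Subspace.dual_finrank_eq, finrank_harmonics]

end MaxwellExterior

/-! ### Decaying fields belong to the domain -/

namespace MaxwellExterior

open Filter Topology

/-- Smooth fields that are square integrable in the exterior domain with weight `|x|²` and whose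
product `x ∧ F` is square integrable. -/
structure IsDecaying (F : R3 → C3) : Prop where
  contDiff : ContDiff ℝ ∞ F
  memLp : MemLp F 2 extMeasure
  memLp_normSq_smul : MemLp (fun x => ((‖x‖ ^ 2 : ℝ) : ℂ) • F x) 2 extMeasure
  memLp_wedge : MemLp (fun x => wedge (normal x) (F x)) 2 extMeasure

lemma IsDecaying.add {F H : R3 → C3} (hF : IsDecaying F) (hH : IsDecaying H) :
    IsDecaying (fun x => F x + H x) where
  contDiff := hF.contDiff.add hH.contDiff
  memLp := hF.memLp.add hH.memLp
  memLp_normSq_smul := by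
    simp only [smul_add]
    exact hF.memLp_normSq_smul.add hH.memLp_normSq_smul
  memLp_wedge := by
    simp only [wedge_add]
    exact hF.memLp_wedge.add hH.memLp_wedge

lemma IsDecaying.const_smul {F : R3 → C3} (hF : IsDecaying F) (c : ℂ) :
    IsDecaying (fun x => c • F x) where
  contDiff := hF.contDiff.const_smul c
  memLp := hF.memLp.const_smul c
  memLp_normSq_smul := by
    simp only [smul_comm _ c]
    exact hF.memLp_normSq_smul.const_smul c
  memLp_wedge := by
    simp only [wedge_smul]
    exact hF.memLp_wedge.const_smul c

/-- Both weighted fields are again of this form: the weight |x|² changes g(s) into s g(s), and x ∧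
acts on the polynomial factor. -/
lemma isDecaying_radialField {g : ℝ → ℝ} (hg : ContDiff ℝ ∞ g) (hd : RapidDecay g)
    (Q : Fin 3 → Poly3) : IsDecaying (radialField g Q) where
  contDiff := contDiff_radialField hg Q
  memLp := memLp_radialField hg.continuous hd Q
  memLp_normSq_smul := by
    have h1 : RapidDecay (fun s => s * g s) := hd.mul_of_le (h := fun s => s) 1 1 fun s hs => by
      rw [abs_of_nonneg (by linarith)]; simp
    have h2 : Continuous (fun s => s * g s) := continuous_id.mul hg.continuous
    refine (memLp_radialField h2 h1 Q).congr_norm ?_ (ae_of_all _ fun x => ?_)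
    · exact ((Complex.continuous_ofReal.comp (continuous_norm.pow 2)).smul
        (contDiff_radialField hg Q).continuous).aestronglyMeasurable
    · simp only [radialField, smul_smul]
      push_cast
      rfl
  memLp_wedge := by
    refine (memLp_radialField hg.continuous hd (polyWedge Q)).congr_norm ?_
      (ae_of_all _ fun x => ?_)
    · have h1 : ContDiff ℝ ∞ (normal : R3 → C3) := (contDiff_piLp 2).2 fun i => contDiff_coord i
      have h2 : ContDiff ℝ ∞ (fun x => wedge (normal x) (radialField g Q x)) :=
        (contDiff_piLp 2).2 fun i => contDiff_wedge_apply h1 (contDiff_radialField hg Q) i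
      exact h2.continuous.aestronglyMeasurable
    · simp only [radialField, wedge_smul, wedge_polyField]

lemma tendsto_toLp_of_norm_sub_le {F : R3 → C3} {f : ℕ → R3 → C3} {w : R3 → ℝ}
    (hf : ∀ j, MemLp (f j) 2 extMeasure) (hF : MemLp F 2 extMeasure) (hw : MemLp w 2 extMeasure)
    (h : ∀ j : ℕ, ∀ x ∈ exteriorDomain, ‖f j x - F x‖ ≤ 1 / ((j : ℝ) + 1) * ‖w x‖) :
    Tendsto (fun j => (hf j).toLp (f j)) atTop (𝓝 (hF.toLp F)) := by
  rw [tendsto_iff_norm_sub_tendsto_zero]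
  have hlim : Tendsto (fun j : ℕ => 1 / ((j : ℝ) + 1) * ‖hw.toLp w‖) atTop (𝓝 0) := by
    simpa using (tendsto_one_div_add_atTop_nhds_zero_nat (𝕜 := ℝ)).mul_const ‖hw.toLp w‖
  refine squeeze_zero (fun j => norm_nonneg _) (fun j => ?_) hlim
  refine Lp.norm_le_mul_norm_of_ae_le_mul ?_
  filter_upwards [Lp.coeFn_sub ((hf j).toLp (f j)) (hF.toLp F), (hf j).coeFn_toLp, hF.coeFn_toLp,
    hw.coeFn_toLp, ae_restrict_mem isOpen_exteriorDomain.measurableSet] with x e1 e2 e3 e4 hx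
  rw [e1, Pi.sub_apply, e2, e3, e4]
  exact h j x hx

/-- Cutoff functions of `s = |x|²` that are `1` on `[0, j + 1]` and vanish for `s ≥ 2 (j + 1)`. -/
noncomputable def outerCutoff (j : ℕ) (s : ℝ) : ℝ := Real.smoothTransition (2 - s / (j + 1))

lemma contDiff_outerCutoff (j : ℕ) : ContDiff ℝ ∞ (outerCutoff j) :=
  Real.smoothTransition.contDiff.comp (contDiff_const.sub (contDiff_id.div_const _))

lemma outerCutoff_one (j : ℕ) : outerCutoff j 1 = 1 := by
  refine Real.smoothTransition.one_of_one_le ?_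
  have : (1 : ℝ) / (j + 1) ≤ 1 := by
    rw [div_le_one (by positivity)]
    have : (0 : ℝ) ≤ j := Nat.cast_nonneg j
    linarith
  linarith

/-- The cutoff differs from 1 only where s ≥ j + 1, and there 1 ≤ s/(j + 1). This is the use of the
weight |x|² in `IsDecaying`. -/
lemma abs_outerCutoff_sub_one_le (j : ℕ) {s : ℝ} (hs : 0 ≤ s) :
    |outerCutoff j s - 1| ≤ 1 / ((j : ℝ) + 1) * s := by
  have hj : (0 : ℝ) < (j : ℝ) + 1 := by positivity
  rcases le_total s ((j : ℝ) + 1) with h | h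
  · have : outerCutoff j s = 1 := by
      refine Real.smoothTransition.one_of_one_le ?_
      have : s / ((j : ℝ) + 1) ≤ 1 := by rwa [div_le_one hj]
      linarith
    rw [this, sub_self, abs_zero]
    positivity
  · have h1 : 1 ≤ 1 / ((j : ℝ) + 1) * s := by rwa [one_div_mul_eq_div, one_le_div hj]
    have h2 := Real.smoothTransition.nonneg (2 - s / ((j : ℝ) + 1))
    have h3 := Real.smoothTransition.le_one (2 - s / ((j : ℝ) + 1))
    rw [outerCutoff, abs_le]
    constructor <;> linarith

lemma hasDerivAt_outerCutoff (j : ℕ) (s : ℝ) : HasDerivAt (outerCutoff j)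
    (-(1 / ((j : ℝ) + 1)) * deriv Real.smoothTransition (2 - s / (j + 1))) s := by
  have h1 : HasDerivAt (fun s : ℝ => 2 - s / ((j : ℝ) + 1)) (-(1 / ((j : ℝ) + 1))) s :=
    ((hasDerivAt_id s).div_const ((j : ℝ) + 1)).const_sub 2
  have h2 := ((Real.smoothTransition.contDiff (n := 1)).differentiable one_ne_zero
    (2 - s / ((j : ℝ) + 1))).hasDerivAt.comp s h1
  rw [mul_comm]
  exact h2

lemma hasCompactSupport_outerCutoff_smul (j : ℕ) (F : R3 → C3) :
    HasCompactSupport (fun x => ((outerCutoff j (‖x‖ ^ 2) : ℝ) : ℂ) • F x) := by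
  have hj : (1 : ℝ) ≤ (j : ℝ) + 1 := by
    have : (0 : ℝ) ≤ j := Nat.cast_nonneg j
    linarith
  refine HasCompactSupport.intro (isCompact_closedBall (0 : R3) (2 * (j + 1))) fun x hx => ?_
  have hx' : 2 * ((j : ℝ) + 1) < ‖x‖ := by simpa using hx
  have : outerCutoff j (‖x‖ ^ 2) = 0 := by
    refine Real.smoothTransition.zero_of_nonpos ?_
    have : 2 ≤ ‖x‖ ^ 2 / ((j : ℝ) + 1) := by
      rw [le_div_iff₀ (by positivity)]
      nlinarith
    linarith
  rw [this, Complex.ofReal_zero, zero_smul]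

lemma tendsto_cutoff {F : R3 → C3} (hF : IsDecaying F)
    (hf : ∀ j, MemLp (fun x => ((outerCutoff j (‖x‖ ^ 2) : ℝ) : ℂ) • F x) 2 extMeasure) :
    Tendsto (fun j => (hf j).toLp _) atTop (𝓝 (hF.memLp.toLp F)) := by
  refine tendsto_toLp_of_norm_sub_le hf hF.memLp hF.memLp_normSq_smul.norm
    fun j x hx => ?_
  have e : ((outerCutoff j (‖x‖ ^ 2) : ℝ) : ℂ) • F x - F x =
      ((outerCutoff j (‖x‖ ^ 2) - 1 : ℝ) : ℂ) • F x := by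
    push_cast
    module
  rw [e, norm_smul, Complex.norm_real, norm_norm, norm_smul, Complex.norm_real, Real.norm_eq_abs,
    Real.norm_of_nonneg (sq_nonneg ‖x‖), ← mul_assoc]
  exact mul_le_mul_of_nonneg_right (abs_outerCutoff_sub_one_le j (sq_nonneg _)) (norm_nonneg _)

/-- Besides the cut-off curl there is the commutator 2χ' x ∧ F with χ' = O(1/(j + 1)), which is
controlled by the integrability of x ∧ F. -/
lemma tendsto_curl_cutoff {F : R3 → C3} (hF : ContDiff ℝ ∞ F)
    (hFw : MemLp (fun x => wedge (normal x) (F x)) 2 extMeasure) (hc : IsDecaying (curl F))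
    (hf : ∀ j, MemLp (curl fun x => ((outerCutoff j (‖x‖ ^ 2) : ℝ) : ℂ) • F x) 2 extMeasure) :
    Tendsto (fun j => (hf j).toLp _) atTop (𝓝 (hc.memLp.toLp (curl F))) := by
  obtain ⟨M, hM⟩ := deriv_smoothTransition_bounded
  have hM0 : 0 ≤ M := (abs_nonneg _).trans (hM 0)
  refine tendsto_toLp_of_norm_sub_le hf hc.memLp
    (hc.memLp_normSq_smul.norm.add (hFw.norm.const_mul (2 * M))) fun j x hx => ?_
  have hd := hasDerivAt_outerCutoff j (‖x‖ ^ 2)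
  set d := -(1 / ((j : ℝ) + 1)) * deriv Real.smoothTransition (2 - ‖x‖ ^ 2 / (j + 1)) with hdd
  have e : curl (fun x => ((outerCutoff j (‖x‖ ^ 2) : ℝ) : ℂ) • F x) x - curl F x =
      ((outerCutoff j (‖x‖ ^ 2) - 1 : ℝ) : ℂ) • curl F x +
        ((2 * d : ℝ) : ℂ) • wedge (normal x) (F x) := by
    rw [curl_radial_smul hd hF]
    push_cast
    module
  have hj : (0 : ℝ) < 1 / ((j : ℝ) + 1) := by positivity
  have hd1 : |d| ≤ 1 / ((j : ℝ) + 1) * M := by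
    rw [hdd, abs_mul, abs_neg, abs_of_pos hj]
    exact mul_le_mul_of_nonneg_left (hM _) hj.le
  have h1 : ‖((outerCutoff j (‖x‖ ^ 2) - 1 : ℝ) : ℂ) • curl F x‖ ≤
      1 / ((j : ℝ) + 1) * ‖((‖x‖ ^ 2 : ℝ) : ℂ) • curl F x‖ := by
    rw [norm_smul, Complex.norm_real, norm_smul, Complex.norm_real, Real.norm_eq_abs,
      Real.norm_of_nonneg (sq_nonneg ‖x‖), ← mul_assoc]
    exact mul_le_mul_of_nonneg_right (abs_outerCutoff_sub_one_le j (sq_nonneg _)) (norm_nonneg _)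
  have h2 : ‖((2 * d : ℝ) : ℂ) • wedge (normal x) (F x)‖ ≤
      1 / ((j : ℝ) + 1) * (2 * M * ‖wedge (normal x) (F x)‖) := by
    rw [norm_smul, Complex.norm_real, Real.norm_eq_abs, abs_mul, abs_two]
    nlinarith [norm_nonneg (wedge (normal x) (F x)),
      mul_le_mul_of_nonneg_right hd1 (norm_nonneg (wedge (normal x) (F x)))]
  rw [e]
  refine (norm_add_le _ _).trans ((add_le_add h1 h2).trans ?_)
  rw [← mul_add]
  exact mul_le_mul_of_nonneg_left (le_abs_self _) hj.le

/-- Decaying smooth fields satisfying the boundary condition are in the domain of the generator. -/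
lemma mem_closure_of_isDecaying {γ : ℝ} {v w : R3 → C3} (hv : IsDecaying v) (hw : IsDecaying w)
    (hcv : IsDecaying (curl v)) (hcw : IsDecaying (curl w)) (hb : BoundaryCondition γ v w) :
    ((WithLp.toLp 2 (hv.memLp.toLp v, hw.memLp.toLp w),
      WithLp.toLp 2 (hcw.memLp.toLp (curl w), -hcv.memLp.toLp (curl v))) :
        StateSpace × StateSpace) ∈ (coreGraph γ).topologicalClosure := by
  have hsm : ∀ {F : R3 → C3}, ContDiff ℝ ∞ F → ∀ j,
      ContDiff ℝ ∞ (fun x => ((outerCutoff j (‖x‖ ^ 2) : ℝ) : ℂ) • F x) := fun hF j =>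
    (contDiff_radial (contDiff_outerCutoff j)).smul hF
  have hm : ∀ {F : R3 → C3}, ContDiff ℝ ∞ F → ∀ j,
      MemLp (fun x => ((outerCutoff j (‖x‖ ^ 2) : ℝ) : ℂ) • F x) 2 extMeasure := fun hF j =>
    (hsm hF j).continuous.memLp_of_hasCompactSupport (hasCompactSupport_outerCutoff_smul j _)
  have hmc : ∀ {F : R3 → C3}, ContDiff ℝ ∞ F → ∀ j,
      MemLp (curl fun x => ((outerCutoff j (‖x‖ ^ 2) : ℝ) : ℂ) • F x) 2 extMeasure := fun hF j =>
    (contDiff_curl (hsm hF j)).continuous.memLp_of_hasCompactSupport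
      (hasCompactSupport_curl (hasCompactSupport_outerCutoff_smul j _))
  have t1 := tendsto_cutoff hv (hm hv.contDiff)
  have t2 := tendsto_cutoff hw (hm hw.contDiff)
  have t3 := tendsto_curl_cutoff hw.contDiff hw.memLp_wedge hcw (hmc hw.contDiff)
  have t4 := (tendsto_curl_cutoff hv.contDiff hv.memLp_wedge hcv (hmc hv.contDiff)).neg
  have hcont := WithLp.prod_continuous_toLp 2 L2Field L2Field
  have t := ((hcont.tendsto _).comp (t1.prodMk_nhds t2)).prodMk_nhds
    ((hcont.tendsto _).comp (t3.prodMk_nhds t4))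
  refine mem_closure_of_tendsto t (Eventually.of_forall fun j => ?_)
  refine ⟨_, _, hsm hv.contDiff j, hasCompactSupport_outerCutoff_smul j v, hsm hw.contDiff j,
    hasCompactSupport_outerCutoff_smul j w, ?_, (hm hv.contDiff j).coeFn_toLp,
    (hm hw.contDiff j).coeFn_toLp, (hmc hw.contDiff j).coeFn_toLp, ?_⟩
  -- The cutoff equals 1 on the sphere, so the boundary condition is inherited.
  · intro x hx
    have hx2 : ‖x‖ ^ 2 = 1 := by rw [hx, one_pow]
    simp only [hx2, outerCutoff_one, Complex.ofReal_one, one_smul]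
    exact hb x hx
  · exact (Lp.coeFn_neg _).trans (hmc hv.contDiff j).coeFn_toLp.neg

end MaxwellExterior

/-! ### Eigenfunctions and the exact multiplicity -/

namespace MaxwellExterior

open Filter Topology

/-- The exterior domain contains (2, ∞)³, a product of infinite sets, which determines a polynomial.
-/
lemma eq_zero_of_polyFun_eq_zero {p : Poly3} (h : ∀ x ∈ exteriorDomain, polyFun p x = 0) :
    p = 0 := by
  refine MvPolynomial.funext_set (fun _ => Complex.ofReal '' Ioi (2 : ℝ))
    (fun _ => (Ioi_infinite 2).image Complex.ofReal_injective.injOn) fun z hz => ?_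
  choose x hx e using fun i => hz i (mem_univ i)
  have hx1 : (WithLp.toLp 2 x : R3) ∈ exteriorDomain := by
    have h0 : (2 : ℝ) < x 0 := hx 0
    have h1 : ‖x 0‖ ≤ ‖(WithLp.toLp 2 x : R3)‖ := PiLp.norm_apply_le (WithLp.toLp 2 x : R3) 0
    have h2 := le_abs_self (x 0)
    rw [Real.norm_eq_abs] at h1
    change (1 : ℝ) < _
    linarith
  have h3 := h _ hx1
  rw [map_zero, ← h3, polyFun, ← funext e]

/-- The fields `a(|x|²) P(x) x + b(|x|²) ∇P(x)`, linearly in `P`. -/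
noncomputable def poloidalField (a b : ℝ → ℝ) : Poly3 →ₗ[ℂ] R3 → C3 where
  toFun p x := radialField a (posField p) x + radialField b (gradField p) x
  map_add' p q := by
    funext x
    ext i
    simp only [radialField, Pi.add_apply, PiLp.add_apply, PiLp.smul_apply, polyField_apply,
      posField, gradField, polyFun_mul, polyFun_add, map_add, smul_eq_mul]
    ring
  map_smul' c p := by
    funext x
    ext i
    simp only [radialField, Pi.smul_apply, PiLp.add_apply, PiLp.smul_apply, polyField_apply,
      posField, gradField, polyFun_mul, polyFun_smul, Derivation.map_smul, smul_eq_mul, RingHom.id_apply]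
    ring

/-- The fields `c(|x|²) x ∧ ∇P(x)`, linearly in `P`. -/
noncomputable def toroidalField (c : ℝ → ℝ) : Poly3 →ₗ[ℂ] R3 → C3 where
  toFun p := radialField c (rotField p)
  map_add' p q := by
    funext x
    ext i
    simp only [radialField, Pi.add_apply, PiLp.add_apply, PiLp.smul_apply, polyField_apply,
      rotField, polyWedge, gradField, polyFun_sub, polyFun_mul, polyFun_add, map_add, smul_eq_mul]
    ring
  map_smul' c p := by
    funext x
    ext i
    simp only [radialField, Pi.smul_apply, PiLp.smul_apply, polyField_apply,
      rotField, polyWedge, gradField, polyFun_sub, polyFun_mul, polyFun_smul, Derivation.map_smul,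
      smul_eq_mul, RingHom.id_apply]
    ring

/-- Square integrable fields depending linearly on a parameter give a linear map to `L²`. -/
noncomputable def toL2 {M : Type*} [AddCommGroup M] [Module ℂ M] (F : M →ₗ[ℂ] R3 → C3)
    (hF : ∀ p, MemLp (F p) 2 extMeasure) : M →ₗ[ℂ] L2Field where
  toFun p := (hF p).toLp (F p)
  map_add' p q := by
    rw [← MemLp.toLp_add]
    exact MemLp.toLp_congr _ _ (ae_of_all _ fun x => by rw [map_add])
  map_smul' c p := by
    rw [RingHom.id_apply, ← MemLp.toLp_const_smul]
    exact MemLp.toLp_congr _ _ (ae_of_all _ fun x => by rw [map_smul])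

/-- The radial profiles of an eigenfunction for the eigenvalue `-μ` with `logDecay n μ = γ`. -/
lemma exists_eigen_profile {γ μ : ℝ} (hμ : 0 < μ) {n : ℕ} (hn : logDecay n μ = γ) :
    ∃ a b b' c : ℝ → ℝ, ContDiff ℝ ∞ a ∧ ContDiff ℝ ∞ b ∧ ContDiff ℝ ∞ c ∧
      (∀ s, HasDerivAt b (b' s) s) ∧ RapidDecay a ∧ RapidDecay b ∧ RapidDecay c ∧
      RapidDecay (deriv c) ∧ (∀ s, 2 * b' s - a s = μ * c s) ∧
      (∀ s, μ * b s = (n + 1) * c s + 2 * s * deriv c s) ∧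
      (∀ s, 1 ≤ s → 2 * n * deriv c s = -μ * a s) ∧ b 1 = -γ * c 1 ∧ ∀ s, 1 ≤ s → 0 < c s := by
  obtain ⟨c, hc, hceq⟩ := exists_contDiff_eq (contDiffOn_besselRadial μ n)
  have hc1 := contDiff_deriv hc
  have hc2 := contDiff_deriv hc1
  have hd1 : ∀ s, 1 / 2 < s → deriv c s = -(1 / 2) * besselRadial μ (n + 1) s := by
    intro s hs
    have h2 : c =ᶠ[𝓝 s] besselRadial μ n := by
      filter_upwards [Ioi_mem_nhds hs] with t ht
      exact hceq t ht
    rw [h2.deriv_eq, (hasDerivAt_besselRadial μ n (by linarith)).deriv]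
  have hd2 : ∀ s, 1 / 2 < s →
      deriv (deriv c) s = -(1 / 2) * (-(1 / 2) * besselRadial μ (n + 2) s) := by
    intro s hs
    have h2 : deriv c =ᶠ[𝓝 s] fun s => -(1 / 2) * besselRadial μ (n + 1) s := by
      filter_upwards [Ioi_mem_nhds hs] with t ht
      exact hd1 t ht
    rw [h2.deriv_eq]
    exact ((hasDerivAt_besselRadial μ (n + 1) (by linarith)).const_mul (-(1 / 2))).deriv
  have hdec0 : RapidDecay c :=
    (rapidDecay_besselRadial hμ n).congr fun s hs => hceq s (by linarith)
  have hdec1 : RapidDecay (deriv c) :=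
    ((rapidDecay_besselRadial hμ (n + 1)).const_mul (-(1 / 2))).congr
      fun s hs => hd1 s (by linarith)
  -- For E = a P x + b ∇P and B = c x ∧ ∇P, the gradient part of curl B = -μE forces b, and curl E =
  -- μB forces a. The radial part of curl B = -μE is then the Bessel equation for c.
  let b : ℝ → ℝ := fun s => ((n + 1) * c s + 2 * s * deriv c s) / μ
  let b' : ℝ → ℝ := fun s => ((n + 3) * deriv c s + 2 * s * deriv (deriv c) s) / μ
  let a : ℝ → ℝ := fun s => 2 * b' s - μ * c s
  have hid : ContDiff ℝ ∞ (fun s : ℝ => s) := contDiff_id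
  have hb : ContDiff ℝ ∞ b :=
    ((contDiff_const.mul hc).add ((contDiff_const.mul hid).mul hc1)).div_const μ
  have hb' : ContDiff ℝ ∞ b' :=
    ((contDiff_const.mul hc1).add ((contDiff_const.mul hid).mul hc2)).div_const μ
  have ha : ContDiff ℝ ∞ a := (contDiff_const.mul hb').sub (contDiff_const.mul hc)
  have hode : ∀ s, 1 ≤ s → 2 * n * deriv c s = -μ * a s := by
    intro s hs
    have h := besselRadial_add_two μ n (show 0 < s by linarith)
    simp only [a, b']
    rw [hd2 s (by linarith), hd1 s (by linarith), hceq s (by linarith)]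
    field_simp
    linear_combination h
  refine ⟨a, b, b', c, ha, hb, hc, fun s => ?_, ?_, ?_, hdec0, hdec1, fun s => ?_, fun s => ?_,
    hode, ?_, fun s hs => ?_⟩
  · have p1 := (hasDerivAt_of_contDiff hc s).const_mul ((n : ℝ) + 1)
    have p2 := ((hasDerivAt_id s).const_mul 2).mul (hasDerivAt_of_contDiff hc1 s)
    refine ((p1.add p2).div_const μ).congr_deriv ?_
    simp only [b', id]
    ring
  · refine (hdec1.const_mul (-(2 * n) / μ)).congr fun s hs => ?_
    have := hode s hs
    field_simp
    linarith
  · refine ((hdec0.const_mul ((n + 1) / μ)).add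
      ((hdec1.mul_of_le (h := fun s => s) 1 1 fun s hs => by
        rw [abs_of_nonneg (by linarith)]; simp).const_mul (2 / μ))).congr fun s _ => ?_
    simp only [b]
    ring
  · simp only [a]
    ring
  · simp only [b]
    field_simp
  · have hQ := besselValue_pos n hμ
    simp only [b]
    rw [hd1 1 (by norm_num), hceq 1 (by norm_num), besselRadial_one, besselRadial_one, ← hn,
      logDecay]
    field_simp
    ring
  · rw [hceq s (by linarith)]
    exact besselRadial_pos hμ n (by linarith)

/-- On the sphere P x has no tangential part and x ∧ (x ∧ ∇P) = -(∇P)_tan, so only (b + γc)(∇P)_tan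
is left. -/
lemma boundaryCondition_poloidal {γ : ℝ} {a b c : ℝ → ℝ} (h : b 1 = -γ * c 1) (p : Poly3) :
    BoundaryCondition γ (poloidalField a b p) (toroidalField c p) := by
  intro x hx
  have hx2 : ‖x‖ ^ 2 = 1 := by rw [hx, one_pow]
  have e0 : tangential x (normal x) = 0 := by
    rw [tangential, inner_normal, dot_normal_self, hx2, Complex.ofReal_one, one_smul, sub_self]
  change tangential x (radialField a (posField p) x + radialField b (gradField p) x) -
    (γ : ℂ) • wedge (normal x) (tangential x (radialField c (rotField p) x)) = 0
  simp only [radialField, hx2, tangential_add, tangential_smul, polyField_posField, e0, wedge_smul,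
    wedge_tangential]
  rw [rotField, ← wedge_polyField, wedge_wedge x hx, h]
  push_cast
  module

/-- P is recovered from the radial component of E, since μ x · E = n(n + 1) c P with c > 0. This is
where n ≥ 1 enters. -/
lemma exists_eigen_map {γ μ : ℝ} (hμ : 0 < μ) {n : ℕ} (h1 : 1 ≤ n) (hn : logDecay n μ = γ) :
    ∃ T : harmonics n →ₗ[ℂ] eigenspace (generator γ) ((-μ : ℝ) : ℂ), Function.Injective T := by
  obtain ⟨a, b, b', c, ha, hb, hc, hbd, da, db, dc, dc1, hab, hbc, hode, hb1, hcpos⟩ :=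
    exists_eigen_profile hμ hn
  have hE : ∀ p, IsDecaying (poloidalField a b p) := fun p =>
    (isDecaying_radialField ha da _).add (isDecaying_radialField hb db _)
  have hB : ∀ p, IsDecaying (toroidalField c p) := fun p => isDecaying_radialField hc dc _
  have hcE : ∀ p, curl (poloidalField a b p) = fun x => (μ : ℂ) • toroidalField c p x := by
    intro p
    funext x
    refine (curl_add_apply (contDiff_radialField ha (posField p))
      (contDiff_radialField hb (gradField p)) x).trans ?_
    rw [curl_posField (hasDerivAt_of_contDiff ha _), curl_gradField (hbd _)]
    change _ = (μ : ℂ) • ((c (‖x‖ ^ 2) : ℝ) : ℂ) • polyField (rotField p) x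
    rw [smul_smul, ← Complex.ofReal_mul, ← hab]
    push_cast
    module
  have hcB : ∀ p ∈ harmonics n, curl (toroidalField c p) =
      poloidalField (fun s => 2 * n * deriv c s) (fun s => -μ * b s) p := by
    intro p hp
    funext x
    refine (curl_rotField (hasDerivAt_of_contDiff hc _) hp).trans ?_
    rw [← hbc]
    change _ = radialField (fun s => 2 * n * deriv c s) (posField p) x +
      radialField (fun s => -μ * b s) (gradField p) x
    simp only [radialField]
    push_cast
    module
  have hcE' : ∀ p, IsDecaying (curl (poloidalField a b p)) := fun p => by
    rw [hcE]
    exact (hB p).const_smul _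
  have hcB' : ∀ p ∈ harmonics n, IsDecaying (curl (toroidalField c p)) := fun p hp => by
    rw [hcB p hp]
    exact (isDecaying_radialField (contDiff_const.mul (contDiff_deriv hc)) (dc1.const_mul _) _).add
      (isDecaying_radialField (contDiff_const.mul hb) (db.const_mul _) _)
  let TE := toL2 ((poloidalField a b).domRestrict (harmonics n)) fun p => (hE p).memLp
  let TB := toL2 ((toroidalField c).domRestrict (harmonics n)) fun p => (hB p).memLp
  let T : harmonics n →ₗ[ℂ] StateSpace :=
    (WithLp.linearEquiv 2 ℂ (L2Field × L2Field)).symm.toLinearMap ∘ₗ TE.prod TB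
  have hT : ∀ p, T p ∈ eigenspace (generator γ) ((-μ : ℝ) : ℂ) := by
    rintro ⟨p, hp⟩
    have hm := mem_closure_of_isDecaying (hE p) (hB p) (hcE' p) (hcB' p hp)
      (boundaryCondition_poloidal hb1 p)
    rw [← generator_graph, LinearPMap.mem_graph_iff] at hm
    obtain ⟨y, e1, e2⟩ := hm
    have e1' : (y : StateSpace) = T ⟨p, hp⟩ := e1
    refine ⟨e1' ▸ y.2, ?_⟩
    have e3 : (⟨T ⟨p, hp⟩, e1' ▸ y.2⟩ : (generator γ).domain) = y := Subtype.ext e1'.symm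
    rw [e3, e2]
    refine (WithLp.equiv 2 (L2Field × L2Field)).injective (Prod.ext ?_ ?_)
    · change (hcB' p hp).memLp.toLp _ = ((-μ : ℝ) : ℂ) • (hE p).memLp.toLp _
      rw [← MemLp.toLp_const_smul]
      refine MemLp.toLp_congr _ _ ?_
      filter_upwards [ae_restrict_mem isOpen_exteriorDomain.measurableSet] with x hx
      have hs : 1 ≤ ‖x‖ ^ 2 := one_le_pow₀ (le_of_lt hx)
      rw [hcB p hp]
      change radialField (fun s => 2 * n * deriv c s) (posField p) x +
        radialField (fun s => -μ * b s) (gradField p) x = ((-μ : ℝ) : ℂ) •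
          (radialField a (posField p) x + radialField b (gradField p) x)
      simp only [radialField, hode _ hs]
      push_cast
      module
    · change -(hcE' p).memLp.toLp _ = ((-μ : ℝ) : ℂ) • (hB p).memLp.toLp _
      rw [← MemLp.toLp_const_smul, ← MemLp.toLp_neg]
      refine MemLp.toLp_congr _ _ (ae_of_all _ fun x => ?_)
      rw [hcE]
      change -((μ : ℂ) • toroidalField c p x) = ((-μ : ℝ) : ℂ) • toroidalField c p x
      push_cast
      module
  refine ⟨T.codRestrict _ hT, ?_⟩
  rw [← LinearMap.ker_eq_bot, LinearMap.ker_codRestrict, LinearMap.ker_eq_bot']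
  rintro ⟨p, hp⟩ h0
  have h2 : (hE p).memLp.toLp (poloidalField a b p) = 0 := congrArg WithLp.fst h0
  have h3 : poloidalField a b p =ᵐ[extMeasure] 0 := by
    filter_upwards [(hE p).memLp.coeFn_toLp, Lp.coeFn_zero C3 2 extMeasure] with x e1 e2
    rw [← e1, h2, e2]
  have h4 : EqOn (poloidalField a b p) 0 exteriorDomain :=
    Measure.eqOn_open_of_ae_eq h3 isOpen_exteriorDomain (hE p).contDiff.continuous.continuousOn
      continuousOn_const
  refine Subtype.ext (eq_zero_of_polyFun_eq_zero fun x hx => ?_)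
  have hs : 1 ≤ ‖x‖ ^ 2 := one_le_pow₀ (le_of_lt hx)
  have h5 : dot (normal x) (radialField a (posField p) x + radialField b (gradField p) x) = 0 := by
    rw [show radialField a (posField p) x + radialField b (gradField p) x = 0 from h4 hx,
      dot_zero_right]
  simp only [radialField, dot_add_right, dot_smul_right, dot_normal_polyField,
    polyRadial_posField, polyRadial_gradField hp.1, polyFun_mul, polyFun_normSqPoly,
    polyFun_natCast] at h5
  -- The derivatives of c contributed by a and by b cancel.
  have h6 : μ * (‖x‖ ^ 2 * a (‖x‖ ^ 2) + n * b (‖x‖ ^ 2)) = n * (n + 1) * c (‖x‖ ^ 2) := by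
    linear_combination n * hbc (‖x‖ ^ 2) + ‖x‖ ^ 2 * hode _ hs
  have h7 : ((n * (n + 1) * c (‖x‖ ^ 2) : ℝ) : ℂ) * polyFun p x = 0 := by
    rw [← h6]
    push_cast at h5 ⊢
    linear_combination (μ : ℂ) * h5
  refine (mul_eq_zero.1 h7).resolve_left (Complex.ofReal_ne_zero.2 ?_)
  have := hcpos _ hs
  have hn0 : (0 : ℝ) < n := by exact_mod_cast h1
  positivity

lemma rank_eigenspace {γ μ : ℝ} (hγ : 1 < γ) (hμ : 0 < μ) {n : ℕ} (h1 : 1 ≤ n)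
    (hn : logDecay n μ = γ) :
    Module.rank ℂ (eigenspace (generator γ) ((-μ : ℝ) : ℂ)) = ((2 * n + 1 : ℕ) : Cardinal) := by
  refine le_antisymm (rank_eigenspace_le hγ hμ hn) ?_
  obtain ⟨T, hT⟩ := exists_eigen_map hμ h1 hn
  rw [← finrank_harmonics, Module.finrank_eq_rank]
  exact LinearMap.rank_le_of_injective T hT

lemma isEigenvalue_of_rank_ne_zero {H : Type*} [AddCommGroup H] [Module ℂ H] {G : H →ₗ.[ℂ] H}
    {z : ℂ} (h : Module.rank ℂ (eigenspace G z) ≠ 0) : IsEigenvalue G z := by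
  have : Nontrivial (eigenspace G z) := rank_pos_iff_nontrivial.1 (pos_iff_ne_zero.2 h)
  obtain ⟨⟨u, hu, e⟩, h0⟩ := exists_ne (0 : eigenspace G z)
  exact ⟨⟨u, hu⟩, fun h1 => h0 (Subtype.ext h1), e⟩

end MaxwellExterior

theorem corollary3p1 (γ : ℝ) (hγ : 1 < γ) :
    ∃ lam : ℕ → ℝ,
      (∀ n : ℕ, 1 ≤ n → lam n < 0) ∧
      (∀ n : ℕ, 1 ≤ n → lam (n + 1) < lam n) ∧
      (∀ n : ℕ, 1 ≤ n →
        MaxwellExterior.IsEigenvalue (MaxwellExterior.generator γ) (lam n : ℂ) ∧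
        MaxwellExterior.geometricMultiplicity (MaxwellExterior.generator γ) (lam n : ℂ) =
          ((2 * n + 1 : ℕ) : Cardinal)) := by
  obtain ⟨m, hm0, hm1, hm2⟩ := MaxwellExterior.exists_seq_logDecay_eq hγ
  refine ⟨fun n => -m n, fun n _ => neg_neg_of_pos (hm0 n), fun n _ => neg_lt_neg (hm1 n),
    fun n hn => ?_⟩
  have hr := MaxwellExterior.rank_eigenspace hγ (hm0 n) hn (hm2 n hn)
  refine ⟨MaxwellExterior.isEigenvalue_of_rank_ne_zero ?_, hr⟩
  rw [hr]
  exact Nat.cast_ne_zero.2 (Nat.succ_ne_zero _)
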